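/- \textbf{Notation.} A fatgraph is a connected ribbon graph all of whose vertices have valency at least $3$, with $s\ge1$ faces labelled $1,\dots,s$; it has genus $g$ if $V-E+s=2-2g$. Let $2g-2+s>0$, and let $\Gamma_{g,s}$ be the set of isomorphism classes (isomorphisms respect the face labels) of fatgraphs of genus $g$ with $s$ faces. For positive integers $P_1,\dots,P_s$ the discrete volume is $$N_{g,s}(P_1,\dots,P_s)=\sum_{\gamma\in\Gamma_{g,s}}\frac{1}{|\mathrm{Aut}\,\gamma|}\,\#\{\ell:\mathrm{Edges}(\gamma)\to\mathbb Z_{>0}\ :\ \text{face } I \text{ has perimeter } P_I,\ 1\le I\le s\},$$ where an edge with the same face on both of its sides counts twice in the perimeter of this face. For $k_1,\dots,k_s\ge1$ let $\langle\prod_i\mathrm{tr}\,H^{k_i}\rangle^{\rm conn}$ be the joint cumulant of the $\mathrm{tr}\,H^{k_i}$ for the normalised Gaussian weight $e^{-\frac N2\mathrm{tr}H^2}DH$ on Hermitian $N\times N$ matrices, let $\langle\prod_i\mathrm{tr}\,H^{k_i}\rangle_g^{\rm conn}$ (independent of $N$) be defined by the finite expansion $N^{s-2}\langle\prod_i\mathrm{tr}\,H^{k_i}\rangle^{\rm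 conn}=\sum_{g\ge0}N^{-2g}\langle\prod_i\mathrm{tr}\,H^{k_i}\rangle_g^{\rm conn}$ for all $N\ge1$, and let $$W_s^{(g)}(x_1,\dots,x_s)=\sum_{k_1,\dots,k_s\ge1}\ \prod_{i=1}^s x_i^{-k_i-1}\ \Bigl\langle\prod_{i=1}^s\mathrm{tr}\,H^{k_i}\Bigr\rangle_g^{\rm conn}.$$ \textbf{Statement.} The genus expansion exists and is unique. For all $g\ge0$, $s\ge1$ with $2g-2+s>0$ the set $\Gamma_{g,s}$ is finite and the following holds. (1) If $\mathrm{Re}\,\lambda_I>0$ and $|e^{\lambda_I}+e^{-\lambda_I}|>2$ for all $I$ (in particular for all real $\lambda_I>0$), then both series below converge absolutely and $$W_s^{(g)}(e^{\lambda_1}+e^{-\lambda_1},\dots,e^{\lambda_s}+e^{-\lambda_s})=\prod_{I=1}^s\frac1{e^{\lambda_I}-e^{-\lambda_I}}\ \sum_{P_1,\dots,P_s\ge1}\ \prod_{I=1}^s P_Ie^{-P_I\lambda_I}\ N_{g,s}(P_1,\dots,P_s).$$ (2) If $\mathrm{Re}\,\lambda_I>0$ for all $I$, then, with absolute convergence,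 $$\sum_{P_1,\dots,P_s\ge1}N_{g,s}(P_1,\dots,P_s)\,e^{-\sum_IP_I\lambda_I}=\sum_{\gamma\in\Gamma_{g,s}}\frac1{|\mathrm{Aut}\,\gamma|}\prod_{e}\frac1{e^{\lambda_{I_1(e)}+\lambda_{I_2(e)}}-1},$$ where $e$ runs over the edges of $\gamma$ and $I_1(e),I_2(e)$ are the (possibly equal) faces on its two sides. (3) The Laplace transformed $N_{g,s}$ are generated by the Kontsevich--Penner matrix model: for every $N\ge1$ and all real $\lambda_1,\dots,\lambda_N>0$, with $\Lambda=\mathrm{diag}(e^{\lambda_1},\dots,e^{\lambda_N})$, $$\frac{\int DX\,e^{-\alpha N\,\mathrm{tr}[\frac12\Lambda X\Lambda X+\log(1-X)+X]}}{\int DX\,e^{-\alpha N\,\mathrm{tr}[\frac12\Lambda X\Lambda X-\frac12X^2]}}=\exp\Bigl(\sum_{\substack{g\ge0,\ s\ge1\\2g-2+s>0}}N^{2-2g}\alpha^{2-2g-s}\,\frac1{s!}\sum_{P_1,\dots,P_s\ge1}N_{g,s}(P_1,\dots,P_s)\prod_{I=1}^s\Bigl(\frac1N\sum_{i=1}^Ne^{-P_I\lambda_i}\Bigr)\Bigr).$$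 The integrals are over Hermitian $N\times N$ matrices, and the left-hand side is understood as a formal matrix integral: one substitutes $X=\alpha^{-1/2}Y$, expands $\exp\bigl(\sum_{k\ge3}\alpha^{1-k/2}\frac Nk\mathrm{tr}\,Y^k\bigr)$ in powers of $\alpha^{-1/2}$, and averages each coefficient over the Gaussian weight $e^{-\frac N2\mathrm{tr}(\Lambda Y\Lambda Y-Y^2)}DY$. Both sides are formal power series in $\alpha^{-1/2}$. -/

import Mathlib

noncomputable section

/-! ## Fatgraphs with labelled faces and the discrete volumes -/

/-- A connected fatgraph (ribbon graph) all of whose vertices have valency at least three, with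
`s` faces labelled by `Fin s`. The half-edges are `Fin n`; the cycles of `σ` are the vertices with
their cyclic orders, the orbits of the fixed-point-free involution `ι` are the edges, and the
cycles of `σ * ι` are the faces. A half-edge `d` is also read as one of the two sides of the edge
`{d, ι d}`; the face that lies on this side is `face d`. -/
structure Fatgraph (s : ℕ) where
  n : ℕ
  σ : Equiv.Perm (Fin n)
  ι : Equiv.Perm (Fin n)
  face : Fin n → Fin s
  ι_ι : ∀ d, ι (ι d) = d
  ι_ne : ∀ d, ι d ≠ d
  valency : ∀ d, σ d ≠ d ∧ σ (σ d) ≠ d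
  connected : ∀ d d', ∃ w ∈ Subgroup.closure ({σ, ι} : Set (Equiv.Perm (Fin n))), w d = d'
  face_surjective : Function.Surjective face
  face_eq_iff : ∀ d d', face d = face d' ↔ (σ * ι).SameCycle d d'

namespace Fatgraph

variable {s : ℕ}

/-- The set of edges; each edge is the unordered pair of its two half-edges. -/
def edges (G : Fatgraph s) : Finset (Sym2 (Fin G.n)) :=
  Finset.univ.image fun d => s(d, G.ι d)

/-- The number of vertices, that is, of cycles of `σ`. -/
def numVertices (G : Fatgraph s) : ℕ :=
  Nat.card (Quotient (Equiv.Perm.SameCycle.setoid G.σ))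

/-- `V - E + F = 2 - 2 g`. -/
def HasGenus (G : Fatgraph s) (g : ℕ) : Prop :=
  (G.numVertices : ℤ) - (G.edges.card : ℤ) + (s : ℤ) = 2 - 2 * (g : ℤ)

/-- Isomorphisms of fatgraphs; they respect the labels of the faces. -/
def Iso (G G' : Fatgraph s) : Type :=
  {e : Fin G.n ≃ Fin G'.n //
    (∀ d, e (G.σ d) = G'.σ (e d)) ∧ (∀ d, e (G.ι d) = G'.ι (e d)) ∧
      ∀ d, G'.face (e d) = G.face d}

/-- The order of the automorphism group. -/
def autCard (G : Fatgraph s) : ℕ := Nat.card (Iso G G)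

/-- Positive integer lengths of the edges for which the face `I` has perimeter `P I`. -/
def Lengths (G : Fatgraph s) (P : Fin s → ℕ+) : Type :=
  {len : Fin G.n → ℕ+ //
    (∀ d, len (G.ι d) = len d) ∧
      ∀ I, ∑ d ∈ Finset.univ.filter (fun d => G.face d = I), (len d : ℕ) = (P I : ℕ)}

end Fatgraph

/-- Isomorphism of genus `g` fatgraphs with `s` labelled faces. -/
instance fatgraphSetoid (g s : ℕ) : Setoid {G : Fatgraph s // G.HasGenus g} where
  r G G' := Nonempty (Fatgraph.Iso G.1 G'.1)
  iseqv :=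
    { refl := fun _ => ⟨⟨Equiv.refl _, fun _ => rfl, fun _ => rfl, fun _ => rfl⟩⟩
      symm := by
        rintro G G' ⟨e, h1, h2, h3⟩
        refine ⟨⟨e.symm, fun d => ?_, fun d => ?_, fun d => ?_⟩⟩
        · rw [Equiv.symm_apply_eq, h1, Equiv.apply_symm_apply]
        · rw [Equiv.symm_apply_eq, h2, Equiv.apply_symm_apply]
        · rw [← h3, Equiv.apply_symm_apply]
      trans := by
        rintro G G' G'' ⟨e, h1, h2, h3⟩ ⟨e', h1', h2', h3'⟩
        refine ⟨⟨e.trans e', fun d => ?_, fun d => ?_, fun d => ?_⟩⟩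
        · simp [h1, h1']
        · simp [h2, h2']
        · simp [h3, h3'] }

/-- The set `Γ_{g,s}` of isomorphism classes of fatgraphs of genus `g` with `s` labelled faces. -/
def Shape (g s : ℕ) : Type := Quotient (fatgraphSetoid g s)

/-- A representative of an isomorphism class. -/
def Shape.graph {g s : ℕ} (γ : Shape g s) : Fatgraph s := (Quotient.out γ).1

/-- The discrete volume `N_{g,s}(P_1, …, P_s)`: the number of fatgraphs with positive integer
lengths of edges and prescribed perimeters, weighted by inverse orders of automorphism groups. -/
def discreteVolume (g s : ℕ) (P : Fin s → ℕ+) : ℚ :=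
  ∑ᶠ γ : Shape g s, (Nat.card (γ.graph.Lengths P) : ℚ) / (γ.graph.autCard : ℚ)

/-- The general term of the discrete Laplace transform of `N_{g,s}`. -/
def laplaceTerm (g : ℕ) {s : ℕ} (l : Fin s → ℂ) (P : Fin s → ℕ+) : ℂ :=
  (discreteVolume g s P : ℂ) * Complex.exp (-∑ I, ((P I : ℕ) : ℂ) * l I)

/-- The discrete Laplace transform of `N_{g,s}`. -/
def laplaceVolume (g : ℕ) {s : ℕ} (l : Fin s → ℂ) : ℂ := ∑' P, laplaceTerm g l P

/-- The factor `1 / (exp (l_i + l_j) - 1)` of an edge between the faces `i` and `j`. -/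
def propagator {s : ℕ} (l : Fin s → ℂ) : Sym2 (Fin s) → ℂ :=
  Sym2.lift ⟨fun i j => 1 / (Complex.exp (l i + l j) - 1), fun i j => by simp only [add_comm]⟩

/-- The sum over shapes, weighted by `1 / |Aut|` and by the product of the edge factors. -/
def shapeSum (g : ℕ) {s : ℕ} (l : Fin s → ℂ) : ℂ :=
  ∑ᶠ γ : Shape g s,
    (1 / (γ.graph.autCard : ℂ)) * ∏ e ∈ γ.graph.edges, propagator l (e.map γ.graph.face)

/-! ## Gaussian means -/

/-- Linear real coordinates on the space of Hermitian matrices: the diagonal entries, and the real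
and imaginary parts of the entries above the diagonal. -/
def hermitianOf {N : ℕ} (A : Fin N → Fin N → ℝ) : Matrix (Fin N) (Fin N) ℂ :=
  Matrix.of fun i j =>
    if i = j then ((A i i : ℝ) : ℂ) else if i < j then ⟨A i j, A j i⟩ else ⟨A j i, -A i j⟩

theorem hermitianOf_injective (N : ℕ) :
    Function.Injective (hermitianOf : (Fin N → Fin N → ℝ) → Matrix (Fin N) (Fin N) ℂ) := by
  intro A B h
  funext i j
  have e1 := congrFun (congrFun h i) j
  have e2 := congrFun (congrFun h j) i
  simp only [hermitianOf, Matrix.of_apply] at e1 e2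
  rcases lt_trichotomy i j with hij | rfl | hij
  · simpa [hij.ne, hij] using congrArg Complex.re e1
  · simpa using e1
  · simpa [hij.ne, hij] using congrArg Complex.im e2

theorem range_hermitianOf (N : ℕ) :
    Set.range (hermitianOf : (Fin N → Fin N → ℝ) → Matrix (Fin N) (Fin N) ℂ) =
      {H | H.IsHermitian} := by
  ext H
  constructor
  · rintro ⟨A, rfl⟩
    refine Matrix.IsHermitian.ext fun i j => ?_
    simp only [hermitianOf, Matrix.of_apply]
    rcases lt_trichotomy i j with hij | rfl | hij
    · apply Complex.ext <;> simp [hij.ne, hij.ne', hij, hij.not_gt]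
    · simp
    · apply Complex.ext <;> simp [hij.ne, hij.ne', hij, hij.not_gt]
  · intro hH
    refine ⟨fun i j => if i ≤ j then (H i j).re else (H j i).im, ?_⟩
    ext i j
    have hh := hH.apply i j
    have hre : (H j i).re = (H i j).re := by
      simpa using congrArg Complex.re hh
    have him : -(H j i).im = (H i j).im := by
      simpa using congrArg Complex.im hh
    simp only [hermitianOf, Matrix.of_apply]
    rcases lt_trichotomy i j with hij | rfl | hij
    · apply Complex.ext <;> simp [hij.ne, hij, hij.le, hij.not_ge]
    · apply Complex.ext
      · simp
      · simp; linarith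
    · apply Complex.ext <;> simp [hij.ne', hij.not_gt, hij.le, hij.not_ge, hre, him]

/-- `∫ f(H) w(H) DH / ∫ w(H) DH`, over Hermitian `N × N` matrices with the Lebesgue measure. -/
def hermitianMean {N : ℕ} (w f : Matrix (Fin N) (Fin N) ℂ → ℂ) : ℂ :=
  (∫ A : Fin N → Fin N → ℝ, f (hermitianOf A) * w (hermitianOf A)) /
    ∫ A : Fin N → Fin N → ℝ, w (hermitianOf A)

/-- The Gaussian mean of `∏_{i ∈ B} tr H^{k_i}` for the weight `exp (-(N/2) tr H²)`. -/
def gaussianMean (N : ℕ) {s : ℕ} (k : Fin s → ℕ) (B : Finset (Fin s)) : ℂ :=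
  hermitianMean (N := N) (fun H => Complex.exp (-((N : ℂ) / 2) * (H * H).trace))
    (fun H => ∏ i ∈ B, (H ^ k i).trace)

/-- The connected mean (joint cumulant) of `tr H^{k_1}, …, tr H^{k_s}`: the inversion of the
formula that writes a mean as the sum over set partitions of products of connected means. -/
def gaussianConnectedMean (N : ℕ) {s : ℕ} (k : Fin s → ℕ) : ℂ :=
  ∑ p : Finpartition (Finset.univ : Finset (Fin s)),
    (-1 : ℂ) ^ (p.parts.card - 1) * ((p.parts.card - 1).factorial : ℂ) *
      ∏ B ∈ p.parts, gaussianMean N k B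

/-- `N^{s-2} ⟨∏ tr H^{k_i}⟩^conn = ∑_g N^{-2g} c_g` for all matrix sizes `N`. -/
def IsGenusExpansion {s : ℕ} (k : Fin s → ℕ) (c : ℕ →₀ ℂ) : Prop :=
  ∀ N : ℕ, 1 ≤ N →
    (N : ℂ) ^ ((s : ℤ) - 2) * gaussianConnectedMean N k =
      c.sum fun g a => a * (N : ℂ) ^ (-2 * (g : ℤ))

open Classical in
/-- The genus `g` part `⟨∏ tr H^{k_i}⟩_g^conn` of the connected mean. -/
def genusMean (g : ℕ) {s : ℕ} (k : Fin s → ℕ) : ℂ :=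
  if h : ∃ c : ℕ →₀ ℂ, IsGenusExpansion k c then h.choose g else 0

/-- The general term of the series for `W_s^{(g)}(x_1, …, x_s)`. -/
def resolventTerm (g : ℕ) {s : ℕ} (x : Fin s → ℂ) (k : Fin s → ℕ+) : ℂ :=
  (∏ i, x i ^ (-((k i : ℕ) : ℤ) - 1)) * genusMean g fun i => (k i : ℕ)

/-- The Gaussian correlation function `W_s^{(g)}(x_1, …, x_s)` for `2 g - 2 + s > 0`. -/
def gaussianCorrelator (g : ℕ) {s : ℕ} (x : Fin s → ℂ) : ℂ := ∑' k, resolventTerm g x k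

/-- The general term of the transform of `N_{g,s}` with weights `P_I exp (-P_I l_I)`. -/
def weightedLaplaceTerm (g : ℕ) {s : ℕ} (l : Fin s → ℂ) (P : Fin s → ℕ+) : ℂ :=
  (∏ I, ((P I : ℕ) : ℂ) * Complex.exp (-((P I : ℕ) : ℂ) * l I)) * (discreteVolume g s P : ℂ)

/-! ## The Kontsevich–Penner matrix model

The integral is the usual formal one: with `α = t⁻²` and `X = t Y`, the exponent becomes
`-(N/2) tr (Λ Y Λ Y - Y²) + N ∑_{k ≥ 3} t^{k-2} tr Y^k / k`; the exponential of the second summand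
is expanded in powers of `t` and its coefficients are averaged over the Gaussian weight that is the
exponential of the first one. -/

/-- `-N t⁻² tr (log (1 - t Y) + t Y + t² Y² / 2) = ∑_{m ≥ 1} N t^m tr Y^{m+2} / (m+2)`. -/
def kpmmInteraction {N : ℕ} (Y : Matrix (Fin N) (Fin N) ℂ) : PowerSeries ℂ :=
  PowerSeries.mk fun m =>
    if m = 0 then 0 else (N : ℂ) * (Y ^ (m + 2)).trace / ((m + 2 : ℕ) : ℂ)

/-- The Gaussian weight `exp (-N tr (Λ Y Λ Y / 2 - Y² / 2))` with `Λ = diag (exp l_i)`. -/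
def kpmmWeight {N : ℕ} (l : Fin N → ℝ) (Y : Matrix (Fin N) (Fin N) ℂ) : ℂ :=
  let L : Matrix (Fin N) (Fin N) ℂ := Matrix.diagonal fun i => (Real.exp (l i) : ℂ)
  Complex.exp (-(N : ℂ) * ((1 / 2) * (L * Y * L * Y).trace - (1 / 2) * (Y * Y).trace))

/-- The partition function of the Kontsevich–Penner matrix model, as a series in `t = α^{-1/2}`. -/
def kpmmPartitionFunction {N : ℕ} (l : Fin N → ℝ) : PowerSeries ℂ :=
  PowerSeries.mk fun m =>
    hermitianMean (kpmmWeight l) fun Y =>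
      PowerSeries.coeff m ((PowerSeries.exp ℂ).subst (kpmmInteraction Y))

/-- The series `∑ N^{2-2g} α^{2-2g-s} (1/s!) ∑_P N_{g,s}(P) ∏_I ((1/N) ∑_i exp (-P_I l_i))` over
`g ≥ 0`, `s ≥ 1`, `2 g - 2 + s > 0`, in the variable `t = α^{-1/2}`; the product over `I` of sums
over `i` is expanded. The coefficient of `t^m` collects the finitely many pairs `(g, s)` with
`2 (2 g - 2 + s) = m`. -/
def volumeGeneratingSeries {N : ℕ} (l : Fin N → ℝ) : PowerSeries ℂ :=
  PowerSeries.mk fun m =>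
    ∑ p ∈ (Finset.range (m + 3) ×ˢ Finset.range (m + 3)).filter
        (fun p => 0 < p.2 ∧ 2 < 2 * p.1 + p.2 ∧ 2 * (2 * p.1 + p.2) = m + 4),
      (N : ℂ) ^ (2 - 2 * (p.1 : ℤ)) * (1 / (p.2.factorial : ℂ)) *
        ((1 / (N : ℂ) ^ p.2) *
          ∑ i : Fin p.2 → Fin N, laplaceVolume p.1 fun I => ((l (i I) : ℝ) : ℂ))

end

/-!
Ribbon graphs are pairs of permutations of the half-edges: `σ` for the vertices and a fixed-point
free involution `ι` for the edges, so that `σ * ι` describes the faces. Both matrix integrals become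
sums over such pairs by Wick's theorem (`IsGaussianWeight.mean_traces`): a mean of a product of
traces, one for each cycle of a permutation, is a sum over pairings, and the sum over the matrix
indices becomes a sum over colourings of the faces.

*Genus expansion.* A cumulant is a Möbius inversion over set partitions, which leaves exactly the
pairings that connect all traces (`sum_cumulant_weights`, `gaussianConnectedMean_eq`). The exponent
of `N` is an Euler characteristic, and a connected map has a genus which is a natural number
(`exists_genus`, from the fact that a transposition splits or joins two cycles). Hence the
coefficients of the expansion are numbers of gluings of stars (`genusMean_eq_gluingCount`), and they
are unique since a polynomial in `N⁻²` is determined by its values.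

*Laplace transform.* The lengths of the edges of a fatgraph are independent, so the sum over them is
a product of geometric series, one for each edge (`laplaceVolume_eq_shapeSum`). By orbit counting, a
sum over isomorphism classes with the weights `1 / |Aut|` is a sum over fatgraphs on `Fin n` with
the weights `1 / n!` (`sum_shape_eq`); all counting is done with these. The sets are finite since
valencies of at least three bound the number of half-edges by genus and number of faces.

*Correlators.* The stars of the Gaussian moments are dual to the fatgraphs: the cycles of the
rotation `φ` of the stars become the boundaries of faces. A pairing of an element `x` with `φ x` is
an edge with a univalent end. The removal of such edges keeps the genus and shortens one cycle by
two; imposing their absence at one element of a cycle after the other leads to the recursion of the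
Chebyshev polynomials (`expand_of_recursion`). Consequently a gluing of cycles of lengths `k` is
a reduced gluing of cycles of lengths `P ≤ k`, with multiplicity given by the coefficients
`backtrackCount` of `(z + z⁻¹) ^ k` (`gluingCount_expand`). A reduced gluing has no univalent
vertices, and contraction of its bivalent vertices yields a fatgraph with edges of integer lengths
and one marked point on the boundary of each face; there are `∏ I, P I * N_{g,s}(P)` of them
(`CircleSystem.reducedCount_eq`). The resolvent sum over `k` is `q ^ P / (q⁻¹ - q)` with
`q = exp (-λ)` (`tsum_backtrack`), and the two orders of summation in the double series over `k` and
`P` are the two sides of the identity (`correlator_eq`). The double series converges absolutely: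
`‖x‖ > 2` is itself of the form `e ^ m + e ^ (-m)` with `m > 0`, and the terms are dominated by
those at the parameter `m`.

*Matrix model.* The exponential formula holds for every weight on families of permutations of finite
sets that is multiplicative under disjoint unions (`MulWeight.totalSeries_eq_exp`). For a single
permutation, weighted with the traces of `Y`, it says that the exponential of the interaction is a
sum over systems of vertices (`connectedSeries_vertexWeight`). Wick's theorem adds a pairing, and
for pairs of permutations the same formula says that the logarithm is the sum over connected
ribbon graphs. These are fatgraphs with unlabelled faces that carry matrix indices as colours;
Euler's formula collects the powers of `N`, and the expression of the Laplace transforms as sums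
over fatgraphs identifies the result (`ribbon_eq_sum_fatgraphs`, `kpmmPartitionFunction_eq_exp`).
-/

noncomputable section

open Equiv Equiv.Perm

/-! ### Cycles of permutations, pairings and Euler's inequality -/

theorem perm_apply_inv {X : Type*} (σ : Perm X) (x : X) : σ (σ⁻¹ x) = x :=
  σ.apply_symm_apply x

/-- A pairing: an involution without fixed points. -/
def IsPairing {X : Type*} (ι : Perm X) : Prop := (∀ d, ι (ι d) = d) ∧ ∀ d, ι d ≠ d

/-- The number of cycles of a permutation, fixed points included. -/
def cyc {X : Type*} (σ : Perm X) : ℕ := Nat.card (Quotient (SameCycle.setoid σ))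

/-- Two permutations act transitively: every predicate that is invariant under both is constant. -/
def Conn {X : Type*} (σ ι : Perm X) : Prop :=
  ∀ f : X → Prop, (∀ x, f (σ x) ↔ f x) → (∀ x, f (ι x) ↔ f x) → ∀ x y, f x ↔ f y

theorem sameCycle_iff_forall_invariant {X : Type*} (σ : Perm X) (x y : X) :
    SameCycle σ x y ↔ ∀ f : X → Prop, (∀ z, f (σ z) ↔ f z) → (f x ↔ f y) := by
  constructor
  · rintro ⟨i, rfl⟩ f hf
    have hnat : ∀ (n : ℕ) z, f ((σ ^ n) z) ↔ f z := by
      intro n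
      induction n with
      | zero => simp
      | succ n ih => intro z; rw [pow_succ', mul_apply, hf, ih]
    obtain ⟨n, rfl | rfl⟩ := i.eq_nat_or_neg
    · simpa using (hnat n x).symm
    · have := hnat n ((σ ^ (-(n : ℤ))) x)
      rwa [← mul_apply, ← zpow_natCast, ← zpow_add, add_neg_cancel, zpow_zero, one_apply] at this
  · intro h
    exact (h (fun z => SameCycle σ x z) (fun z => sameCycle_apply_right)).1 (SameCycle.refl _ _)

theorem SameCycle.congr_invariant {X α : Type*} {σ : Perm X} {x y : X} (h : SameCycle σ x y)
    {f : X → α} (hf : ∀ z, f (σ z) = f z) : f x = f y :=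
  (((sameCycle_iff_forall_invariant σ x y).1 h (fun z => f z = f y)
    (fun z => by rw [hf])).2 rfl)

theorem sameCycle_semiconj {X Y : Type*} {σ : Perm X} {τ : Perm Y} (e : X → Y)
    (he : ∀ x, e (σ x) = τ (e x)) {x y : X} (h : SameCycle σ x y) :
    SameCycle τ (e x) (e y) :=
  ((sameCycle_iff_forall_invariant σ x y).1 h (fun z => SameCycle τ (e x) (e z))
    (fun z => by rw [he, sameCycle_apply_right])).1 (SameCycle.refl _ _)

theorem sameCycle_equiv {X Y : Type*} {σ : Perm X} {τ : Perm Y} (e : X ≃ Y)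
    (he : ∀ x, e (σ x) = τ (e x)) {x y : X} :
    SameCycle τ (e x) (e y) ↔ SameCycle σ x y := by
  refine ⟨fun h => ?_, sameCycle_semiconj e he⟩
  have := sameCycle_semiconj (σ := τ) (τ := σ) e.symm
    (fun z => by rw [symm_apply_eq, he, apply_symm_apply]) h
  simpa using this

theorem cyc_congr {X Y : Type*} {σ : Perm X} {τ : Perm Y} (e : X ≃ Y)
    (he : ∀ x, e (σ x) = τ (e x)) : cyc σ = cyc τ :=
  Nat.card_congr (Quotient.congr e fun _ _ => (sameCycle_equiv e he).symm)

theorem cyc_mul_comm {X : Type*} (σ τ : Perm X) : cyc (σ * τ) = cyc (τ * σ) :=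
  cyc_congr τ fun x => by simp

theorem Conn.congr {X Y : Type*} {σ ι : Perm X} {σ' ι' : Perm Y} (e : X ≃ Y)
    (he : ∀ x, e (σ x) = σ' (e x)) (hi : ∀ x, e (ι x) = ι' (e x)) (h : Conn σ ι) :
    Conn σ' ι' := by
  intro f h1 h2 x y
  have := h (fun z => f (e z)) (fun z => by rw [he, h1]) (fun z => by rw [hi, h2])
    (e.symm x) (e.symm y)
  simpa using this

theorem IsPairing.congr {X Y : Type*} {ι : Perm X} {ι' : Perm Y} (e : X ≃ Y)
    (hi : ∀ x, e (ι x) = ι' (e x)) (h : IsPairing ι) : IsPairing ι' := by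
  constructor
  · intro d
    have := h.1 (e.symm d)
    rw [← e.apply_eq_iff_eq, hi, hi] at this
    simpa using this
  · intro d hd
    refine h.2 (e.symm d) ?_
    rw [← e.apply_eq_iff_eq, hi]
    simpa using hd

theorem IsPairing.mul_self {X : Type*} {ι : Perm X} (h : IsPairing ι) : ι * ι = 1 := by
  ext d; simp [h.1]

/-- Transitivity in terms of the subgroup that the two permutations generate. -/
theorem conn_iff_closure {X : Type*} (σ ι : Perm X) :
    Conn σ ι ↔ ∀ d d', ∃ w ∈ Subgroup.closure ({σ, ι} : Set (Perm X)), w d = d' := by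
  constructor
  · intro h d d'
    have hinv : ∀ τ ∈ Subgroup.closure ({σ, ι} : Set (Perm X)), ∀ x,
        (∃ w ∈ Subgroup.closure ({σ, ι} : Set (Perm X)), w d = τ x) ↔
        ∃ w ∈ Subgroup.closure ({σ, ι} : Set (Perm X)), w d = x := by
      intro τ hτ x
      constructor
      · rintro ⟨w, hw, h⟩
        exact ⟨τ⁻¹ * w, mul_mem (inv_mem hτ) hw, by simp [h]⟩
      · rintro ⟨w, hw, h⟩
        exact ⟨τ * w, mul_mem hτ hw, by simp [h]⟩
    refine (h (fun z => ∃ w ∈ Subgroup.closure ({σ, ι} : Set (Perm X)), w d = z)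
      (hinv σ (Subgroup.subset_closure (by simp)))
      (hinv ι (Subgroup.subset_closure (by simp))) d d').1 ⟨1, one_mem _, rfl⟩
  · intro h f h1 h2 x y
    obtain ⟨w, hw, rfl⟩ := h x y
    have : ∀ z, f (w z) ↔ f z := by
      induction hw using Subgroup.closure_induction with
      | mem τ hτ =>
        rcases hτ with rfl | hτ
        · exact h1
        · rw [Set.mem_singleton_iff.1 hτ]; exact h2
      | one => simp
      | mul a b _ _ ha hb => intro z; rw [mul_apply, ha, hb]
      | inv a _ ha => intro z; rw [← ha (a⁻¹ z), perm_apply_inv]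
    exact (this x).symm

/-- Each class is counted by its points, each with the inverse size of the class. -/
theorem card_quotient_eq_sum {X : Type*} [Fintype X] (s : Setoid X) :
    (Nat.card (Quotient s) : ℚ) = ∑ x, 1 / (Nat.card {y // s x y} : ℚ) := by
  classical
  rw [← Finset.sum_fiberwise (g := fun x => (Quotient.mk s x))]
  rw [Nat.card_eq_fintype_card, Fintype.card, Finset.cast_card]
  refine Finset.sum_congr rfl fun q _ => ?_
  induction q using Quotient.inductionOn with
  | h a =>
    have : ∀ x ∈ Finset.univ.filter (fun x => Quotient.mk s x = Quotient.mk s a),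
        1 / (Nat.card {y // s x y} : ℚ) =
          1 / ((Finset.univ.filter (fun x => Quotient.mk s x = Quotient.mk s a)).card : ℚ) := by
      intro x hx
      have hx' := (Finset.mem_filter.1 hx).2
      congr 2
      rw [Nat.card_eq_fintype_card, Fintype.card_subtype]
      congr 1
      ext y
      simp only [Finset.mem_filter, Finset.mem_univ, true_and]
      rw [← hx', Quotient.eq]
      exact ⟨fun h => s.symm h, fun h => s.symm h⟩
    rw [Finset.sum_congr rfl this, Finset.sum_const, nsmul_eq_mul, mul_one_div_cancel]
    rw [Nat.cast_ne_zero, ← Nat.pos_iff_ne_zero, Finset.card_pos]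
    exact ⟨a, by simp⟩

theorem card_sameCycle {X : Type*} [Finite X] (σ : Perm X) (x : X) :
    Nat.card {y // SameCycle σ x y} = Function.minimalPeriod σ x := by
  classical
  have := Fintype.ofFinite X
  have h := MulAction.minimalPeriod_eq_card (a := σ) (b := x)
  have h2 : (fun y => σ • y) = σ := rfl
  rw [h2] at h
  rw [h, ← Nat.card_eq_fintype_card]
  refine Nat.card_congr (Equiv.subtypeEquivRight fun y => ?_)
  rw [MulAction.mem_orbit_iff]
  constructor
  · rintro ⟨i, rfl⟩
    exact ⟨⟨σ ^ i, i, rfl⟩, rfl⟩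
  · rintro ⟨⟨_, i, rfl⟩, rfl⟩
    exact ⟨i, rfl⟩

/-- The number of cycles as a sum of local terms. -/
theorem cyc_eq_sum {X : Type*} [Fintype X] (σ : Perm X) :
    (cyc σ : ℚ) = ∑ x, 1 / (Function.minimalPeriod σ x : ℚ) := by
  rw [cyc, card_quotient_eq_sum]
  exact Finset.sum_congr rfl fun x _ => by rw [← card_sameCycle σ x]; rfl

theorem minimalPeriod_semiconj {X Y : Type*} {σ : Perm X} {τ : Perm Y} {e : X → Y}
    (hinj : Function.Injective e) (he : ∀ x, e (σ x) = τ (e x)) (x : X) :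
    Function.minimalPeriod τ (e x) = Function.minimalPeriod σ x := by
  have hit : ∀ n, (τ^[n]) (e x) = e ((σ^[n]) x) := fun n =>
    ((Function.Semiconj.iterate_right (f := e) (ga := σ) (gb := τ) he n) x).symm
  refine Nat.dvd_antisymm ?_ ?_
  · refine Function.IsPeriodicPt.minimalPeriod_dvd ?_
    rw [Function.IsPeriodicPt, Function.IsFixedPt, hit, Function.iterate_minimalPeriod]
  · refine Function.IsPeriodicPt.minimalPeriod_dvd ?_
    rw [Function.IsPeriodicPt, Function.IsFixedPt]
    apply hinj
    rw [← hit, Function.iterate_minimalPeriod]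

theorem card_invariant_functions {X : Type*} [Fintype X] [DecidableEq X] (σ : Perm X) (N : ℕ) :
    Nat.card {f : X → Fin N // ∀ x, f (σ x) = f x} = N ^ cyc σ := by
  classical
  have e : {f : X → Fin N // ∀ x, f (σ x) = f x} ≃ (Quotient (SameCycle.setoid σ) → Fin N) :=
    { toFun := fun f q => Quotient.lift f.1 (fun _ _ h => SameCycle.congr_invariant h f.2) q
      invFun := fun g => ⟨fun x => g (Quotient.mk _ x), fun x => congrArg g
        (Quotient.sound (s := SameCycle.setoid σ)
          (show SameCycle σ (σ x) x from sameCycle_apply_left.2 (SameCycle.refl _ _)))⟩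
      left_inv := fun f => rfl
      right_inv := fun g => by
        funext q
        induction q using Quotient.inductionOn with
        | h a => rfl }
  rw [Nat.card_congr e, Nat.card_fun, Nat.card_fin, cyc]

/-- The equivalence relation generated by `s` and the pair `(a, b)`. -/
def glue {X : Type*} (s : Setoid X) (a b : X) : Setoid X where
  r x y := s x y ∨ (s x a ∧ s b y) ∨ (s x b ∧ s a y)
  iseqv :=
    { refl := fun x => Or.inl (s.refl x)
      symm := by
        rintro x y (h | ⟨h1, h2⟩ | ⟨h1, h2⟩)
        · exact Or.inl (s.symm h)
        · exact Or.inr (Or.inr ⟨s.symm h2, s.symm h1⟩)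
        · exact Or.inr (Or.inl ⟨s.symm h2, s.symm h1⟩)
      trans := by
        rintro x y z (h | ⟨h1, h2⟩ | ⟨h1, h2⟩) (h' | ⟨h1', h2'⟩ | ⟨h1', h2'⟩)
        · exact Or.inl (s.trans h h')
        · exact Or.inr (Or.inl ⟨s.trans h h1', h2'⟩)
        · exact Or.inr (Or.inr ⟨s.trans h h1', h2'⟩)
        · exact Or.inr (Or.inl ⟨h1, s.trans h2 h'⟩)
        · exact Or.inl (s.trans h1 (s.trans (s.symm (s.trans h2 h1')) h2'))
        · exact Or.inl (s.trans h1 h2')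
        · exact Or.inr (Or.inr ⟨h1, s.trans h2 h'⟩)
        · exact Or.inl (s.trans h1 h2')
        · exact Or.inl (s.trans h1 (s.trans (s.symm (s.trans h2 h1')) h2')) }

theorem glue_le_iff {X : Type*} {s t : Setoid X} {a b : X} :
    glue s a b ≤ t ↔ s ≤ t ∧ t a b := by
  constructor
  · intro h
    exact ⟨fun x y hxy => h (Or.inl hxy), h (Or.inr (Or.inl ⟨s.refl _, s.refl _⟩))⟩
  · rintro ⟨h1, h2⟩ x y (h | ⟨h3, h4⟩ | ⟨h3, h4⟩)
    · exact h1 h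
    · exact t.trans (h1 h3) (t.trans h2 (h1 h4))
    · exact t.trans (h1 h3) (t.trans (t.symm h2) (h1 h4))

theorem card_glue_of_rel {X : Type*} {s : Setoid X} {a b : X} (h : s a b) :
    Nat.card (Quotient (glue s a b)) = Nat.card (Quotient s) := by
  have : glue s a b = s :=
    le_antisymm (glue_le_iff.2 ⟨le_rfl, h⟩) (glue_le_iff (s := s).1 le_rfl).1
  rw [this]

theorem card_glue_of_not_rel {X : Type*} [Finite X] {s : Setoid X} {a b : X} (h : ¬ s a b) :
    Nat.card (Quotient (glue s a b)) + 1 = Nat.card (Quotient s) := by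
  classical
  have := Fintype.ofFinite X
  have hle := (glue_le_iff (s := s) (t := glue s a b) (a := a) (b := b)).1 le_rfl
  let F : {q : Quotient s // q ≠ Quotient.mk s b} → Quotient (glue s a b) := fun q =>
    Quotient.map' (s₁ := s) (s₂ := glue s a b) id (fun x y hxy => hle.1 hxy) q.1
  have hF : Function.Bijective F := by
    constructor
    · rintro ⟨q, hq⟩ ⟨q', hq'⟩ hqq
      induction q using Quotient.inductionOn with
      | h x =>
        induction q' using Quotient.inductionOn with
        | h y =>
          have h1 : glue s a b x y := Quotient.exact hqq
          refine Subtype.ext (Quotient.sound ?_)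
          rcases h1 with h1 | ⟨_, h1⟩ | ⟨h1, _⟩
          · exact h1
          · exact absurd (Quotient.sound (s.symm h1)) hq'
          · exact absurd (Quotient.sound h1) hq
    · intro q
      induction q using Quotient.inductionOn with
      | h x =>
        by_cases hx : s x b
        · refine ⟨⟨Quotient.mk s a, fun hh => h (Quotient.exact hh)⟩, ?_⟩
          exact Quotient.sound (s := glue s a b)
            ((glue s a b).trans hle.2 (hle.1 (s.symm hx)))
        · exact ⟨⟨Quotient.mk s x, fun hh => hx (Quotient.exact hh)⟩, rfl⟩
  rw [← Nat.card_congr (Equiv.ofBijective F hF), Nat.card_eq_fintype_card,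
    Nat.card_eq_fintype_card, Fintype.card_subtype_compl, Fintype.card_subtype_eq]
  have : 0 < Fintype.card (Quotient s) := Fintype.card_pos_iff.2 ⟨Quotient.mk s b⟩
  omega

theorem sameCycle_le_iff {X : Type*} {σ : Perm X} {r : Setoid X} :
    SameCycle.setoid σ ≤ r ↔ ∀ x, r x (σ x) := by
  constructor
  · intro h x
    exact h (show SameCycle σ x (σ x) from sameCycle_apply_right.2 (SameCycle.refl _ _))
  · intro h x y hxy
    refine ((sameCycle_iff_forall_invariant σ x y).1 hxy (fun z => r x z) fun z => ?_).1 (r.refl x)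
    exact ⟨fun h' => r.trans h' (r.symm (h z)), fun h' => r.trans h' (h z)⟩

theorem sameCycle_swap_mul_le {X : Type*} [DecidableEq X] {σ : Perm X} {r : Setoid X} {a b : X}
    (h : SameCycle.setoid σ ≤ r) (hab : r a b) : SameCycle.setoid (swap a b * σ) ≤ r := by
  rw [sameCycle_le_iff] at h ⊢
  intro x
  refine r.trans (h x) ?_
  rw [mul_apply, swap_apply_def]
  split_ifs with h1 h2
  · rw [h1]; exact hab
  · rw [h2]; exact r.symm hab
  · exact r.refl _

/-- Up to the pair `(a, b)`, multiplication by the transposition of `a` and `b` does not change the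
equivalence relation of the cycles. -/
theorem glue_swap_mul {X : Type*} [DecidableEq X] (σ : Perm X) (a b : X) :
    glue (SameCycle.setoid (swap a b * σ)) a b = glue (SameCycle.setoid σ) a b := by
  have key : ∀ σ : Perm X,
      glue (SameCycle.setoid (swap a b * σ)) a b ≤ glue (SameCycle.setoid σ) a b := by
    intro σ
    have := (glue_le_iff (s := SameCycle.setoid σ) (a := a) (b := b)).1 le_rfl
    exact glue_le_iff.2 ⟨sameCycle_swap_mul_le this.1 this.2, this.2⟩
  refine le_antisymm (key σ) ?_
  have := key (swap a b * σ)
  rwa [← mul_assoc, swap_mul_self, one_mul] at this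

theorem invariant_of_mapsTo {X : Type*} [Finite X] {σ : Perm X} {A : X → Prop}
    (h : ∀ x, A x → A (σ x)) (x : X) : A (σ x) ↔ A x := by
  refine ⟨fun hx => ?_, h x⟩
  let F : {x // A x} → {x // A x} := fun y => ⟨σ y.1, h _ y.2⟩
  have hF : Function.Injective F := fun y z hyz => Subtype.ext (σ.injective (congrArg (·.1) hyz))
  obtain ⟨y, hy⟩ := Finite.injective_iff_surjective.1 hF ⟨σ x, hx⟩
  rw [← σ.injective (congrArg (·.1) hy)]
  exact y.2

/-- Multiplication by a transposition splits a cycle that contains both points. -/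
theorem not_sameCycle_swap_mul {X : Type*} [Finite X] [DecidableEq X] {σ : Perm X} {a b : X}
    (hab : a ≠ b) (h : SameCycle σ a b) : ¬ SameCycle (swap a b * σ) a b := by
  classical
  obtain ⟨m₀, hm₀⟩ := h.exists_nat_pow_eq
  have hex : ∃ m : ℕ, (σ ^ m) a = b := ⟨m₀, hm₀⟩
  set m := Nat.find hex with hm
  have hmb : (σ ^ m) a = b := Nat.find_spec hex
  have hmin : ∀ i, i < m → (σ ^ i) a ≠ b := fun i hi => Nat.find_min hex hi
  have hm0 : 0 < m := by
    rcases Nat.eq_zero_or_pos m with h0 | h0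
    · rw [h0] at hmb; exact absurd hmb hab
    · exact h0
  intro hc
  have hstep : ∀ x, (∃ i < m, (σ ^ i) a = x) → ∃ i < m, (σ ^ i) a = (swap a b * σ) x := by
    rintro x ⟨i, hi, rfl⟩
    have hpow : (swap a b * σ) ((σ ^ i) a) = swap a b ((σ ^ (i + 1)) a) := by
      rw [pow_succ']; rfl
    rw [hpow]
    rcases (Nat.succ_le_of_lt hi).lt_or_eq with h1 | h1
    · have hne : (σ ^ (i + 1)) a ≠ a := by
        intro hh
        refine hmin (m - (i + 1)) (by omega) ?_
        rw [← hmb]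
        conv_rhs => rw [← Nat.sub_add_cancel h1.le, pow_add, mul_apply, Nat.succ_eq_add_one, hh]
      rw [swap_apply_of_ne_of_ne hne (hmin _ h1)]
      exact ⟨i + 1, h1, rfl⟩
    · refine ⟨0, hm0, ?_⟩
      rw [show i + 1 = m from h1, hmb, swap_apply_right]; rfl
  have hA := (sameCycle_iff_forall_invariant _ a b).1 hc (fun x => ∃ i < m, (σ ^ i) a = x)
    (invariant_of_mapsTo hstep)
  obtain ⟨i, hi, hib⟩ := hA.1 ⟨0, hm0, rfl⟩
  exact hmin i hi hib

/-- Multiplication by a transposition joins the cycles of its two points if they differ. -/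
theorem sameCycle_swap_mul {X : Type*} [Finite X] [DecidableEq X] {σ : Perm X} {a b : X}
    (h : ¬ SameCycle σ a b) : SameCycle (swap a b * σ) a b := by
  rw [sameCycle_iff_forall_invariant]
  intro f hf
  -- otherwise the part of the `σ`-cycle of `a` on which `f` takes the value `f a` would be
  -- `σ`-invariant and would not contain a preimage of `a`
  by_contra hne
  let A : X → Prop := fun x => (f x ↔ f a) ∧ SameCycle σ a x
  have hstep : ∀ x, A x → A (σ x) ∧ σ x ≠ a := by
    rintro x ⟨hx1, hx2⟩
    have hx3 : SameCycle σ a (σ x) := sameCycle_apply_right.2 hx2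
    have hb : σ x ≠ b := fun hh => h (hh ▸ hx3)
    have hfx := hf x
    rw [mul_apply] at hfx
    have ha : σ x ≠ a := by
      intro hh
      rw [hh, swap_apply_left] at hfx
      exact hne (hx1.symm.trans hfx.symm)
    rw [swap_apply_of_ne_of_ne ha hb] at hfx
    exact ⟨⟨hfx.trans hx1, hx3⟩, ha⟩
  have hinv := invariant_of_mapsTo (A := A) (σ := σ) fun x hx => (hstep x hx).1
  have h1 : A (σ⁻¹ a) := by
    rw [← hinv, perm_apply_inv]
    exact ⟨Iff.rfl, SameCycle.refl _ _⟩
  exact (hstep _ h1).2 (perm_apply_inv _ _)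

theorem cyc_swap_mul_of_sameCycle {X : Type*} [Finite X] [DecidableEq X] {σ : Perm X} {a b : X}
    (hab : a ≠ b) (h : SameCycle σ a b) : cyc (swap a b * σ) = cyc σ + 1 := by
  have h1 := card_glue_of_rel (s := SameCycle.setoid σ) h
  have h2 := card_glue_of_not_rel (s := SameCycle.setoid (swap a b * σ))
    (not_sameCycle_swap_mul hab h)
  rw [glue_swap_mul] at h2
  rw [cyc, cyc]; omega

theorem cyc_swap_mul_of_not_sameCycle {X : Type*} [Finite X] [DecidableEq X] {σ : Perm X} {a b : X}
    (h : ¬ SameCycle σ a b) : cyc (swap a b * σ) + 1 = cyc σ := by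
  have h1 := card_glue_of_not_rel (s := SameCycle.setoid σ) h
  have h2 := card_glue_of_rel (s := SameCycle.setoid (swap a b * σ))
    (sameCycle_swap_mul h)
  rw [glue_swap_mul] at h2
  rw [cyc, cyc]; omega

/-- Euler's inequality before connectedness is used: `r` collects the points that are joined by
`σ` and `ι`. The transpositions of `ι` are multiplied to `σ` one at a time; each changes the number
of cycles by one, and it can only split a cycle if it does not join two classes of `r`. -/
theorem exists_setoid_euler {X : Type*} [Fintype X] [DecidableEq X] (σ : Perm X) (n : ℕ) :
    ∀ ι : Perm X, (∀ x, ι (ι x) = x) → ι.support.card = 2 * n →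
      ∃ r : Setoid X, SameCycle.setoid σ ≤ r ∧ (∀ x, r x (ι x)) ∧
        SameCycle.setoid (ι * σ) ≤ r ∧
        cyc (ι * σ) + cyc σ ≤ 2 * Nat.card (Quotient r) + n ∧
        Even (cyc (ι * σ) + cyc σ + n) := by
  induction n with
  | zero =>
    intro ι hι hs
    have : ι = 1 := by simpa using hs
    subst this
    refine ⟨SameCycle.setoid σ, le_rfl, fun x => SameCycle.refl _ _, by rw [one_mul], ?_, ?_⟩
    · rw [one_mul, cyc]; omega
    · rw [one_mul]; exact ⟨cyc σ, by omega⟩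
  | succ n ih =>
    intro ι hι hs
    obtain ⟨a, ha⟩ : ι.support.Nonempty := by rw [← Finset.card_pos]; omega
    have hab : ι a ≠ a := mem_support.1 ha
    have hsupp : (swap a (ι a) * ι).support = ι.support \ {a, ι a} := by
      ext x
      simp only [mem_support, Finset.mem_sdiff, Finset.mem_insert, Finset.mem_singleton,
        mul_apply]
      by_cases h1 : x = a
      · subst h1; simp
      by_cases h2 : x = ι a
      · subst h2; simp [hι]
      have h3 : ι x ≠ a := fun hh => h2 (by rw [← hh, hι])
      have h4 : ι x ≠ ι a := fun hh => h1 (ι.injective hh)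
      rw [swap_apply_of_ne_of_ne h3 h4]
      tauto
    have hcard : (swap a (ι a) * ι).support.card = 2 * n := by
      rw [hsupp, Finset.card_sdiff_of_subset, Finset.card_pair hab.symm, hs]
      · omega
      · intro x hx
        rcases Finset.mem_insert.1 hx with rfl | hx
        · exact ha
        · rw [Finset.mem_singleton.1 hx, mem_support, hι]; exact hab.symm
    have hinv : ∀ x, (swap a (ι a) * ι) ((swap a (ι a) * ι) x) = x := by
      have : swap a (ι a) * ι = ι * swap a (ι a) := by
        rw [mul_swap_eq_swap_mul, hι, swap_comm]
      intro x
      rw [← mul_apply]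
      conv_lhs => arg 1; arg 1; rw [this]
      rw [mul_assoc, swap_mul_self_mul, mul_apply, hι]
    obtain ⟨r, h1, h2, h3, h4, h5⟩ := ih _ hinv hcard
    have hle := (glue_le_iff (s := r) (a := a) (b := ι a)).1 le_rfl
    have hmul : ι * σ = swap a (ι a) * (swap a (ι a) * ι * σ) := by
      rw [mul_assoc, swap_mul_self_mul]
    have hne : a ≠ ι a := hab.symm
    refine ⟨glue r a (ι a), h1.trans hle.1, fun x => ?_, ?_, ?_, ?_⟩
    · have hx := hle.1 (h2 x)
      refine Setoid.trans' _ hx ?_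
      rw [mul_apply, swap_apply_def]
      split_ifs with h6 h7
      · rw [h6]; exact Setoid.symm' _ hle.2
      · rw [h7]; exact hle.2
      · exact Setoid.refl' _ _
    · rw [hmul]; exact sameCycle_swap_mul_le (h3.trans hle.1) hle.2
    · by_cases hr : r a (ι a)
      · rw [card_glue_of_rel hr]
        by_cases hsc : SameCycle (swap a (ι a) * ι * σ) a (ι a)
        · have := cyc_swap_mul_of_sameCycle hne hsc
          rw [← hmul] at this; omega
        · have := cyc_swap_mul_of_not_sameCycle hsc
          rw [← hmul] at this; omega
      · have hg := card_glue_of_not_rel hr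
        have hsc : ¬ SameCycle (swap a (ι a) * ι * σ) a (ι a) := fun hh => hr (h3 hh)
        have := cyc_swap_mul_of_not_sameCycle hsc
        rw [← hmul] at this; omega
    · by_cases hsc : SameCycle (swap a (ι a) * ι * σ) a (ι a)
      · have := cyc_swap_mul_of_sameCycle hne hsc
        rw [← hmul] at this
        rw [this]; rw [Nat.even_iff] at h5 ⊢; omega
      · have := cyc_swap_mul_of_not_sameCycle hsc
        rw [← hmul] at this
        rw [← this] at h5; rw [Nat.even_iff] at h5 ⊢; omega

theorem IsPairing.even_card {X : Type*} [Fintype X] {ι : Perm X} (h : IsPairing ι) :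
    Even (Fintype.card X) := by
  classical
  have h2 : ι.support = Finset.univ := by ext x; simp [h.2 x]
  have := sum_cycleType ι
  rw [h2, Finset.card_univ] at this
  rw [← this, even_iff_two_dvd]
  refine Multiset.dvd_sum fun n hn => ?_
  have h3 : n ∣ orderOf ι := dvd_of_mem_cycleType hn
  have h4 : orderOf ι ∣ 2 := orderOf_dvd_of_pow_eq_one (by rw [pow_two, h.mul_self])
  have h5 := two_le_of_mem_cycleType hn
  have h6 := Nat.le_of_dvd two_pos (h3.trans h4)
  exact dvd_of_eq (by omega)

/-- Euler's formula: a connected map has a genus, which is a natural number. -/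
theorem exists_genus {X : Type*} [Fintype X] [Nonempty X] {σ ι : Perm X} (hι : IsPairing ι)
    (hc : Conn σ ι) :
    ∃ g : ℕ, 2 * (cyc σ + cyc (σ * ι) : ℤ) - Fintype.card X = 4 - 4 * g := by
  classical
  obtain ⟨n, hn⟩ := hι.even_card
  have h2 : ι.support = Finset.univ := by ext x; simp [hι.2 x]
  obtain ⟨r, h1, h3, -, h4, h5⟩ := exists_setoid_euler σ n ι hι.1
    (by rw [h2, Finset.card_univ, hn]; ring)
  have hcard : Nat.card (Quotient r) = 1 := by
    rw [Nat.card_eq_one_iff_unique]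
    refine ⟨⟨fun q q' => ?_⟩, ⟨Quotient.mk r (Classical.arbitrary X)⟩⟩
    induction q using Quotient.inductionOn with
    | h x =>
      induction q' using Quotient.inductionOn with
      | h y =>
        refine Quotient.sound ?_
        refine (hc (fun z => r x z) (fun z => ?_) (fun z => ?_) x y).1 (r.refl x)
        · have := sameCycle_le_iff.1 h1 z
          exact ⟨fun h => r.trans h (r.symm this), fun h => r.trans h this⟩
        · exact ⟨fun h => r.trans h (r.symm (h3 z)), fun h => r.trans h (h3 z)⟩
  rw [hcard, cyc_mul_comm ι σ] at h4
  rw [cyc_mul_comm ι σ] at h5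
  obtain ⟨q, hq⟩ := h5
  refine ⟨n + 1 - q, ?_⟩
  omega

/-! ### Wick sums over pairings -/

open Classical in
/-- The pairings of the subset `S`, as involutions of the whole type with support `S`. -/
def pairingsOn {X : Type*} [Fintype X] (S : Finset X) : Finset (Perm X) :=
  Finset.univ.filter fun ι => (∀ x, ι (ι x) = x) ∧ ∀ x, ι x ≠ x ↔ x ∈ S

theorem mem_pairingsOn {X : Type*} [Fintype X] {S : Finset X} {ι : Perm X} :
    ι ∈ pairingsOn S ↔ (∀ x, ι (ι x) = x) ∧ ∀ x, ι x ≠ x ↔ x ∈ S := by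
  classical
  simp [pairingsOn]

theorem mem_pairingsOn_univ {X : Type*} [Fintype X] {ι : Perm X} :
    ι ∈ pairingsOn (Finset.univ : Finset X) ↔ IsPairing ι := by
  simp [mem_pairingsOn, IsPairing]

/-- The sum over all pairings of `S`; a pair `{a, b}` has the weight `r a b * r b a`. -/
def wickSum {X R : Type*} [Fintype X] [CommRing R] (r : X → X → R) (S : Finset X) : R :=
  ∑ ι ∈ pairingsOn S, ∏ d ∈ S, r d (ι d)

theorem wickSum_empty {X R : Type*} [Fintype X] [CommRing R] (r : X → X → R) :
    wickSum r ∅ = 1 := by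
  have : pairingsOn (∅ : Finset X) = {1} := by
    ext ι
    rw [mem_pairingsOn, Finset.mem_singleton]
    constructor
    · rintro ⟨-, h⟩
      ext x
      by_contra hx
      exact absurd ((h x).1 hx) (Finset.notMem_empty _)
    · rintro rfl
      simp
  simp [wickSum, this]

/-- A pairing that pairs `a` with `b` is a pairing of the remaining points. -/
theorem swap_mul_mem_pairingsOn {X : Type*} [Fintype X] [DecidableEq X] {S : Finset X} {a b : X}
    (hb : b ∈ S.erase a) {ι : Perm X} (hι : ι ∈ pairingsOn S) (hab : ι a = b) :
    swap a b * ι ∈ pairingsOn ((S.erase a).erase b) := by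
  rw [mem_pairingsOn] at hι ⊢
  have hne : b ≠ a := (Finset.mem_erase.1 hb).1
  have hba : ι b = a := by rw [← hab, hι.1]
  have hout : ∀ x, x ≠ a → x ≠ b → (swap a b * ι) x = ι x := by
    intro x h1 h2
    rw [mul_apply, swap_apply_of_ne_of_ne]
    · intro h; exact h2 (ι.injective (by rw [h, hba]))
    · intro h; exact h1 (ι.injective (by rw [h, hab]))
  have hpa : (swap a b * ι) a = a := by rw [mul_apply, hab, swap_apply_right]
  have hpb : (swap a b * ι) b = b := by rw [mul_apply, hba, swap_apply_left]
  constructor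
  · intro x
    by_cases h1 : x = a
    · rw [h1, hpa, hpa]
    by_cases h2 : x = b
    · rw [h2, hpb, hpb]
    rw [hout x h1 h2, hout, hι.1]
    · intro h; exact h2 (ι.injective (by rw [h, hba]))
    · intro h; exact h1 (ι.injective (by rw [h, hab]))
  · intro x
    by_cases h1 : x = a
    · rw [h1, hpa]; simp
    by_cases h2 : x = b
    · rw [h2, hpb]; simp
    rw [hout x h1 h2, hι.2]; simp [h1, h2]

/-- A pairing of the points other than `a` and `b` is completed by the pair `{a, b}`. -/
theorem swap_mul_mem_pairingsOn' {X : Type*} [Fintype X] [DecidableEq X] {S : Finset X} {a b : X}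
    (ha : a ∈ S) (hb : b ∈ S.erase a) {ι : Perm X} (hι : ι ∈ pairingsOn ((S.erase a).erase b)) :
    swap a b * ι ∈ pairingsOn S ∧ (swap a b * ι) a = b := by
  rw [mem_pairingsOn] at hι ⊢
  have hne : b ≠ a := (Finset.mem_erase.1 hb).1
  have hbS : b ∈ S := (Finset.mem_erase.1 hb).2
  have hia : ι a = a := by by_contra h; have := (hι.2 a).1 h; simp at this
  have hib : ι b = b := by by_contra h; have := (hι.2 b).1 h; simp at this
  have hout : ∀ x, x ≠ a → x ≠ b → (swap a b * ι) x = ι x := by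
    intro x h1 h2
    rw [mul_apply, swap_apply_of_ne_of_ne]
    · intro h; exact h1 (ι.injective (by rw [h, hia]))
    · intro h; exact h2 (ι.injective (by rw [h, hib]))
  have hpa : (swap a b * ι) a = b := by rw [mul_apply, hia, swap_apply_left]
  have hpb : (swap a b * ι) b = a := by rw [mul_apply, hib, swap_apply_right]
  refine ⟨⟨?_, ?_⟩, hpa⟩
  · intro x
    by_cases h1 : x = a
    · rw [h1, hpa, hpb]
    by_cases h2 : x = b
    · rw [h2, hpb, hpa]
    rw [hout x h1 h2, hout, hι.1]
    · intro h; exact h1 (ι.injective (by rw [h, hia]))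
    · intro h; exact h2 (ι.injective (by rw [h, hib]))
  · intro x
    by_cases h1 : x = a
    · rw [h1, hpa]; simp [hne, ha]
    by_cases h2 : x = b
    · rw [h2, hpb]; simp [hne.symm, hbS]
    rw [hout x h1 h2, hι.2]; simp [h1, h2]

/-- The pairings are sorted by the partner of `a`. -/
theorem wickSum_recursion {X R : Type*} [Fintype X] [DecidableEq X] [CommRing R] (r : X → X → R)
    {S : Finset X} {a : X} (ha : a ∈ S) :
    wickSum r S = ∑ b ∈ S.erase a, r a b * r b a * wickSum r ((S.erase a).erase b) := by
  classical
  rw [wickSum, ← Finset.sum_fiberwise_of_maps_to (t := S.erase a) (g := fun ι : Perm X => ι a)]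
  · refine Finset.sum_congr rfl fun b hb => ?_
    have hne : b ≠ a := (Finset.mem_erase.1 hb).1
    rw [wickSum, Finset.mul_sum]
    refine Finset.sum_bij' (fun ι _ => swap a b * ι) (fun ι _ => swap a b * ι) ?_ ?_ ?_ ?_ ?_
    · intro ι hι
      rw [Finset.mem_filter] at hι
      exact swap_mul_mem_pairingsOn hb hι.1 hι.2
    · intro ι hι
      rw [Finset.mem_filter]
      exact swap_mul_mem_pairingsOn' ha hb hι
    · intro ι _; rw [swap_mul_self_mul]
    · intro ι _; rw [swap_mul_self_mul]
    · intro ι hι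
      rw [Finset.mem_filter, mem_pairingsOn] at hι
      obtain ⟨⟨h1, h2⟩, h3⟩ := hι
      have hba : ι b = a := by rw [← h3, h1]
      rw [← Finset.mul_prod_erase _ _ ha, ← Finset.mul_prod_erase _ _ hb, h3, hba, mul_assoc]
      congr 2
      refine Finset.prod_congr rfl fun d hd => ?_
      rw [Finset.mem_erase, Finset.mem_erase] at hd
      rw [mul_apply, swap_apply_of_ne_of_ne]
      · intro h; exact hd.1 (ι.injective (by rw [h, hba]))
      · intro h; exact hd.2.1 (ι.injective (by rw [h, h3]))
  · intro ι hι
    rw [mem_pairingsOn] at hι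
    rw [Finset.mem_erase]
    refine ⟨(hι.2 a).2 ha, (hι.2 _).1 fun h => (hι.2 a).2 ha (ι.injective h)⟩

theorem pderiv_prod {τ X : Type*} [DecidableEq X] (p : τ) (L : X → MvPolynomial τ ℂ)
    (S : Finset X) : MvPolynomial.pderiv p (∏ d ∈ S, L d) =
      ∑ b ∈ S, MvPolynomial.pderiv p (L b) * ∏ d ∈ S.erase b, L d := by
  induction S using Finset.induction_on with
  | empty => simp
  | insert a S ha ih =>
    rw [Finset.prod_insert ha, Derivation.leibniz, ih, Finset.sum_insert ha,
      Finset.erase_insert ha, smul_eq_mul, smul_eq_mul, add_comm, mul_comm (∏ d ∈ S, L d)]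
    congr 1
    rw [Finset.mul_sum]
    refine Finset.sum_congr rfl fun b hb => ?_
    have hab : a ≠ b := fun h => ha (h ▸ hb)
    rw [Finset.erase_insert_of_ne hab, Finset.prod_insert]
    · ring
    · exact fun h => ha (Finset.mem_of_mem_erase h)

/-- Wick's theorem for a functional that satisfies integration by parts. -/
theorem functional_prod_eq_wickSum {τ X : Type*} [Fintype τ] [Fintype X] [DecidableEq X]
    (E : MvPolynomial τ ℂ →ₗ[ℂ] ℂ) (v : τ → ℂ) (h1 : E 1 = 1)
    (hE : ∀ p q, E (MvPolynomial.X p * q) = v p * E (MvPolynomial.pderiv p q))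
    (ℓ : X → τ → ℂ) (r : X → X → ℂ)
    (hr : ∀ a b, r a b * r b a = ∑ p, ℓ a p * ℓ b p * v p) (S : Finset X) :
    E (∏ d ∈ S, ∑ p, MvPolynomial.C (ℓ d p) * MvPolynomial.X p) = wickSum r S := by
  classical
  induction hn : S.card using Nat.strong_induction_on generalizing S with
  | _ n ih =>
    rcases S.eq_empty_or_nonempty with rfl | ⟨a, ha⟩
    · rw [wickSum_empty, Finset.prod_empty, h1]
    · have hder : ∀ p b, MvPolynomial.pderiv p
          (∑ p', MvPolynomial.C (ℓ b p') * MvPolynomial.X p') = MvPolynomial.C (ℓ b p) := by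
        intro p b
        rw [map_sum, Finset.sum_eq_single p]
        · simp
        · intro p' _ hp
          rw [MvPolynomial.pderiv_C_mul, MvPolynomial.pderiv_X_of_ne hp, mul_zero]
        · simp
      have hC : ∀ (z : ℂ) q, E (MvPolynomial.C z * q) = z * E q := fun z q => by
        rw [← MvPolynomial.smul_eq_C_mul, map_smul, smul_eq_mul]
      rw [wickSum_recursion r ha, ← Finset.mul_prod_erase _ _ ha, Finset.sum_mul, map_sum]
      have hp : ∀ p, E (MvPolynomial.C (ℓ a p) * MvPolynomial.X p *
          ∏ d ∈ S.erase a, ∑ p', MvPolynomial.C (ℓ d p') * MvPolynomial.X p') =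
          ∑ b ∈ S.erase a, ℓ a p * (v p * (ℓ b p * E (∏ d ∈ (S.erase a).erase b,
            ∑ p', MvPolynomial.C (ℓ d p') * MvPolynomial.X p'))) := by
        intro p
        rw [mul_assoc, hC, hE, pderiv_prod, map_sum, Finset.mul_sum, Finset.mul_sum]
        refine Finset.sum_congr rfl fun b _ => ?_
        rw [hder, hC]
      rw [Finset.sum_congr rfl fun p _ => hp p, Finset.sum_comm]
      refine Finset.sum_congr rfl fun b hb => ?_
      have hc : ((S.erase a).erase b).card < n := by
        rw [Finset.card_erase_of_mem hb, Finset.card_erase_of_mem ha, hn]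
        have : 0 < S.card := Finset.card_pos.2 ⟨a, ha⟩
        omega
      rw [ih _ hc ((S.erase a).erase b) rfl, hr a b, Finset.sum_mul]
      refine Finset.sum_congr rfl fun p _ => ?_
      ring

/-! ### Gaussian moments -/

/-- The moment of order `j` of the weight `exp (-b x²)` on the real line. -/
def gaussMoment (b : ℝ) (j : ℕ) : ℝ :=
  (∫ x : ℝ, x ^ j * Real.exp (-b * x ^ 2)) / ∫ x : ℝ, Real.exp (-b * x ^ 2)

theorem integrable_pow_mul_gauss {b : ℝ} (hb : 0 < b) (j : ℕ) :
    MeasureTheory.Integrable fun x : ℝ => x ^ j * Real.exp (-b * x ^ 2) := by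
  have := integrable_rpow_mul_exp_neg_mul_sq hb (s := (j : ℝ))
    (lt_of_lt_of_le (by norm_num) (Nat.cast_nonneg j))
  simpa using this

theorem integral_gauss_pos {b : ℝ} (hb : 0 < b) : 0 < ∫ x : ℝ, Real.exp (-b * x ^ 2) := by
  rw [integral_gaussian]
  positivity

theorem gaussMoment_zero {b : ℝ} (hb : 0 < b) : gaussMoment b 0 = 1 := by
  simp only [gaussMoment, pow_zero, one_mul]
  exact div_self (integral_gauss_pos hb).ne'

/-- Integration by parts. -/
theorem gaussMoment_succ {b : ℝ} (hb : 0 < b) (j : ℕ) :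
    gaussMoment b (j + 1) = 1 / (2 * b) * (j * gaussMoment b (j - 1)) := by
  have hder : ∀ x : ℝ, HasDerivAt (fun x => Real.exp (-b * x ^ 2))
      (-(2 * b) * (x * Real.exp (-b * x ^ 2))) x := by
    intro x
    have h := ((hasDerivAt_pow 2 x).const_mul (-b)).exp
    convert h using 1
    push_cast; ring
  have hpow : ∀ x : ℝ, HasDerivAt (fun x : ℝ => x ^ j) (j * x ^ (j - 1)) x := fun x =>
    hasDerivAt_pow j x
  have key := MeasureTheory.integral_mul_deriv_eq_deriv_mul_of_integrable
    (u := fun x : ℝ => x ^ j) (v := fun x => Real.exp (-b * x ^ 2))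
    (u' := fun x => j * x ^ (j - 1)) (v' := fun x => -(2 * b) * (x * Real.exp (-b * x ^ 2)))
    (fun x _ => hpow x) (fun x _ => hder x) ?_ ?_ ?_
  · have e1 : ∀ x : ℝ, x ^ j * (-(2 * b) * (x * Real.exp (-b * x ^ 2))) =
        -(2 * b) * (x ^ (j + 1) * Real.exp (-b * x ^ 2)) := fun x => by ring
    have e2 : ∀ x : ℝ, (j : ℝ) * x ^ (j - 1) * Real.exp (-b * x ^ 2) =
        j * (x ^ (j - 1) * Real.exp (-b * x ^ 2)) := fun x => by ring
    simp_rw [e1, e2, MeasureTheory.integral_const_mul] at key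
    rw [gaussMoment, gaussMoment]
    have h0 := (integral_gauss_pos hb).ne'
    generalize (∫ x : ℝ, Real.exp (-b * x ^ 2)) = D at *
    generalize (∫ x : ℝ, x ^ (j + 1) * Real.exp (-b * x ^ 2)) = I₁ at *
    generalize (∫ x : ℝ, x ^ (j - 1) * Real.exp (-b * x ^ 2)) = I₂ at *
    field_simp
    linarith
  · refine ((integrable_pow_mul_gauss hb (j + 1)).const_mul (-(2 * b))).congr ?_
    exact Filter.Eventually.of_forall fun x => by simp only [Pi.mul_apply]; ring
  · refine ((integrable_pow_mul_gauss hb (j - 1)).const_mul (j : ℝ)).congr ?_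
    exact Filter.Eventually.of_forall fun x => by simp only [Pi.mul_apply]; ring
  · exact integrable_pow_mul_gauss hb j

/-- The product Gaussian functional on polynomials. -/
def gaussFunctional {τ : Type*} [Fintype τ] (b : τ → ℝ) : MvPolynomial τ ℂ →ₗ[ℂ] ℂ :=
  (MvPolynomial.basisMonomials τ ℂ).constr ℂ fun m => ∏ p, ((gaussMoment (b p) (m p) : ℝ) : ℂ)

theorem gaussFunctional_monomial {τ : Type*} [Fintype τ] (b : τ → ℝ) (m : τ →₀ ℕ) (a : ℂ) :
    gaussFunctional b (MvPolynomial.monomial m a) =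
      a * ∏ p, ((gaussMoment (b p) (m p) : ℝ) : ℂ) := by
  have h : MvPolynomial.monomial m a = a • MvPolynomial.basisMonomials τ ℂ m := by
    simp [MvPolynomial.smul_monomial]
  rw [h, map_smul, gaussFunctional, Module.Basis.constr_basis, smul_eq_mul]

theorem gaussFunctional_one {τ : Type*} [Fintype τ] {b : τ → ℝ} (hb : ∀ p, 0 < b p) :
    gaussFunctional b 1 = 1 := by
  have := gaussFunctional_monomial b 0 1
  rw [MvPolynomial.monomial_zero', map_one] at this
  rw [this]
  simp [gaussMoment_zero (hb _)]

/-- Integration by parts in the coordinate `p`: the hypothesis of `functional_prod_eq_wickSum`. -/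
theorem gaussFunctional_X_mul {τ : Type*} [Fintype τ] {b : τ → ℝ} (hb : ∀ p, 0 < b p) (p : τ)
    (q : MvPolynomial τ ℂ) :
    gaussFunctional b (MvPolynomial.X p * q) =
      ((1 / (2 * b p) : ℝ) : ℂ) * gaussFunctional b (MvPolynomial.pderiv p q) := by
  classical
  induction q using MvPolynomial.induction_on' with
  | monomial m a =>
    rw [MvPolynomial.pderiv_monomial, MvPolynomial.X, MvPolynomial.monomial_mul, one_mul,
      gaussFunctional_monomial, gaussFunctional_monomial,
      ← Finset.mul_prod_erase _ _ (Finset.mem_univ p),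
      ← Finset.mul_prod_erase _ _ (Finset.mem_univ p)]
    have e1 : (Finsupp.single p 1 + m : τ →₀ ℕ) p = m p + 1 := by simp [add_comm]
    have e2 : (m - Finsupp.single p 1 : τ →₀ ℕ) p = m p - 1 := by simp
    rw [e1, e2, gaussMoment_succ (hb p)]
    have e3 : ∏ x ∈ Finset.univ.erase p, ((gaussMoment (b x) ((Finsupp.single p 1 + m : τ →₀ ℕ) x) : ℝ) : ℂ)
        = ∏ x ∈ Finset.univ.erase p, ((gaussMoment (b x) ((m - Finsupp.single p 1 : τ →₀ ℕ) x) : ℝ) : ℂ) := by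
      refine Finset.prod_congr rfl fun x hx => ?_
      have hx' : p ≠ x := (Finset.ne_of_mem_erase hx).symm
      simp [Finsupp.single_eq_of_ne hx'.symm]
    rw [e3]
    push_cast
    ring
  | add q1 q2 h1 h2 => rw [mul_add, map_add, h1, h2, map_add, map_add, mul_add]

/-- The Gaussian integral of a polynomial in the coordinates of a Hermitian matrix. -/
theorem integral_gauss_polynomial {N : ℕ} {b : Fin N × Fin N → ℝ} (hb : ∀ p, 0 < b p)
    (q : MvPolynomial (Fin N × Fin N) ℂ) :
    (MeasureTheory.Integrable fun A : Fin N → Fin N → ℝ =>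
      MvPolynomial.eval (fun p => ((A p.1 p.2 : ℝ) : ℂ)) q *
        ∏ p : Fin N × Fin N, ((Real.exp (-b p * A p.1 p.2 ^ 2) : ℝ) : ℂ)) ∧
    ∫ A : Fin N → Fin N → ℝ, MvPolynomial.eval (fun p => ((A p.1 p.2 : ℝ) : ℂ)) q *
        ∏ p : Fin N × Fin N, ((Real.exp (-b p * A p.1 p.2 ^ 2) : ℝ) : ℂ) =
      gaussFunctional b q * ∏ p, ((∫ x : ℝ, Real.exp (-b p * x ^ 2) : ℝ) : ℂ) := by
  induction q using MvPolynomial.induction_on' with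
  | monomial m a =>
    have e : ∀ A : Fin N → Fin N → ℝ,
        MvPolynomial.eval (fun p => ((A p.1 p.2 : ℝ) : ℂ)) (MvPolynomial.monomial m a) *
          ∏ p : Fin N × Fin N, ((Real.exp (-b p * A p.1 p.2 ^ 2) : ℝ) : ℂ) =
        a * ∏ i, ∏ j, ((A i j ^ m (i, j) * Real.exp (-b (i, j) * A i j ^ 2) : ℝ) : ℂ) := by
      intro A
      rw [MvPolynomial.eval_monomial, Finsupp.prod_fintype _ _ (by simp), mul_assoc,
        ← Finset.prod_mul_distrib, ← Finset.univ_product_univ, Finset.prod_product]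
      push_cast
      rfl
    simp_rw [e]
    have hi : ∀ p : Fin N × Fin N, MeasureTheory.Integrable fun x : ℝ =>
        ((x ^ m p * Real.exp (-b p * x ^ 2) : ℝ) : ℂ) := fun p =>
      (integrable_pow_mul_gauss (hb p) (m p)).ofReal
    constructor
    · refine MeasureTheory.Integrable.const_mul ?_ a
      exact MeasureTheory.Integrable.fintype_prod_dep
        (f := fun i (Ai : Fin N → ℝ) =>
          ∏ j, ((Ai j ^ m (i, j) * Real.exp (-b (i, j) * Ai j ^ 2) : ℝ) : ℂ))
        fun i => MeasureTheory.Integrable.fintype_prod_dep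
          (f := fun j (x : ℝ) => ((x ^ m (i, j) * Real.exp (-b (i, j) * x ^ 2) : ℝ) : ℂ))
          fun j => hi (i, j)
    · rw [MeasureTheory.integral_const_mul, MeasureTheory.integral_fintype_prod_volume_eq_prod
        (f := fun i (Ai : Fin N → ℝ) =>
          ∏ j, ((Ai j ^ m (i, j) * Real.exp (-b (i, j) * Ai j ^ 2) : ℝ) : ℂ))]
      have hrow : ∀ i, ∫ Ai : Fin N → ℝ,
          ∏ j, ((Ai j ^ m (i, j) * Real.exp (-b (i, j) * Ai j ^ 2) : ℝ) : ℂ) =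
          ∏ j, ∫ x : ℝ, ((x ^ m (i, j) * Real.exp (-b (i, j) * x ^ 2) : ℝ) : ℂ) := fun i =>
        MeasureTheory.integral_fintype_prod_volume_eq_prod
          (f := fun j (x : ℝ) => ((x ^ m (i, j) * Real.exp (-b (i, j) * x ^ 2) : ℝ) : ℂ))
      simp_rw [hrow]
      rw [gaussFunctional_monomial, mul_assoc, ← Finset.prod_mul_distrib,
        ← Finset.univ_product_univ, Finset.prod_product]
      congr 1
      refine Finset.prod_congr rfl fun i _ => Finset.prod_congr rfl fun j _ => ?_
      rw [integral_complex_ofReal, gaussMoment, ← Complex.ofReal_mul,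
        div_mul_cancel₀ _ (integral_gauss_pos (hb (i, j))).ne']
  | add q1 q2 h1 h2 =>
    simp_rw [map_add, add_mul]
    exact ⟨h1.1.add h2.1, by rw [MeasureTheory.integral_add h1.1 h2.1, h1.2, h2.2]⟩

/-! ### Wick's theorem for Hermitian matrices -/

/-- A weight that is Gaussian with independent entries: `c i j` is the inverse variance of the
entry `(i, j)`. -/
def IsGaussianWeight {N : ℕ} (c : Fin N → Fin N → ℝ) (w : Matrix (Fin N) (Fin N) ℂ → ℂ) : Prop :=
  (∀ i j, 0 < c i j) ∧ (∀ i j, c i j = c j i) ∧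
    ∀ A : Fin N → Fin N → ℝ, w (hermitianOf A) = ∏ p : Fin N × Fin N,
      ((Real.exp (-(if p.1 = p.2 then c p.1 p.2 / 2 else c p.1 p.2) * A p.1 p.2 ^ 2) : ℝ) : ℂ)

/-- The coefficients of the entries of a Hermitian matrix in the real coordinates. -/
def entryCoeff {N : ℕ} (i j : Fin N) (p : Fin N × Fin N) : ℂ :=
  (if p = (i, j) then (if i ≤ j then 1 else -Complex.I) else 0) +
    if p = (j, i) then (if i < j then Complex.I else if j < i then 1 else 0) else 0

theorem hermitianOf_eq_eval {N : ℕ} (A : Fin N → Fin N → ℝ) (i j : Fin N) :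
    hermitianOf A i j = MvPolynomial.eval (fun p => ((A p.1 p.2 : ℝ) : ℂ))
      (∑ p, MvPolynomial.C (entryCoeff i j p) * MvPolynomial.X p) := by
  simp only [map_sum, map_mul, MvPolynomial.eval_C, MvPolynomial.eval_X, entryCoeff, add_mul,
    Finset.sum_add_distrib, ite_mul, zero_mul, Finset.sum_ite_eq', Finset.mem_univ, if_true]
  simp only [hermitianOf, Matrix.of_apply]
  rcases lt_trichotomy i j with h | rfl | h
  · simp only [h.ne, h, h.le, if_true, if_false, one_mul]
    apply Complex.ext <;> simp
  · simp
  · simp only [h.ne', h, h.not_gt, h.not_ge, if_true, if_false, one_mul]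
    apply Complex.ext <;> simp

/-- The covariances of the entries: `H i j` is correlated with its conjugate `H j i` only. -/
theorem sum_entryCoeff {N : ℕ} {c : Fin N → Fin N → ℝ} (hc : ∀ i j, 0 < c i j)
    (hs : ∀ i j, c i j = c j i) (i j k l : Fin N) :
    ∑ p : Fin N × Fin N, entryCoeff i j p * entryCoeff k l p *
      ((1 / (2 * (if p.1 = p.2 then c p.1 p.2 / 2 else c p.1 p.2)) : ℝ) : ℂ) =
      if i = l ∧ j = k then ((1 / c i j : ℝ) : ℂ) else 0 := by
  have hcij : (c i j : ℂ) ≠ 0 := by exact_mod_cast (hc i j).ne'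
  simp only [entryCoeff, add_mul, mul_add, Finset.sum_add_distrib, ite_mul, mul_ite, zero_mul,
    mul_zero, Finset.sum_ite_eq', Finset.mem_univ, if_true, Prod.mk.injEq]
  have hI := Complex.I_mul_I
  by_cases h1 : i = k ∧ j = l
  · obtain ⟨rfl, rfl⟩ := h1
    rcases lt_trichotomy i j with h | rfl | h
    · simp [h.ne, h.ne', h, h.le, hs j i]
    · simp; field_simp
    · simp [h.ne, h.ne', h, h.not_gt, h.not_ge, hs j i]
  · by_cases h2 : i = l ∧ j = k
    · obtain ⟨rfl, rfl⟩ := h2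
      rcases lt_trichotomy i j with h | rfl | h
      · simp [h.ne, h.ne', h, h.le, h.not_gt, h.not_ge, hs j i]
        field_simp; norm_num
      · simp at h1
      · simp [h.ne, h.ne', h, h.le, h.not_gt, h.not_ge, hs j i]
        field_simp; norm_num
    · have h3 : ¬ (k = i ∧ l = j) := fun h => h1 ⟨h.1.symm, h.2.symm⟩
      have h4 : ¬ (k = j ∧ l = i) := fun h => h2 ⟨h.2.symm, h.1.symm⟩
      have h5 : ¬ (l = i ∧ k = j) := fun h => h4 ⟨h.2, h.1⟩
      have h6 : ¬ (l = j ∧ k = i) := fun h => h3 ⟨h.2, h.1⟩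
      simp [h2, h3, h4, h5, h6]

/-- Wick's theorem for the entries, for any factorization `r a b * r b a` of the covariances; the
first part says that the integral converges. -/
theorem IsGaussianWeight.prod_entries {N : ℕ} {c : Fin N → Fin N → ℝ}
    {w : Matrix (Fin N) (Fin N) ℂ → ℂ} (hw : IsGaussianWeight c w) {X : Type*} [Fintype X]
    (i j : X → Fin N) :
    (MeasureTheory.Integrable fun A : Fin N → Fin N → ℝ =>
      (∏ d, hermitianOf A (i d) (j d)) * w (hermitianOf A)) ∧
    ∀ r : X → X → ℂ, (∀ a b, r a b * r b a =
        if i a = j b ∧ j a = i b then ((1 / c (i a) (j a) : ℝ) : ℂ) else 0) →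
      hermitianMean w (fun H => ∏ d, H (i d) (j d)) = wickSum r Finset.univ := by
  classical
  obtain ⟨hc, hs, hw⟩ := hw
  let b : Fin N × Fin N → ℝ := fun p => if p.1 = p.2 then c p.1 p.2 / 2 else c p.1 p.2
  have hb : ∀ p, 0 < b p := by
    intro p
    simp only [b]
    split_ifs
    · exact half_pos (hc _ _)
    · exact hc _ _
  let q : MvPolynomial (Fin N × Fin N) ℂ :=
    ∏ d ∈ Finset.univ, ∑ p, MvPolynomial.C (entryCoeff (i d) (j d) p) * MvPolynomial.X p
  have he : ∀ A : Fin N → Fin N → ℝ, (∏ d, hermitianOf A (i d) (j d)) =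
      MvPolynomial.eval (fun p => ((A p.1 p.2 : ℝ) : ℂ)) q := by
    intro A
    simp only [q, map_prod]
    exact Finset.prod_congr rfl fun d _ => hermitianOf_eq_eval A _ _
  have h1 := integral_gauss_polynomial hb q
  have h0 := integral_gauss_polynomial hb 1
  simp_rw [hw, he]
  refine ⟨h1.1, fun r hr => ?_⟩
  simp only [hermitianMean]
  simp_rw [hw, he]
  have hden : ∏ p, ((∫ x : ℝ, Real.exp (-b p * x ^ 2) : ℝ) : ℂ) ≠ 0 :=
    Finset.prod_ne_zero_iff.2 fun p _ => by
      exact_mod_cast (integral_gauss_pos (hb p)).ne'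
  have h0' := h0.2
  simp only [map_one, one_mul, gaussFunctional_one hb] at h0'
  rw [show (∫ A : Fin N → Fin N → ℝ, MvPolynomial.eval (fun p => ((A p.1 p.2 : ℝ) : ℂ)) q *
    ∏ p : Fin N × Fin N, ((Real.exp (-(if p.1 = p.2 then c p.1 p.2 / 2 else c p.1 p.2) *
      A p.1 p.2 ^ 2) : ℝ) : ℂ)) = _ from h1.2]
  rw [show (∫ A : Fin N → Fin N → ℝ,
    ∏ p : Fin N × Fin N, ((Real.exp (-(if p.1 = p.2 then c p.1 p.2 / 2 else c p.1 p.2) *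
      A p.1 p.2 ^ 2) : ℝ) : ℂ)) = _ from h0', mul_div_cancel_right₀ _ hden]
  exact functional_prod_eq_wickSum (gaussFunctional b) _ (gaussFunctional_one hb)
    (gaussFunctional_X_mul hb) (fun d => entryCoeff (i d) (j d)) r
    (fun a b => by rw [hr, ← sum_entryCoeff hc hs]) Finset.univ

theorem hermitianMean_sum {N : ℕ} {w : Matrix (Fin N) (Fin N) ℂ → ℂ} {κ : Type*} (T : Finset κ)
    (f : κ → Matrix (Fin N) (Fin N) ℂ → ℂ)
    (hf : ∀ k ∈ T, MeasureTheory.Integrable fun A : Fin N → Fin N → ℝ =>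
      f k (hermitianOf A) * w (hermitianOf A)) :
    hermitianMean w (fun H => ∑ k ∈ T, f k H) = ∑ k ∈ T, hermitianMean w (f k) := by
  simp only [hermitianMean, Finset.sum_mul]
  rw [MeasureTheory.integral_finsetSum _ hf, Finset.sum_div]

theorem hermitianMean_const_mul {N : ℕ} (w : Matrix (Fin N) (Fin N) ℂ → ℂ) (a : ℂ)
    (f : Matrix (Fin N) (Fin N) ℂ → ℂ) :
    hermitianMean w (fun H => a * f H) = a * hermitianMean w f := by
  simp only [hermitianMean, mul_assoc]
  rw [MeasureTheory.integral_const_mul, mul_div_assoc]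

theorem IsGaussianWeight.integrable_traces {N : ℕ} {c : Fin N → Fin N → ℝ}
    {w : Matrix (Fin N) (Fin N) ℂ → ℂ} (hw : IsGaussianWeight c w) {X : Type*} [Fintype X]
    [DecidableEq X] (σ : Perm X) :
    MeasureTheory.Integrable fun A : Fin N → Fin N → ℝ =>
      (∑ i : X → Fin N, ∏ d, hermitianOf A (i d) (i (σ d))) * w (hermitianOf A) := by
  simp_rw [Finset.sum_mul]
  exact MeasureTheory.integrable_finsetSum _ fun i _ =>
    (hw.prod_entries i (fun d => i (σ d))).1

open Classical in
/-- The Gaussian mean of a product of traces, one for each cycle of `σ`, as a sum over pairings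
`ι` and over colourings of the cycles of `σ * ι`. -/
theorem IsGaussianWeight.mean_traces {N : ℕ} {c : Fin N → Fin N → ℝ}
    {w : Matrix (Fin N) (Fin N) ℂ → ℂ} (hw : IsGaussianWeight c w) {X : Type*} [Fintype X]
    (σ : Perm X) :
    hermitianMean w (fun H => ∑ i : X → Fin N, ∏ d, H (i d) (i (σ d))) =
      ∑ ι ∈ pairingsOn (Finset.univ : Finset X),
        ∑ i ∈ Finset.univ.filter (fun i : X → Fin N => ∀ d, i ((σ * ι) d) = i d),
          ∏ d, ((Real.sqrt (1 / c (i d) (i (ι d))) : ℝ) : ℂ) := by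
  rw [hermitianMean_sum _ (fun (i : X → Fin N) H => ∏ d, H (i d) (i (σ d)))
    fun i _ => (hw.prod_entries i _).1]
  have key : ∀ i : X → Fin N, hermitianMean w (fun H => ∏ d, H (i d) (i (σ d))) =
      ∑ ι ∈ pairingsOn (Finset.univ : Finset X), if ∀ d, i ((σ * ι) d) = i d then
        ∏ d, ((Real.sqrt (1 / c (i d) (i (ι d))) : ℝ) : ℂ) else 0 := by
    intro i
    rw [(hw.prod_entries i (fun d => i (σ d))).2 fun a b =>
      if i a = i (σ b) ∧ i (σ a) = i b then
        ((Real.sqrt (1 / c (i a) (i b)) : ℝ) : ℂ) else 0]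
    · refine Finset.sum_congr rfl fun ι hι => ?_
      rw [mem_pairingsOn_univ] at hι
      split_ifs with h
      · refine Finset.prod_congr rfl fun d _ => ?_
        refine if_pos ⟨(h d).symm, ?_⟩
        have := h (ι d)
        rwa [mul_apply, hι.1] at this
      · push Not at h
        obtain ⟨d, hd⟩ := h
        refine Finset.prod_eq_zero (Finset.mem_univ d) (if_neg fun hh => hd hh.1.symm)
    · intro a b
      by_cases h : i a = i (σ b) ∧ i (σ a) = i b
      · rw [if_pos h, if_pos ⟨h.2.symm, h.1.symm⟩, if_pos h, hw.2.1 (i b) (i a), ← h.2,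
          ← Complex.ofReal_mul, Real.mul_self_sqrt (by have := hw.1 (i a) (i (σ a)); positivity)]
      · rw [if_neg h, if_neg h, zero_mul]
  simp_rw [key]
  rw [Finset.sum_comm]
  exact Finset.sum_congr rfl fun ι _ => by rw [Finset.sum_filter]

/-! ### Traces of powers as sums over closed walks -/

/-- Walks with `m` steps, closed by `B`; the matrix `B` is what the induction on `m` needs. -/
theorem sum_walks_mul {n R : Type*} [Fintype n] [DecidableEq n] [CommRing R] (A : Matrix n n R)
    (m : ℕ) : ∀ B : Matrix n n R,
      ∑ u : Fin (m + 1) → n, (∏ j : Fin m, A (u j.castSucc) (u j.succ)) *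
        B (u (Fin.last m)) (u 0) = (A ^ m * B).trace := by
  induction m with
  | zero =>
    intro B
    rw [pow_zero, one_mul, Matrix.trace, ← (Equiv.funUnique (Fin 1) n).sum_comp]
    simp
  | succ m ih =>
    intro B
    rw [pow_succ, mul_assoc, ← ih (A * B),
      ← (Fin.snocEquiv (fun _ : Fin (m + 2) => n)).sum_comp, Fintype.sum_prod_type,
      Finset.sum_comm]
    refine Finset.sum_congr rfl fun u _ => ?_
    rw [Matrix.mul_apply, Finset.mul_sum]
    refine Finset.sum_congr rfl fun x _ => ?_
    rw [Fin.prod_univ_castSucc]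
    have e1 : ∀ j : Fin (m + 1), (Fin.snocEquiv (fun _ : Fin (m + 2) => n)) (x, u) j.castSucc
        = u j := fun j => Fin.snoc_castSucc (α := fun _ => n) _ _ _
    have e0 : (Fin.snocEquiv (fun _ : Fin (m + 2) => n)) (x, u) 0 = u 0 := e1 0
    have e2 : (Fin.snocEquiv (fun _ : Fin (m + 2) => n)) (x, u) (Fin.last (m + 1)) = x :=
      Fin.snoc_last (α := fun _ => n) _ _
    have e3 : ∀ j : Fin m, (Fin.snocEquiv (fun _ : Fin (m + 2) => n)) (x, u) j.castSucc.succ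
        = u j.succ := fun j => by rw [← Fin.castSucc_succ, e1]
    rw [e0, e2, Fin.succ_last, e2, e1]
    simp_rw [e1, e3]
    ring

theorem trace_pow_eq_sum {n R : Type*} [Fintype n] [DecidableEq n] [CommRing R] (A : Matrix n n R)
    {k : ℕ} (hk : 0 < k) :
    (A ^ k).trace = ∑ u : Fin k → n, ∏ j, A (u j) (u (finRotate k j)) := by
  obtain ⟨m, rfl⟩ : ∃ m, k = m + 1 := ⟨k - 1, by omega⟩
  rw [pow_succ, ← sum_walks_mul]
  refine Finset.sum_congr rfl fun u _ => ?_
  rw [Fin.prod_univ_castSucc, finRotate_last]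
  congr 1
  refine Finset.prod_congr rfl fun j _ => ?_
  rw [finRotate_apply, Fin.coeSucc_eq_succ]

/-! ### The exponential formula -/

/-- A series with constant term one is the exponential of `F` if it satisfies the differential
equation `t Z' = t F' Z`, stated here for the coefficients. -/
theorem PowerSeries.eq_exp_subst {Z F : PowerSeries ℂ} (hF : PowerSeries.constantCoeff F = 0)
    (hZ : PowerSeries.coeff 0 Z = 1)
    (hrec : ∀ m : ℕ, (m : ℂ) * PowerSeries.coeff m Z = ∑ p ∈ Finset.HasAntidiagonal.antidiagonal m,
      (p.1 : ℂ) * PowerSeries.coeff p.1 F * PowerSeries.coeff p.2 Z) :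
    Z = (PowerSeries.exp ℂ).subst F := by
  have hs : PowerSeries.HasSubst F := PowerSeries.HasSubst.of_constantCoeff_zero' hF
  have h0 : PowerSeries.coeff 0 ((PowerSeries.exp ℂ).subst F) = 1 := by
    rw [PowerSeries.coeff_zero_eq_constantCoeff_apply,
      show PowerSeries.constantCoeff ((PowerSeries.exp ℂ).subst F) = _ from
        PowerSeries.constantCoeff_subst hs _, finsum_eq_single _ 0]
    · simp
    · intro d hd
      rw [map_pow, show MvPowerSeries.constantCoeff F = 0 from hF, zero_pow hd, smul_zero]
  have hd : PowerSeries.derivative ℂ ((PowerSeries.exp ℂ).subst F) =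
      (PowerSeries.exp ℂ).subst F * PowerSeries.derivative ℂ F := by
    rw [PowerSeries.derivative_subst hs, PowerSeries.derivative_exp]
  have hrec' : ∀ m : ℕ, (m : ℂ) * PowerSeries.coeff m ((PowerSeries.exp ℂ).subst F) =
      ∑ p ∈ Finset.HasAntidiagonal.antidiagonal m, (p.1 : ℂ) * PowerSeries.coeff p.1 F *
        PowerSeries.coeff p.2 ((PowerSeries.exp ℂ).subst F) := by
    intro m
    cases m with
    | zero => simp
    | succ m =>
      have h := congrArg (PowerSeries.coeff m) hd
      rw [PowerSeries.coeff_derivative, mul_comm (PowerSeries.subst _ _), PowerSeries.coeff_mul] at h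
      rw [Finset.Nat.antidiagonal_succ, Finset.sum_cons, Finset.sum_map]
      simp only [Nat.cast_zero, zero_mul, zero_add]
      push_cast
      rw [mul_comm, h]
      refine Finset.sum_congr rfl fun p _ => ?_
      rw [PowerSeries.coeff_derivative]
      simp only [Function.Embedding.prodMap, Function.Embedding.coeFn_mk, Prod.map,
        Function.Embedding.refl_apply]
      push_cast
      ring
  ext m
  induction m using Nat.strong_induction_on with
  | _ m ih =>
    rcases Nat.eq_zero_or_pos m with rfl | hm
    · rw [hZ, h0]
    · have hm' : (m : ℂ) ≠ 0 := by exact_mod_cast hm.ne'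
      refine mul_left_cancel₀ hm' ?_
      rw [hrec, hrec']
      refine Finset.sum_congr rfl fun p hp => ?_
      rw [Finset.HasAntidiagonal.mem_antidiagonal] at hp
      rcases Nat.eq_zero_or_pos p.1 with h | h
      · simp [h]
      · rw [ih p.2 (by omega)]

/-- A family of permutations acts transitively. -/
def FamConn {κ X : Type*} (ρ : κ → Perm X) : Prop :=
  ∀ f : X → Prop, (∀ k x, f (ρ k x) ↔ f x) → ∀ x y, f x ↔ f y

/-- The disjoint union of two families of permutations, transported along `e`. -/
def disjUnion {κ A B X : Type*} (e : A ⊕ B ≃ X) (ρ₁ : κ → Perm A) (ρ₂ : κ → Perm B) :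
    κ → Perm X := fun k => e.permCongr (Perm.sumCongr (ρ₁ k) (ρ₂ k))

theorem disjUnion_inl {κ A B X : Type*} (e : A ⊕ B ≃ X) (ρ₁ : κ → Perm A) (ρ₂ : κ → Perm B)
    (k : κ) (x : A) : disjUnion e ρ₁ ρ₂ k (e (Sum.inl x)) = e (Sum.inl (ρ₁ k x)) := by
  simp [disjUnion, Equiv.permCongr_apply]

theorem disjUnion_inr {κ A B X : Type*} (e : A ⊕ B ≃ X) (ρ₁ : κ → Perm A) (ρ₂ : κ → Perm B)
    (k : κ) (x : B) : disjUnion e ρ₁ ρ₂ k (e (Sum.inr x)) = e (Sum.inr (ρ₂ k x)) := by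
  simp [disjUnion, Equiv.permCongr_apply]

theorem exists_disjUnion {κ A B X : Type*} [Finite A] [Finite B] (e : A ⊕ B ≃ X)
    (ρ : κ → Perm X) (h : ∀ k x, ∃ y, ρ k (e (Sum.inl x)) = e (Sum.inl y)) :
    ∃ ρ₁ ρ₂, disjUnion e ρ₁ ρ₂ = ρ := by
  classical
  have := Fintype.ofFinite A
  have := Fintype.ofFinite B
  have key : ∀ k, ∃ σ : Perm A × Perm B, e.permCongr (Perm.sumCongr σ.1 σ.2) = ρ k := by
    intro k
    have hm : Set.MapsTo (e.symm.permCongr (ρ k)) (Set.range (Sum.inl : A → A ⊕ B))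
        (Set.range Sum.inl) := by
      rintro _ ⟨x, rfl⟩
      obtain ⟨y, hy⟩ := h k x
      exact ⟨y, by simp [Equiv.permCongr_apply, hy]⟩
    obtain ⟨σ, hσ⟩ := Equiv.Perm.mem_sumCongrHom_range_of_perm_mapsTo_inl hm
    refine ⟨σ, ?_⟩
    have hσ' : Perm.sumCongr σ.1 σ.2 = e.symm.permCongr (ρ k) := hσ
    rw [hσ']
    ext x
    simp [Equiv.permCongr_apply]
  choose σ hσ using key
  exact ⟨fun k => (σ k).1, fun k => (σ k).2, funext hσ⟩

theorem disjUnion_injective {κ A B X : Type*} (e : A ⊕ B ≃ X) :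
    Function.Injective fun p : (κ → Perm A) × (κ → Perm B) => disjUnion e p.1 p.2 := by
  rintro ⟨ρ₁, ρ₂⟩ ⟨ρ₁', ρ₂'⟩ h
  simp only at h
  refine Prod.ext ?_ ?_
  · funext k
    ext x
    have := congrFun h k
    have := congrArg (fun σ : Perm X => σ (e (Sum.inl x))) this
    simpa [disjUnion_inl] using this
  · funext k
    ext x
    have := congrFun h k
    have := congrArg (fun σ : Perm X => σ (e (Sum.inr x))) this
    simpa [disjUnion_inr] using this

open Classical in
/-- Sums over families that preserve one summand. -/
theorem sum_disjUnion {κ A B X : Type*} [Fintype κ] [Fintype A] [Fintype B] [Fintype X]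
    [DecidableEq A] [DecidableEq B] [DecidableEq X]
    (e : A ⊕ B ≃ X) (F : (κ → Perm X) → ℂ) :
    ∑ ρ, (if ∀ k x, ∃ y, ρ k (e (Sum.inl x)) = e (Sum.inl y) then F ρ else 0) =
      ∑ ρ₁ : κ → Perm A, ∑ ρ₂ : κ → Perm B, F (disjUnion e ρ₁ ρ₂) := by
  rw [← Finset.sum_filter, ← Fintype.sum_prod_type']
  symm
  refine Finset.sum_nbij (fun p => disjUnion e p.1 p.2) ?_ ?_ ?_ ?_
  · rintro ⟨ρ₁, ρ₂⟩ -
    simp only [Finset.mem_filter, Finset.mem_univ, true_and]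
    exact fun k x => ⟨ρ₁ k x, disjUnion_inl _ _ _ _ _⟩
  · exact (disjUnion_injective e).injOn
  · rintro ρ hρ
    obtain ⟨ρ₁, ρ₂, h⟩ := exists_disjUnion e ρ (by simpa using hρ)
    exact ⟨(ρ₁, ρ₂), by simp, h⟩
  · intro p _; rfl

/-- `K` is an orbit of the family `ρ`. -/
def IsOrbit {κ X : Type*} (ρ : κ → Perm X) (K : Finset X) : Prop :=
  K.Nonempty ∧ (∀ k x, ρ k x ∈ K ↔ x ∈ K) ∧
    ∀ f : X → Prop, (∀ k x, f (ρ k x) ↔ f x) → ∀ x ∈ K, ∀ y ∈ K, f x ↔ f y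

open Classical in
/-- The orbits partition the set. -/
theorem sum_orbits {κ X : Type*} [Fintype X] (ρ : κ → Perm X) (f : X → ℂ) :
    ∑ x, f x = ∑ K : Finset X, if IsOrbit ρ K then ∑ x ∈ K, f x else 0 := by
  let orb : X → Finset X := fun x => Finset.univ.filter fun y =>
    ∀ g : X → Prop, (∀ k z, g (ρ k z) ↔ g z) → (g x ↔ g y)
  have horb : ∀ x, IsOrbit ρ (orb x) := by
    intro x
    refine ⟨⟨x, by simp [orb]⟩, fun k z => ?_, fun g hg y hy z hz => ?_⟩
    · simp only [orb, Finset.mem_filter, Finset.mem_univ, true_and]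
      constructor
      · intro h g hg; rw [h g hg, hg]
      · intro h g hg; rw [h g hg, hg]
    · simp only [orb, Finset.mem_filter, Finset.mem_univ, true_and] at hy hz
      rw [← hy g hg, hz g hg]
  have huniq : ∀ K x, IsOrbit ρ K → x ∈ K → orb x = K := by
    intro K x hK hx
    ext y
    simp only [orb, Finset.mem_filter, Finset.mem_univ, true_and]
    constructor
    · intro h
      exact (h (fun z => z ∈ K) hK.2.1).1 hx
    · intro hy g hg
      exact hK.2.2 g hg x hx y hy
  rw [← Finset.sum_fiberwise (s := Finset.univ) (g := orb)]
  refine Finset.sum_congr rfl fun K _ => ?_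
  split_ifs with h
  · refine Finset.sum_congr ?_ fun _ _ => rfl
    ext x
    simp only [Finset.mem_filter, Finset.mem_univ, true_and]
    constructor
    · rintro rfl; simp [orb]
    · exact huniq K x h
  · refine Finset.sum_eq_zero fun x hx => ?_
    rw [Finset.mem_filter] at hx
    exact absurd (hx.2 ▸ horb x) h

/-- The first summand of a disjoint union is an orbit if and only if the first family
is transitive. -/
theorem isOrbit_disjUnion {κ A B X : Type*} [Fintype X] (e : A ⊕ B ≃ X) (K : Finset X)
    (hK : ∀ s, e s ∈ K ↔ s.isLeft) (ρ₁ : κ → Perm A) (ρ₂ : κ → Perm B) :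
    IsOrbit (disjUnion e ρ₁ ρ₂) K ↔ Nonempty A ∧ FamConn ρ₁ := by
  constructor
  · rintro ⟨⟨x, hx⟩, -, h⟩
    obtain ⟨s, rfl⟩ := e.surjective x
    refine ⟨?_, fun f hf x y => ?_⟩
    · rw [hK] at hx
      obtain ⟨y, rfl⟩ := Sum.isLeft_iff.1 hx
      exact ⟨y⟩
    · have := h (fun z => Sum.elim f (fun _ => True) (e.symm z)) ?_ (e (Sum.inl x))
        ((hK _).2 rfl) (e (Sum.inl y)) ((hK _).2 rfl)
      · simpa using this
      · intro k z
        obtain ⟨s, rfl⟩ := e.surjective z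
        rcases s with s | s
        · rw [disjUnion_inl]; simpa using hf k s
        · rw [disjUnion_inr]; simp
  · rintro ⟨⟨a⟩, h⟩
    refine ⟨⟨e (Sum.inl a), (hK _).2 rfl⟩, ?_, ?_⟩
    · intro k z
      obtain ⟨s, rfl⟩ := e.surjective z
      rcases s with s | s
      · rw [disjUnion_inl, hK, hK]; rfl
      · rw [disjUnion_inr, hK, hK]; rfl
    · intro f hf x hx y hy
      obtain ⟨s, rfl⟩ := e.surjective x
      obtain ⟨t, rfl⟩ := e.surjective y
      rw [hK] at hx hy
      obtain ⟨s, rfl⟩ := Sum.isLeft_iff.1 hx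
      obtain ⟨t, rfl⟩ := Sum.isLeft_iff.1 hy
      refine h (fun z => f (e (Sum.inl z))) (fun k z => ?_) s t
      rw [← disjUnion_inl e ρ₁ ρ₂, hf]

/-- A weight on families of permutations of finite sets that is multiplicative under disjoint
unions, together with a degree that is the sum of the local terms `δ`. The last axiom makes the
degree a natural number and leaves finitely many set sizes in each degree. -/
structure MulWeight (κ : Type) where
  w : ∀ n, (κ → Perm (Fin n)) → ℂ
  δ : ∀ n, (κ → Perm (Fin n)) → Fin n → ℚ
  w_zero : ∀ ρ, w 0 ρ = 1
  w_mul : ∀ (n a b : ℕ) (e : Fin a ⊕ Fin b ≃ Fin n) ρ₁ ρ₂,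
    w n (disjUnion e ρ₁ ρ₂) = w a ρ₁ * w b ρ₂
  δ_inl : ∀ (n a b : ℕ) (e : Fin a ⊕ Fin b ≃ Fin n) ρ₁ ρ₂ x,
    δ n (disjUnion e ρ₁ ρ₂) (e (Sum.inl x)) = δ a ρ₁ x
  δ_inr : ∀ (n a b : ℕ) (e : Fin a ⊕ Fin b ≃ Fin n) ρ₁ ρ₂ x,
    δ n (disjUnion e ρ₁ ρ₂) (e (Sum.inr x)) = δ b ρ₂ x
  deg_bound : ∀ n ρ, w n ρ ≠ 0 → ∃ m : ℕ, ∑ x, δ n ρ x = m ∧ n ≤ 3 * m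

namespace MulWeight

variable {κ : Type} [Fintype κ] (M : MulWeight κ)

/-- The degree of a family of permutations. -/
def deg {n : ℕ} (ρ : κ → Perm (Fin n)) : ℚ := ∑ x, M.δ n ρ x

open Classical in
/-- The total weight of all families on `n` points of degree `m`. -/
def total (n m : ℕ) : ℂ := ∑ ρ : κ → Perm (Fin n), if M.deg ρ = m then M.w n ρ else 0

open Classical in
/-- The total weight of the transitive families on `n > 0` points of degree `m`. -/
def connected (n m : ℕ) : ℂ :=
  ∑ ρ : κ → Perm (Fin n), if 0 < n ∧ FamConn ρ ∧ M.deg ρ = m then M.w n ρ else 0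

theorem total_eq_zero {n m : ℕ} (h : 3 * m < n) : M.total n m = 0 := by
  classical
  refine Finset.sum_eq_zero fun ρ _ => ?_
  split_ifs with hd
  · by_contra hw
    obtain ⟨m', h1, h2⟩ := M.deg_bound n ρ hw
    have : (m' : ℚ) = m := h1.symm.trans hd
    have : m' = m := by exact_mod_cast this
    omega
  · rfl

theorem connected_eq_zero {n m : ℕ} (h : 3 * m < n) : M.connected n m = 0 := by
  classical
  refine Finset.sum_eq_zero fun ρ _ => ?_
  split_ifs with hd
  · by_contra hw
    obtain ⟨m', h1, h2⟩ := M.deg_bound n ρ hw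
    have : (m' : ℚ) = m := h1.symm.trans hd.2.2
    have : m' = m := by exact_mod_cast this
    omega
  · rfl

omit [Fintype κ] in
theorem deg_disjUnion {n a b : ℕ} (e : Fin a ⊕ Fin b ≃ Fin n) (ρ₁ : κ → Perm (Fin a))
    (ρ₂ : κ → Perm (Fin b)) : M.deg (disjUnion e ρ₁ ρ₂) = M.deg ρ₁ + M.deg ρ₂ := by
  rw [deg, ← e.sum_comp, Fintype.sum_sum_type]
  simp_rw [M.δ_inl, M.δ_inr]
  rfl

open Classical in
/-- The contribution of the orbit `K` to the degree, summed over all families: the families with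
the orbit `K` are the disjoint unions of a transitive family on `K` and a family on the rest. -/
theorem sum_isOrbit (n m : ℕ) (K : Finset (Fin n)) :
    ∑ ρ : κ → Perm (Fin n), (if IsOrbit ρ K then ∑ x ∈ K,
        (if M.deg ρ = m then M.w n ρ * (M.δ n ρ x : ℂ) else 0) else 0) =
      ∑ p ∈ Finset.HasAntidiagonal.antidiagonal m, (p.1 : ℂ) * M.connected K.card p.1 *
        M.total (n - K.card) p.2 := by
  have hc : (Kᶜ).card = n - K.card := by rw [Finset.card_compl, Fintype.card_fin]
  let e : Fin K.card ⊕ Fin (n - K.card) ≃ Fin n := finSumEquivOfFinset rfl hc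
  have hK : ∀ s, e s ∈ K ↔ s.isLeft := by
    rintro (s | s)
    · simp [e]
    · have : e (Sum.inr s) ∈ Kᶜ := by
        simp only [e, finSumEquivOfFinset_inr]
        exact Finset.orderEmbOfFin_mem _ _ _
      simpa using this
  have hKe : K = Finset.univ.map ⟨fun x => e (Sum.inl x), fun x y h => by simpa using h⟩ := by
    ext x
    obtain ⟨s, rfl⟩ := e.surjective x
    rw [hK, Sum.isLeft_iff, Finset.mem_map]
    constructor
    · rintro ⟨y, rfl⟩; exact ⟨y, Finset.mem_univ _, rfl⟩
    · rintro ⟨y, -, hy⟩; exact ⟨y, (e.injective hy).symm⟩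
  have h1 : ∀ ρ : κ → Perm (Fin n), (if IsOrbit ρ K then ∑ x ∈ K,
        (if M.deg ρ = m then M.w n ρ * (M.δ n ρ x : ℂ) else 0) else 0) =
      if ∀ k x, ∃ y, ρ k (e (Sum.inl x)) = e (Sum.inl y) then
        (if IsOrbit ρ K then ∑ x ∈ K,
        (if M.deg ρ = m then M.w n ρ * (M.δ n ρ x : ℂ) else 0) else 0) else 0 := by
    intro ρ
    by_cases h : IsOrbit ρ K
    · refine (if_pos fun k x => ?_).symm
      have h2 : e (e.symm (ρ k (e (Sum.inl x)))) ∈ K := by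
        rw [e.apply_symm_apply, h.2.1, hK]; rfl
      rw [hK] at h2
      obtain ⟨y, hy⟩ := Sum.isLeft_iff.1 h2
      exact ⟨y, by rw [← hy, e.apply_symm_apply]⟩
    · rw [if_neg h, ite_self]
  rw [Finset.sum_congr rfl fun ρ _ => h1 ρ]
  refine (Eq.trans (by congr!) (sum_disjUnion e fun ρ => if IsOrbit ρ K then ∑ x ∈ K,
    (if M.deg ρ = m then M.w n ρ * (M.δ n ρ x : ℂ) else 0) else 0)).trans ?_
  simp_rw [connected, total]
  have h2 : ∀ (ρ₁ : κ → Perm (Fin K.card)) (ρ₂ : κ → Perm (Fin (n - K.card))),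
      (if IsOrbit (disjUnion e ρ₁ ρ₂) K then ∑ x ∈ K,
        (if M.deg (disjUnion e ρ₁ ρ₂) = m then M.w n (disjUnion e ρ₁ ρ₂) *
          (M.δ n (disjUnion e ρ₁ ρ₂) x : ℂ) else 0) else 0) =
      ∑ p ∈ Finset.HasAntidiagonal.antidiagonal m, (p.1 : ℂ) *
        (if 0 < K.card ∧ FamConn ρ₁ ∧ M.deg ρ₁ = p.1 then M.w K.card ρ₁ else 0) *
        (if M.deg ρ₂ = p.2 then M.w (n - K.card) ρ₂ else 0) := by
    intro ρ₁ ρ₂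
    rw [isOrbit_disjUnion e K hK, ← Fin.pos_iff_nonempty, M.deg_disjUnion, M.w_mul]
    by_cases hcon : 0 < K.card ∧ FamConn ρ₁
    · rw [if_pos hcon]
      have hsum : ∀ F : Fin n → ℂ, ∑ x ∈ K, F x = ∑ x, F (e (Sum.inl x)) := fun F => by
        conv_lhs => rw [hKe, Finset.sum_map]
        rfl
      rw [hsum]
      simp only [M.δ_inl]
      by_cases hw : M.w K.card ρ₁ * M.w (n - K.card) ρ₂ = 0
      · rw [Finset.sum_eq_zero fun x _ => by rw [hw]; simp]
        symm
        refine Finset.sum_eq_zero fun p _ => ?_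
        split_ifs
        · rw [mul_assoc, hw, mul_zero]
        all_goals simp
      · obtain ⟨m₁, hm₁, -⟩ := M.deg_bound _ ρ₁ (left_ne_zero_of_mul hw)
        obtain ⟨m₂, hm₂, -⟩ := M.deg_bound _ ρ₂ (right_ne_zero_of_mul hw)
        have e1 : M.deg ρ₁ = m₁ := hm₁
        have e2 : M.deg ρ₂ = m₂ := hm₂
        rw [e1, e2]
        by_cases hm : m₁ + m₂ = m
        · rw [Finset.sum_eq_single (m₁, m₂)]
          · simp only [hcon.1, hcon.2, true_and, if_true]
            have : ((m₁ : ℚ) + m₂ = m) := by exact_mod_cast hm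
            simp only [this, if_true]
            rw [← Finset.mul_sum, ← Rat.cast_sum, hm₁]
            push_cast; ring
          · intro p _ hp
            have : ¬ (m₁ = p.1 ∧ m₂ = p.2) := fun h => hp (Prod.ext h.1.symm h.2.symm)
            simp only [Nat.cast_inj]
            by_cases h1 : m₁ = p.1
            · rw [if_neg (c := m₂ = p.2) (fun h2 => this ⟨h1, h2⟩), mul_zero]
            · rw [if_neg (fun h2 => h1 h2.2.2), mul_zero, zero_mul]
          · intro h; exact absurd (Finset.HasAntidiagonal.mem_antidiagonal.2 hm) h
        · rw [Finset.sum_eq_zero, Finset.sum_eq_zero]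
          · intro p hp
            rw [Finset.HasAntidiagonal.mem_antidiagonal] at hp
            simp only [Nat.cast_inj]
            by_cases h1 : m₁ = p.1
            · rw [if_neg (c := m₂ = p.2) (fun h2 => hm (by omega)), mul_zero]
            · rw [if_neg (fun h2 => h1 h2.2.2), mul_zero, zero_mul]
          · intro x _
            rw [if_neg]
            exact_mod_cast hm
    · rw [if_neg hcon]
      symm
      refine Finset.sum_eq_zero fun p _ => ?_
      rw [if_neg (fun h => hcon ⟨h.1, h.2.1⟩), mul_zero, zero_mul]
  simp_rw [h2]
  rw [Finset.sum_congr rfl fun ρ₁ _ => Finset.sum_comm, Finset.sum_comm]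
  refine Finset.sum_congr rfl fun p _ => ?_
  rw [mul_assoc, Finset.sum_mul_sum, Finset.mul_sum]
  refine Finset.sum_congr rfl fun ρ₁ _ => ?_
  rw [Finset.mul_sum]
  exact Finset.sum_congr rfl fun ρ₂ _ => mul_assoc _ _ _

/-- A recursion for the total weight. The degree is a sum over the points, and the points are sorted
by their orbits; the part of the degree on an orbit is the degree of a transitive family, and the
other points carry an arbitrary family. -/
theorem mul_total (n m : ℕ) :
    (m : ℂ) * M.total n m = ∑ i ∈ Finset.range (n + 1), (n.choose i : ℂ) *
      ∑ p ∈ Finset.HasAntidiagonal.antidiagonal m, (p.1 : ℂ) * M.connected i p.1 * M.total (n - i) p.2 := by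
  classical
  have h1 : (m : ℂ) * M.total n m = ∑ ρ : κ → Perm (Fin n), ∑ x,
      (if M.deg ρ = m then M.w n ρ * (M.δ n ρ x : ℂ) else 0) := by
    rw [total, Finset.mul_sum]
    refine Finset.sum_congr rfl fun ρ _ => ?_
    split_ifs with h
    · rw [← Finset.mul_sum, ← Rat.cast_sum, show ∑ x, M.δ n ρ x = m from h]
      push_cast; ring
    · simp
  rw [h1, Finset.sum_congr rfl fun ρ _ => sum_orbits ρ _, Finset.sum_comm]
  simp_rw [M.sum_isOrbit n m]
  rw [← Finset.powerset_univ, Finset.sum_powerset_apply_card (fun i =>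
    ∑ p ∈ Finset.HasAntidiagonal.antidiagonal m, (p.1 : ℂ) * M.connected i p.1 * M.total (n - i) p.2)]
  simp [nsmul_eq_mul]

/-- The generating series of the transitive families in the degree. -/
def connectedSeries : PowerSeries ℂ :=
  PowerSeries.mk fun m => ∑ n ∈ Finset.range (3 * m + 1), M.connected n m / (n.factorial : ℂ)

/-- The generating series of all families in the degree. -/
def totalSeries : PowerSeries ℂ :=
  PowerSeries.mk fun m => ∑ n ∈ Finset.range (3 * m + 1), M.total n m / (n.factorial : ℂ)

/-- The exponential formula. The polynomials in the number of points make the sums over `n`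
into evaluations at one. -/
theorem totalSeries_eq_exp : M.totalSeries = (PowerSeries.exp ℂ).subst M.connectedSeries := by
  classical
  let P : (ℕ → ℕ → ℂ) → ℕ → Polynomial ℂ := fun a m =>
    ∑ n ∈ Finset.range (3 * m + 1), Polynomial.monomial n (a n m / (n.factorial : ℂ))
  have hP : ∀ a : ℕ → ℕ → ℂ, (∀ n m, 3 * m < n → a n m = 0) → ∀ m n,
      (P a m).coeff n = a n m / (n.factorial : ℂ) := by
    intro a ha m n
    simp only [P, Polynomial.finsetSum_coeff, Polynomial.coeff_monomial]
    rw [Finset.sum_ite_eq']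
    split_ifs with h
    · rfl
    · rw [ha n m (by simpa [Nat.lt_succ_iff] using h), zero_div]
  have hev : ∀ a : ℕ → ℕ → ℂ, ∀ m, (P a m).eval 1 =
      ∑ n ∈ Finset.range (3 * m + 1), a n m / (n.factorial : ℂ) := by
    intro a m
    simp [P, Polynomial.eval_finsetSum]
  have ht := hP M.total fun n m h => M.total_eq_zero h
  have hcn := hP M.connected fun n m h => M.connected_eq_zero h
  -- the recursion for the exponential generating polynomials, by comparison of coefficients
  have hpoly : ∀ m : ℕ, Polynomial.C (m : ℂ) * P M.total m =
      ∑ p ∈ Finset.HasAntidiagonal.antidiagonal m, Polynomial.C (p.1 : ℂ) * P M.connected p.1 * P M.total p.2 := by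
    intro m
    ext n
    rw [Polynomial.coeff_C_mul, ht, ← mul_div_assoc, M.mul_total, Polynomial.finsetSum_coeff]
    simp_rw [mul_assoc, Polynomial.coeff_C_mul, Polynomial.coeff_mul, hcn, ht]
    rw [Finset.sum_div]
    simp_rw [Finset.Nat.sum_antidiagonal_eq_sum_range_succ_mk, Finset.mul_sum, Finset.sum_div]
    rw [Finset.sum_comm]
    refine Finset.sum_congr rfl fun j _ => Finset.sum_congr rfl fun i hi => ?_
    have hin : i ≤ n := Nat.lt_succ_iff.1 (Finset.mem_range.1 hi)
    have hf := Nat.choose_mul_factorial_mul_factorial hin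
    have hf' : (n.choose i : ℂ) * i.factorial * (n - i).factorial = n.factorial := by
      exact_mod_cast hf
    have h1 : (i.factorial : ℂ) ≠ 0 := by exact_mod_cast i.factorial_ne_zero
    have h2 : ((n - i).factorial : ℂ) ≠ 0 := by exact_mod_cast (n - i).factorial_ne_zero
    have h3 : (n.choose i : ℂ) ≠ 0 := by exact_mod_cast (Nat.choose_pos hin).ne'
    rw [← hf']
    field_simp
  refine PowerSeries.eq_exp_subst ?_ ?_ fun m => ?_
  · rw [← PowerSeries.coeff_zero_eq_constantCoeff_apply, connectedSeries, PowerSeries.coeff_mk]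
    simp [connected]
  · rw [totalSeries, PowerSeries.coeff_mk]
    simp [total, deg, M.w_zero]
  · simp only [totalSeries, connectedSeries, PowerSeries.coeff_mk]
    have := congrArg (Polynomial.eval 1) (hpoly m)
    simpa [Polynomial.eval_finsetSum, Polynomial.eval_mul, hev] using this

end MulWeight

/-! ### Fatgraphs on a fixed set of half-edges -/

/-- The axioms of a fatgraph with labelled faces, for permutations of an arbitrary set. -/
structure IsFatgraph {X : Type*} {s : ℕ} (σ ι : Perm X) (face : X → Fin s) : Prop where
  pairing : IsPairing ι
  valency : ∀ d, σ d ≠ d ∧ σ (σ d) ≠ d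
  conn : Conn σ ι
  surj : Function.Surjective face
  face_iff : ∀ d d', face d = face d' ↔ SameCycle (σ * ι) d d'

/-- The condition `V - E + F = 2 - 2 g`, multiplied by two. -/
def EulerEq {X : Type*} (σ : Perm X) (g s : ℕ) : Prop :=
  2 * (cyc σ : ℤ) - Nat.card X + 2 * s = 4 - 4 * g

/-- A product over half-edges as a product over edges. -/
theorem prod_eq_prod_edges {X M : Type*} [Fintype X] [DecidableEq X] [CommMonoid M] {ι : Perm X}
    (hι : IsPairing ι) (f : X → M) (F : Sym2 X → M) (h : ∀ d, f d * f (ι d) = F s(d, ι d)) :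
    ∏ d, f d = ∏ e ∈ Finset.univ.image (fun d => s(d, ι d)), F e := by
  rw [← Finset.prod_fiberwise_of_maps_to (g := fun d => s(d, ι d))
    (t := Finset.univ.image (fun d => s(d, ι d))) (fun d hd => Finset.mem_image_of_mem _ hd)]
  refine Finset.prod_congr rfl fun e he => ?_
  obtain ⟨a, -, rfl⟩ := Finset.mem_image.1 he
  have : Finset.univ.filter (fun d => s(d, ι d) = s(a, ι a)) = {a, ι a} := by
    ext d
    simp only [Finset.mem_filter, Finset.mem_univ, true_and, Finset.mem_insert,
      Finset.mem_singleton, Sym2.eq_iff]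
    constructor
    · rintro (h | h)
      · exact Or.inl h.1
      · exact Or.inr h.1
    · rintro (rfl | rfl)
      · exact Or.inl ⟨rfl, rfl⟩
      · exact Or.inr ⟨rfl, hι.1 _⟩
  rw [this, Finset.prod_pair (hι.2 a).symm, h]

theorem two_mul_card_edges {X : Type*} [Fintype X] [DecidableEq X] {ι : Perm X}
    (hι : IsPairing ι) :
    2 * (Finset.univ.image (fun d => s(d, ι d))).card = Fintype.card X := by
  have := prod_eq_prod_edges hι (fun _ => 2) (fun _ => 4) (fun _ => rfl)
  rw [Finset.prod_const, Finset.prod_const, Finset.card_univ, show 4 = 2 ^ 2 from rfl,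
    ← pow_mul] at this
  exact (Nat.pow_right_injective le_rfl this).symm

/-- If all cycles have length at least three, there are at most `|X| / 3` of them. -/
theorem three_mul_cyc_le {X : Type*} [Finite X] {σ : Perm X}
    (h : ∀ d, σ d ≠ d ∧ σ (σ d) ≠ d) : 3 * cyc σ ≤ Nat.card X := by
  have := Fintype.ofFinite X
  have hmp : ∀ x, 3 ≤ Function.minimalPeriod σ x := by
    intro x
    have hp : 0 < Function.minimalPeriod σ x := by
      rw [← card_sameCycle]
      exact Nat.card_pos_iff.2 ⟨⟨⟨x, SameCycle.refl _ _⟩⟩, inferInstance⟩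
    have hper := Function.iterate_minimalPeriod (f := σ) (x := x)
    by_contra hlt
    have : Function.minimalPeriod σ x = 1 ∨ Function.minimalPeriod σ x = 2 := by omega
    rcases this with h1 | h1
    · rw [h1] at hper; exact (h x).1 hper
    · rw [h1] at hper; exact (h x).2 hper
  have h1 : (cyc σ : ℚ) ≤ ∑ _x : X, 1 / 3 := by
    rw [cyc_eq_sum]
    refine Finset.sum_le_sum fun x _ => ?_
    exact one_div_le_one_div_of_le (by norm_num) (by exact_mod_cast hmp x)
  rw [Finset.sum_const, Finset.card_univ, nsmul_eq_mul] at h1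
  have h2 : (3 * cyc σ : ℚ) ≤ Fintype.card X := by linarith
  rw [Nat.card_eq_fintype_card]
  exact_mod_cast h2

namespace Fatgraph

variable {s : ℕ}

theorem isPairing (G : Fatgraph s) : IsPairing G.ι := ⟨G.ι_ι, G.ι_ne⟩

theorem isFatgraph (G : Fatgraph s) : IsFatgraph G.σ G.ι G.face :=
  ⟨G.isPairing, G.valency, (conn_iff_closure _ _).2 G.connected, G.face_surjective,
    G.face_eq_iff⟩

theorem hasGenus_iff (G : Fatgraph s) (g : ℕ) : G.HasGenus g ↔ EulerEq G.σ g s := by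
  have h := two_mul_card_edges G.isPairing
  rw [Fintype.card_fin] at h
  have h1 : G.numVertices = cyc G.σ := rfl
  rw [HasGenus, EulerEq, Nat.card_fin, h1, edges]
  omega

/-- The fatgraph on `Fin n` with given permutations. -/
def ofIsFatgraph {n : ℕ} {σ ι : Perm (Fin n)} {face : Fin n → Fin s}
    (h : IsFatgraph σ ι face) : Fatgraph s where
  n := n
  σ := σ
  ι := ι
  face := face
  ι_ι := h.pairing.1
  ι_ne := h.pairing.2
  valency := h.valency
  connected := (conn_iff_closure _ _).1 h.conn
  face_surjective := h.surj
  face_eq_iff := h.face_iff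

/-- The number of half-edges is bounded by genus and number of faces; hence there are finitely many
fatgraphs. -/
theorem n_lt (G : Fatgraph s) {g : ℕ} (h : G.HasGenus g) : G.n < 12 * g + 6 * s + 1 := by
  rw [hasGenus_iff, EulerEq, Nat.card_fin] at h
  have := three_mul_cyc_le G.valency
  rw [Nat.card_fin] at this
  omega

end Fatgraph

/-- Transport of the fatgraph axioms along a bijection. -/
theorem IsFatgraph.congr {X Y : Type*} {s : ℕ} {σ ι : Perm X} {face : X → Fin s}
    {σ' ι' : Perm Y} {face' : Y → Fin s} (e : X ≃ Y) (h1 : ∀ x, e (σ x) = σ' (e x))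
    (h2 : ∀ x, e (ι x) = ι' (e x)) (h3 : ∀ x, face' (e x) = face x)
    (h : IsFatgraph σ ι face) : IsFatgraph σ' ι' face' where
  pairing := h.pairing.congr e h2
  valency := by
    intro d
    obtain ⟨x, rfl⟩ := e.surjective d
    rw [← h1, ← h1]
    exact ⟨fun hh => (h.valency x).1 (e.injective hh), fun hh => (h.valency x).2 (e.injective hh)⟩
  conn := h.conn.congr e h1 h2
  surj := by
    intro i
    obtain ⟨x, rfl⟩ := h.surj i
    exact ⟨e x, h3 x⟩
  face_iff := by
    intro d d'
    obtain ⟨x, rfl⟩ := e.surjective d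
    obtain ⟨y, rfl⟩ := e.surjective d'
    rw [h3, h3, h.face_iff, sameCycle_equiv (σ := σ * ι) (τ := σ' * ι') e
      fun x => by simp [h1, h2]]

/-- The fatgraphs of genus `g` with `s` labelled faces. -/
abbrev FatgraphOfGenus (g s : ℕ) : Type := {G : Fatgraph s // G.HasGenus g}

/-- Fatgraphs as triples of maps on initial segments of the natural numbers. -/
def fatgraphEquiv (g s : ℕ) :
    FatgraphOfGenus g s ≃ Σ n : Fin (12 * g + 6 * s + 1),
      {t : Perm (Fin n) × Perm (Fin n) × (Fin n → Fin s) //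
        IsFatgraph t.1 t.2.1 t.2.2 ∧ EulerEq t.1 g s} where
  toFun G := ⟨⟨G.1.n, G.1.n_lt G.2⟩, ⟨(G.1.σ, G.1.ι, G.1.face),
    G.1.isFatgraph, (G.1.hasGenus_iff g).1 G.2⟩⟩
  invFun t := ⟨Fatgraph.ofIsFatgraph t.2.2.1, (Fatgraph.hasGenus_iff _ g).2 t.2.2.2⟩
  left_inv _ := rfl
  right_inv _ := rfl

instance finite_fatgraphOfGenus (g s : ℕ) : Finite (FatgraphOfGenus g s) :=
  Finite.of_equiv _ (fatgraphEquiv g s).symm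

instance finite_shape (g s : ℕ) : Finite (Shape g s) :=
  inferInstanceAs (Finite (Quotient (fatgraphSetoid g s)))

instance fintype_fatgraphOfGenus (g s : ℕ) : Fintype (FatgraphOfGenus g s) := Fintype.ofFinite _

instance fintype_shape (g s : ℕ) : Fintype (Shape g s) := Fintype.ofFinite _

open Classical in
theorem sum_fatgraphOfGenus {K : Type*} [AddCommMonoid K] (g s : ℕ)
    (F : ∀ n, Perm (Fin n) → Perm (Fin n) → (Fin n → Fin s) → K) :
    ∑ G : FatgraphOfGenus g s, F G.1.n G.1.σ G.1.ι G.1.face =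
      ∑ n ∈ Finset.range (12 * g + 6 * s + 1), ∑ t : Perm (Fin n) × Perm (Fin n) × (Fin n → Fin s),
        if IsFatgraph t.1 t.2.1 t.2.2 ∧ EulerEq t.1 g s then F n t.1 t.2.1 t.2.2 else 0 := by
  refine (Fintype.sum_equiv (fatgraphEquiv g s) _
    (fun t => F t.1 t.2.1.1 t.2.1.2.1 t.2.1.2.2) (fun G => rfl)).trans ?_
  rw [Finset.sum_range, Fintype.sum_sigma]
  refine Finset.sum_congr rfl fun n _ => ?_
  rw [← Finset.sum_filter]
  exact (Finset.sum_subtype _ (by simp)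
    (fun t : Perm (Fin n) × Perm (Fin n) × (Fin n → Fin s) => F n t.1 t.2.1 t.2.2)).symm

/-! ### Sums over isomorphism classes as sums over labelled objects -/

namespace Fatgraph

variable {s : ℕ}

/-- The fatgraph with its half-edges renamed by `e`. -/
def rename (H : Fatgraph s) (e : Perm (Fin H.n)) : Fatgraph s :=
  ofIsFatgraph (n := H.n) (σ := e * H.σ * e⁻¹) (ι := e * H.ι * e⁻¹) (face := H.face ∘ (e⁻¹ : Perm _))
    (H.isFatgraph.congr e (fun x => by simp) (fun x => by simp) (fun x => by simp))

/-- The renaming is an isomorphism. -/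
def renameIso (H : Fatgraph s) (e : Perm (Fin H.n)) : Iso H (H.rename e) :=
  ⟨e, fun d => show e (H.σ d) = (e * H.σ * e⁻¹) (e d) by simp,
    fun d => show e (H.ι d) = (e * H.ι * e⁻¹) (e d) by simp,
    fun d => show (H.face ∘ (e⁻¹ : Perm _)) (e d) = H.face d by simp⟩

theorem exists_rename_eq {H G : Fatgraph s} (e : Iso H G) : ∃ e', H.rename e' = G := by
  obtain ⟨n, σ, ι, face, _, _, _, _, _, _⟩ := G
  obtain ⟨e, h1, h2, h3⟩ := e
  have hn : H.n = n := by simpa using Fintype.card_congr e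
  subst hn
  refine ⟨e, ?_⟩
  simp only [rename, ofIsFatgraph, Fatgraph.mk.injEq, heq_eq_eq, true_and]
  refine ⟨?_, ?_, ?_⟩
  · ext x; simp [h1]
  · ext x; simp [h2]
  · ext x
    have := h3 ((e⁻¹ : Perm _) x)
    rw [Function.comp_apply, ← this]
    exact congrArg (fun y => (face y).1) (perm_apply_inv e x)

theorem rename_eq_iff {H : Fatgraph s} (e e' : Perm (Fin H.n)) :
    H.rename e = H.rename e' ↔ (∀ d, (e⁻¹ * e') (H.σ d) = H.σ ((e⁻¹ * e') d)) ∧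
      (∀ d, (e⁻¹ * e') (H.ι d) = H.ι ((e⁻¹ * e') d)) ∧ ∀ d, H.face ((e⁻¹ * e') d) = H.face d := by
  have aux : ∀ τ : Perm (Fin H.n), e * τ * e⁻¹ = e' * τ * e'⁻¹ ↔
      ∀ d, (e⁻¹ * e') (τ d) = τ ((e⁻¹ * e') d) := by
    intro τ
    constructor
    · intro h d
      have h' : e⁻¹ * e' * τ = τ * (e⁻¹ * e') := by
        calc e⁻¹ * e' * τ = e⁻¹ * (e' * τ * e'⁻¹) * e' := by group
          _ = τ * (e⁻¹ * e') := by rw [← h]; group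
      exact congrArg (fun τ' : Perm (Fin H.n) => τ' d) h'
    · intro h
      have h' : e⁻¹ * e' * τ = τ * (e⁻¹ * e') := Equiv.ext h
      calc e * τ * e⁻¹ = e * (τ * (e⁻¹ * e')) * e'⁻¹ := by group
        _ = e' * τ * e'⁻¹ := by rw [← h']; group
  simp only [rename, ofIsFatgraph, Fatgraph.mk.injEq, heq_eq_eq, true_and, aux]
  refine and_congr_right fun _ => and_congr_right fun _ => ?_
  constructor
  · intro h d
    have := congrFun h (e' d)
    simpa using this
  · intro h
    funext x
    have := h ((e'⁻¹ : Perm _) x)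
    simpa [perm_apply_inv] using this

theorem card_rename_fiber (H : Fatgraph s) (e₀ : Perm (Fin H.n)) :
    Nat.card {e : Perm (Fin H.n) // H.rename e = H.rename e₀} = H.autCard := by
  refine Nat.card_congr
    { toFun := fun e => ⟨e₀⁻¹ * e.1, (rename_eq_iff e₀ e.1).1 e.2.symm⟩
      invFun := fun φ => ⟨e₀ * φ.1, ((rename_eq_iff e₀ (e₀ * φ.1)).2 ?_).symm⟩
      left_inv := fun e => Subtype.ext (by simp)
      right_inv := fun φ => Subtype.ext (by ext x; simp) }
  simpa using φ.2

end Fatgraph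

/-- The isomorphism class of a fatgraph. -/
def shapeOf {g s : ℕ} (G : FatgraphOfGenus g s) : Shape g s := Quotient.mk (fatgraphSetoid g s) G

theorem shapeOf_out {g s : ℕ} (γ : Shape g s) : shapeOf (Quotient.out γ) = γ := Quotient.out_eq γ

open Classical in
/-- The number of labelled fatgraphs in an isomorphism class, multiplied by the order of the
automorphism group, is the number of all labellings. -/
theorem card_class_mul_autCard {g s : ℕ} (γ : Shape g s) :
    (Finset.univ.filter fun G : FatgraphOfGenus g s =>
      shapeOf G = γ).card * γ.graph.autCard =
      (γ.graph.n).factorial := by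
  have hgen : ∀ e, (γ.graph.rename e).HasGenus g := by
    intro e
    have h1 := (γ.graph.hasGenus_iff g).1 (Quotient.out γ).2
    rw [Fatgraph.hasGenus_iff]
    have h2 : cyc (γ.graph.rename e).σ = cyc γ.graph.σ :=
      (cyc_congr (γ.graph.renameIso e).1 (γ.graph.renameIso e).2.1).symm
    rw [EulerEq, h2]
    exact h1
  let R : Perm (Fin γ.graph.n) → FatgraphOfGenus g s := fun e => ⟨γ.graph.rename e, hgen e⟩
  have hcard : (γ.graph.n).factorial = Fintype.card (Perm (Fin γ.graph.n)) := by
    rw [Fintype.card_perm, Fintype.card_fin]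
  rw [hcard, ← Finset.card_univ, Finset.card_eq_sum_card_fiberwise (f := R)
    (t := Finset.univ.filter fun G : FatgraphOfGenus g s =>
      shapeOf G = γ), Finset.sum_const_nat]
  · intro G hG
    rw [Finset.mem_filter] at hG
    have hr : (fatgraphSetoid g s).r (Quotient.out γ) G :=
      Quotient.exact (s := fatgraphSetoid g s) ((shapeOf_out γ).trans hG.2.symm)
    obtain ⟨e⟩ := hr
    obtain ⟨e₀, he₀⟩ := Fatgraph.exists_rename_eq e
    rw [← Fatgraph.card_rename_fiber γ.graph e₀, Nat.card_eq_fintype_card, Fintype.card_subtype]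
    congr 1
    ext e'
    simp only [Finset.mem_filter, Finset.mem_univ, true_and, R, Subtype.ext_iff]
    rw [show γ.graph.rename e₀ = G.1 from he₀]
  · intro e _
    rw [Finset.coe_filter, Set.mem_ofPred_eq]
    refine ⟨Finset.mem_univ _, ?_⟩
    refine Eq.trans (Quotient.sound (s := fatgraphSetoid g s) ?_).symm (shapeOf_out γ)
    exact ⟨γ.graph.renameIso e⟩

/-- Orbit counting: an isomorphism class contains `n! / |Aut|` fatgraphs on `Fin n`, so that a sum
over classes with the weights `1 / |Aut|` is a sum over labelled fatgraphs with the weights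
`1 / n!`. -/
theorem sum_shape_eq {K : Type*} [Field K] [CharZero K] {g s : ℕ} (f : Fatgraph s → K)
    (hf : ∀ G G' : Fatgraph s, Nonempty (Fatgraph.Iso G G') → f G = f G') :
    ∑ᶠ γ : Shape g s, f γ.graph / (γ.graph.autCard : K) =
      ∑ G : FatgraphOfGenus g s, f G.1 / (G.1.n.factorial : K) := by
  classical
  rw [finsum_eq_sum_of_fintype, ← Finset.sum_fiberwise (s := Finset.univ)
    (g := fun G : FatgraphOfGenus g s => shapeOf G)]
  refine Finset.sum_congr rfl fun γ _ => ?_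
  have h : ∀ G ∈ Finset.univ.filter (fun G : FatgraphOfGenus g s =>
      shapeOf G = γ),
      f G.1 / (G.1.n.factorial : K) = f γ.graph / (γ.graph.n.factorial : K) := by
    intro G hG
    rw [Finset.mem_filter] at hG
    have hr : (fatgraphSetoid g s).r (Quotient.out γ) G :=
      Quotient.exact (s := fatgraphSetoid g s) ((shapeOf_out γ).trans hG.2.symm)
    obtain ⟨e⟩ := hr
    have hn : γ.graph.n = G.1.n := by
      have := Fintype.card_congr e.1
      rwa [Fintype.card_fin, Fintype.card_fin] at this
    rw [← hf _ _ ⟨e⟩, ← hn]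
    rfl
  have hc := card_class_mul_autCard γ
  have hfac : (γ.graph.n.factorial : K) ≠ 0 := by exact_mod_cast γ.graph.n.factorial_ne_zero
  have haut : (γ.graph.autCard : K) ≠ 0 := by
    intro h0
    have : γ.graph.autCard = 0 := by exact_mod_cast h0
    rw [this, mul_zero] at hc
    exact γ.graph.n.factorial_ne_zero hc.symm
  refine Eq.trans ?_ (Finset.sum_congr rfl h).symm
  rw [Finset.sum_const, nsmul_eq_mul]
  have hc' : ((Finset.univ.filter (fun G : FatgraphOfGenus g s =>
      shapeOf G = γ)).card : K) * γ.graph.autCard =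
      γ.graph.n.factorial := by exact_mod_cast hc
  rw [← hc'] at hfac ⊢
  have := left_ne_zero_of_mul hfac
  field_simp

theorem card_lengths_congr {s : ℕ} {G G' : Fatgraph s} (e : Fatgraph.Iso G G')
    (P : Fin s → ℕ+) : Nat.card (G.Lengths P) = Nat.card (G'.Lengths P) := by
  obtain ⟨e, h1, h2, h3⟩ := e
  refine Nat.card_congr (Equiv.subtypeEquiv (e.arrowCongr (Equiv.refl _)) fun len => ?_)
  refine and_congr ?_ (forall_congr' fun I => ?_)
  · constructor
    · intro h d
      obtain ⟨x, rfl⟩ := e.surjective d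
      simpa [← h2] using h x
    · intro h d
      simpa [← h2] using h (e d)
  · have : ∑ d ∈ Finset.univ.filter (fun d => G'.face d = I),
        (((e.arrowCongr (Equiv.refl ℕ+)) len d : ℕ+) : ℕ) =
        ∑ d ∈ Finset.univ.filter (fun d => G.face d = I), (len d : ℕ) := by
      rw [Finset.sum_filter, Finset.sum_filter, ← e.sum_comp]
      refine Finset.sum_congr rfl fun d _ => ?_
      rw [h3]; simp
    rw [this]

theorem discreteVolume_eq_sum (g s : ℕ) (P : Fin s → ℕ+) :
    discreteVolume g s P = ∑ G : FatgraphOfGenus g s,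
      (Nat.card (G.1.Lengths P) : ℚ) / (G.1.n.factorial : ℚ) :=
  sum_shape_eq (fun G => (Nat.card (G.Lengths P) : ℚ))
    fun _ _ ⟨e⟩ => by rw [card_lengths_congr e P]

theorem prod_propagator_eq {s : ℕ} (G : Fatgraph s) (l : Fin s → ℂ) (r : Fin G.n → ℂ)
    (hr : ∀ d, r d * r (G.ι d) =
      1 / (Complex.exp (l (G.face d) + l (G.face (G.ι d))) - 1)) :
    ∏ e ∈ G.edges, propagator l (e.map G.face) = ∏ d, r d :=
  (prod_eq_prod_edges G.isPairing r (fun e => propagator l (e.map G.face)) fun d => by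
    rw [hr]; rfl).symm

/-! ### The Laplace transform of the discrete volumes -/

theorem hasSum_prod_option {α β : Type*} [Fintype α] (h : Option α → β → ℂ)
    (hs : ∀ e, Summable (h e))
    (ih : HasSum (fun k : α → β => ∏ e, h (some e) (k e)) (∏ e, ∑' k, h (some e) k)) :
    HasSum (fun k : Option α → β => ∏ e, h e (k e)) (∏ e, ∑' k, h e k) := by
  have h1 : Summable fun p : β × (α → β) => h none p.1 * ∏ e, h (some e) (p.2 e) :=
    summable_mul_of_summable_norm (f := h none) (g := fun k : α → β => ∏ e, h (some e) (k e))
      (hs none).norm ih.summable.norm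
  have h2 := HasSum.mul (f := h none) (g := fun k : α → β => ∏ e, h (some e) (k e))
    (hs none).hasSum ih h1
  rw [← (Equiv.piOptionEquivProd (β := fun _ : Option α => β)).symm.hasSum_iff,
    Fintype.prod_option]
  refine h2.congr_fun fun p => ?_
  rw [Function.comp_apply, Fintype.prod_option]
  rfl

theorem hasSum_prod_equiv {α γ β : Type*} [Fintype α] [Fintype γ] (e : α ≃ γ) (h : γ → β → ℂ)
    (ih : HasSum (fun k : α → β => ∏ a, h (e a) (k a)) (∏ a, ∑' k, h (e a) k)) :
    HasSum (fun k : γ → β => ∏ c, h c (k c)) (∏ c, ∑' k, h c k) := by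
  rw [e.prod_comp (fun c => ∑' k, h c k)] at ih
  rw [← (e.arrowCongr (Equiv.refl β)).hasSum_iff]
  refine ih.congr_fun fun k => ?_
  rw [Function.comp_apply, ← e.prod_comp]
  simp

/-- Absolutely convergent series in different variables may be multiplied. -/
theorem hasSum_prod_pi {E β : Type*} [Fintype E] (h : E → β → ℂ) (hs : ∀ e, Summable (h e)) :
    HasSum (fun k : E → β => ∏ e, h e (k e)) (∏ e, ∑' k, h e k) := by
  have key : ∀ (n : ℕ) (h : Fin n → β → ℂ), (∀ e, Summable (h e)) →
      HasSum (fun k : Fin n → β => ∏ e, h e (k e)) (∏ e, ∑' k, h e k) := by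
    intro n
    induction n with
    | zero => simp
    | succ n ih =>
      intro h hs
      exact hasSum_prod_equiv (finSuccEquiv n).symm h
        (hasSum_prod_option _ (fun _ => hs _) (ih _ fun _ => hs _))
  exact hasSum_prod_equiv (Fintype.equivFin E).symm h (key _ _ fun _ => hs _)

theorem hasSum_exp_pnat {y : ℂ} (hy : 0 < y.re) :
    HasSum (fun k : ℕ+ => Complex.exp (-((k : ℕ) : ℂ) * y)) (1 / (Complex.exp y - 1)) := by
  have hn : ‖Complex.exp (-y)‖ < 1 := by
    rw [Complex.norm_exp, Complex.neg_re, Real.exp_lt_one_iff]; linarith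
  have h := (hasSum_geometric_of_norm_lt_one hn).mul_left (Complex.exp (-y))
  rw [← Equiv.pnatEquivNat.symm.hasSum_iff]
  have e1 : (1 - Complex.exp (-y))⁻¹ = Complex.exp y / (Complex.exp y - 1) := by
    have h0 := Complex.exp_ne_zero y
    rw [Complex.exp_neg]
    have h1 : Complex.exp y - 1 ≠ 0 := by
      intro h1
      rw [Complex.exp_neg, sub_eq_zero.1 h1, inv_one, norm_one] at hn
      exact lt_irrefl _ hn
    have h2 : 1 - (Complex.exp y)⁻¹ = (Complex.exp y - 1) / Complex.exp y := by field_simp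
    rw [h2, inv_div]
  rw [e1, ← mul_div_assoc, ← Complex.exp_add, neg_add_cancel, Complex.exp_zero] at h
  refine h.congr_fun fun n => ?_
  rw [Function.comp_apply, ← Complex.exp_nat_mul, ← Complex.exp_add]
  congr 1
  have : (((Equiv.pnatEquivNat.symm n : ℕ+) : ℕ) : ℂ) = n + 1 := by
    simp
  rw [this]; ring

namespace Fatgraph

variable {s : ℕ}

/-- Positive integer lengths of the edges, as functions on half-edges. -/
abbrev SymLen (G : Fatgraph s) : Type := {len : Fin G.n → ℕ+ // ∀ d, len (G.ι d) = len d}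

theorem mem_edges (G : Fatgraph s) (d : Fin G.n) : s(d, G.ι d) ∈ G.edges :=
  Finset.mem_image_of_mem _ (Finset.mem_univ d)

theorem symLen_out (G : Fatgraph s) (len : G.SymLen) (d : Fin G.n) :
    len.1 (Quot.out s(d, G.ι d)).1 = len.1 d := by
  have h : (Quot.out s(d, G.ι d)).1 ∈ s(d, G.ι d) := Sym2.out_fst_mem _
  rcases Sym2.mem_iff.1 h with h | h
  · rw [h]
  · rw [h, len.2]

/-- Lengths as functions on the set of edges. -/
def symLenEquiv (G : Fatgraph s) : G.SymLen ≃ (G.edges → ℕ+) where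
  toFun len e := len.1 (Quot.out e.1).1
  invFun f := ⟨fun d => f ⟨s(d, G.ι d), G.mem_edges d⟩, fun d => congrArg f (Subtype.ext (by
    show s(G.ι d, G.ι (G.ι d)) = s(d, G.ι d)
    rw [G.ι_ι, Sym2.eq_swap]))⟩
  left_inv len := Subtype.ext (funext fun d => G.symLen_out len d)
  right_inv f := by
    funext ⟨e, he⟩
    obtain ⟨d, -, rfl⟩ := Finset.mem_image.1 he
    refine congrArg f (Subtype.ext ?_)
    have h : (Quot.out s(d, G.ι d)).1 ∈ s(d, G.ι d) := Sym2.out_fst_mem _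
    show s((Quot.out s(d, G.ι d)).1, G.ι (Quot.out s(d, G.ι d)).1) = s(d, G.ι d)
    rcases Sym2.mem_iff.1 h with h | h
    · exact congrArg (fun x => s(x, G.ι x)) h
    · exact (congrArg (fun x => s(x, G.ι x)) h).trans (by rw [G.ι_ι, Sym2.eq_swap])

/-- The lengths of different edges are independent, and each edge contributes a geometric series. -/
theorem hasSum_symLen (G : Fatgraph s) {l : Fin s → ℂ} (hl : ∀ I, 0 < (l I).re) :
    HasSum (fun len : G.SymLen =>
      ∏ d, Complex.exp (-(((len.1 d : ℕ+) : ℕ) : ℂ) * l (G.face d)))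
      (∏ e ∈ G.edges, propagator l (e.map G.face)) := by
  let y : Sym2 (Fin G.n) → ℂ :=
    Sym2.lift ⟨fun a b => l (G.face a) + l (G.face b), fun a b => add_comm _ _⟩
  have hy : ∀ e, 0 < (y e).re := by
    intro e
    induction e with
    | _ a b => exact add_pos (hl _) (hl _)
  have hprop : ∀ e, propagator l (e.map G.face) = 1 / (Complex.exp (y e) - 1) := by
    intro e
    induction e with
    | _ a b => rfl
  have h := hasSum_prod_pi (fun (e : G.edges) (k : ℕ+) => Complex.exp (-((k : ℕ) : ℂ) * y e.1))
    (fun e => (hasSum_exp_pnat (hy e.1)).summable)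
  rw [← G.symLenEquiv.hasSum_iff] at h
  convert h using 1
  · funext len
    rw [Function.comp_apply, prod_eq_prod_edges G.isPairing _
      (fun e => Complex.exp (-(((len.1 (Quot.out e).1 : ℕ+) : ℕ) : ℂ) * y e))]
    · exact (Finset.prod_coe_sort G.edges
        (fun e => Complex.exp (-(((len.1 (Quot.out e).1 : ℕ+) : ℕ) : ℂ) * y e))).symm
    · intro d
      rw [G.symLen_out, len.2, ← Complex.exp_add]
      congr 1
      show _ = -_ * (l (G.face d) + l (G.face (G.ι d)))
      ring
  · rw [← Finset.prod_coe_sort]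
    refine Finset.prod_congr rfl fun e _ => ?_
    rw [hprop, (hasSum_exp_pnat (hy e.1)).tsum_eq]

/-- The perimeters of the faces. -/
def perimeter (G : Fatgraph s) (len : Fin G.n → ℕ+) (I : Fin s) : ℕ+ :=
  ⟨∑ d ∈ Finset.univ.filter (fun d => G.face d = I), (len d : ℕ), by
    obtain ⟨d, hd⟩ := G.face_surjective I
    exact Finset.sum_pos (fun d _ => (len d).pos) ⟨d, by simp [hd]⟩⟩

/-- Lengths are sorted by the perimeters. -/
def sigmaLengthsEquiv (G : Fatgraph s) : (Σ P : Fin s → ℕ+, G.Lengths P) ≃ G.SymLen where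
  toFun p := ⟨p.2.1, p.2.2.1⟩
  invFun len := ⟨G.perimeter len.1, ⟨len.1, len.2, fun _ => rfl⟩⟩
  left_inv := by
    rintro ⟨P, ⟨len, h1, h2⟩⟩
    have : G.perimeter len = P := by
      funext I
      exact PNat.eq (h2 I)
    subst this
    rfl
  right_inv _ := rfl

instance finite_lengths (G : Fatgraph s) (P : Fin s → ℕ+) : Finite (G.Lengths P) := by
  have hle : ∀ (len : G.Lengths P) d, (len.1 d : ℕ) < P (G.face d) + 1 := by
    intro len d
    rw [Nat.lt_succ_iff, ← len.2.2 (G.face d)]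
    exact Finset.single_le_sum (f := fun d => (len.1 d : ℕ)) (fun _ _ => Nat.zero_le _)
      (by simp)
  refine Finite.of_injective (β := ∀ d, Fin (P (G.face d) + 1))
    (fun len d => ⟨len.1 d, hle len d⟩) fun len len' h => Subtype.ext (funext fun d => PNat.eq ?_)
  exact congrArg Fin.val (congrFun h d)

theorem prod_exp_eq (G : Fatgraph s) (l : Fin s → ℂ) (P : Fin s → ℕ+) (len : G.Lengths P) :
    ∏ d, Complex.exp (-(((len.1 d : ℕ+) : ℕ) : ℂ) * l (G.face d)) =
      Complex.exp (-∑ I, ((P I : ℕ) : ℂ) * l I) := by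
  rw [← Complex.exp_sum, ← Finset.sum_fiberwise (s := Finset.univ) (g := G.face),
    ← Finset.sum_neg_distrib]
  congr 1
  refine Finset.sum_congr rfl fun I _ => ?_
  rw [← len.2.2 I, Nat.cast_sum, Finset.sum_mul, ← Finset.sum_neg_distrib]
  refine Finset.sum_congr rfl fun d hd => ?_
  rw [(Finset.mem_filter.1 hd).2]; ring

theorem hasSum_lengths (G : Fatgraph s) {l : Fin s → ℂ} (hl : ∀ I, 0 < (l I).re) :
    HasSum (fun P : Fin s → ℕ+ => (Nat.card (G.Lengths P) : ℂ) *
      Complex.exp (-∑ I, ((P I : ℕ) : ℂ) * l I))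
      (∏ e ∈ G.edges, propagator l (e.map G.face)) := by
  have h := G.hasSum_symLen hl
  rw [← G.sigmaLengthsEquiv.hasSum_iff] at h
  refine h.sigma fun P => ?_
  have := Fintype.ofFinite (G.Lengths P)
  have h2 := hasSum_fintype fun len : G.Lengths P =>
    ∏ d, Complex.exp (-(((len.1 d : ℕ+) : ℕ) : ℂ) * l (G.face d))
  rw [Finset.sum_congr rfl fun len _ => G.prod_exp_eq l P len, Finset.sum_const, nsmul_eq_mul,
    Finset.card_univ, ← Nat.card_eq_fintype_card] at h2
  exact h2

end Fatgraph

theorem hasSum_laplaceTerm (g : ℕ) {s : ℕ} {l : Fin s → ℂ} (hl : ∀ I, 0 < (l I).re) :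
    HasSum (laplaceTerm g l) (∑ G : FatgraphOfGenus g s,
      (∏ e ∈ G.1.edges, propagator l (e.map G.1.face)) / (G.1.n.factorial : ℂ)) := by
  have h := hasSum_sum (s := (Finset.univ : Finset (FatgraphOfGenus g s))) fun G _ =>
    (G.1.hasSum_lengths hl).div_const (G.1.n.factorial : ℂ)
  refine h.congr_fun fun P => ?_
  rw [laplaceTerm, discreteVolume_eq_sum]
  push_cast
  rw [Finset.sum_mul]
  exact Finset.sum_congr rfl fun G _ => by ring

theorem prod_propagator_iso {s : ℕ} (l : Fin s → ℂ) {G G' : Fatgraph s} (e : Fatgraph.Iso G G') :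
    ∏ e ∈ G.edges, propagator l (e.map G.face) = ∏ e ∈ G'.edges, propagator l (e.map G'.face) := by
  obtain ⟨e, h1, h2, h3⟩ := e
  have hedge : G'.edges = G.edges.image (Sym2.map e) := by
    rw [Fatgraph.edges, Fatgraph.edges, Finset.image_image]
    ext x
    simp only [Finset.mem_image, Finset.mem_univ, true_and, Function.comp_apply, Sym2.map_mk]
    constructor
    · rintro ⟨d, rfl⟩
      exact ⟨e.symm d, by simp [h2]⟩
    · rintro ⟨d, rfl⟩
      exact ⟨e d, by rw [h2]⟩
  rw [hedge, Finset.prod_image fun x _ y _ h => Sym2.map.injective e.injective h]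
  refine Finset.prod_congr rfl fun x _ => ?_
  rw [Sym2.map_map]
  congr 2
  funext d
  exact (h3 d).symm

theorem shapeSum_eq_sum (g : ℕ) {s : ℕ} (l : Fin s → ℂ) :
    shapeSum g l = ∑ G : FatgraphOfGenus g s,
      (∏ e ∈ G.1.edges, propagator l (e.map G.1.face)) / (G.1.n.factorial : ℂ) := by
  rw [← sum_shape_eq (fun G => ∏ e ∈ G.edges, propagator l (e.map G.face))
    fun G G' ⟨e⟩ => prod_propagator_iso l e, shapeSum]
  exact finsum_congr fun γ => by ring

/-- The Laplace transform of the discrete volumes is the sum over fatgraphs of the products of the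
propagators. -/
theorem laplaceVolume_eq_shapeSum (g : ℕ) {s : ℕ} {l : Fin s → ℂ} (hl : ∀ I, 0 < (l I).re) :
    Summable (laplaceTerm g l) ∧ laplaceVolume g l = shapeSum g l := by
  have h := hasSum_laplaceTerm g hl
  exact ⟨h.summable, by rw [shapeSum_eq_sum]; exact h.tsum_eq⟩

/-! ### The Gaussian weights of the two matrix models -/

theorem hermitianOf_mul_hermitianOf {N : ℕ} (A : Fin N → Fin N → ℝ) (i j : Fin N) :
    hermitianOf A i j * hermitianOf A j i =
      (((if i = j then A i j ^ 2 else A i j ^ 2 + A j i ^ 2 : ℝ)) : ℂ) := by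
  simp only [hermitianOf, Matrix.of_apply]
  rcases lt_trichotomy i j with hij | rfl | hij
  · rw [if_neg hij.ne, if_pos hij, if_neg hij.ne', if_neg hij.not_gt, if_neg hij.ne]
    apply Complex.ext <;> simp [pow_two]
    ring
  · simp [pow_two]
  · rw [if_neg hij.ne', if_neg hij.not_gt, if_neg hij.ne, if_pos hij, if_neg hij.ne']
    apply Complex.ext <;> simp [pow_two] <;> ring

/-- The quadratic form is diagonal in the real coordinates; there, an entry off the diagonal occurs
twice. -/
theorem sum_mul_hermitianOf {N : ℕ} (K : Fin N → Fin N → ℝ) (hK : ∀ i j, K i j = K j i)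
    (A : Fin N → Fin N → ℝ) :
    ∑ i, ∑ j, (K i j : ℂ) * (hermitianOf A i j * hermitianOf A j i) =
      ((∑ p : Fin N × Fin N,
        2 * ((if p.1 = p.2 then K p.1 p.2 / 2 else K p.1 p.2) * A p.1 p.2 ^ 2) : ℝ) : ℂ) := by
  simp_rw [hermitianOf_mul_hermitianOf]
  norm_cast
  have h1 : ∀ i j, K i j * (if i = j then A i j ^ 2 else A i j ^ 2 + A j i ^ 2) =
      K i j * A i j ^ 2 + (if i = j then 0 else K j i * A j i ^ 2) := by
    intro i j
    split_ifs with h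
    · ring
    · rw [hK j i]; ring
  simp_rw [h1, Finset.sum_add_distrib]
  rw [Finset.sum_comm (f := fun i j => if i = j then 0 else K j i * A j i ^ 2),
    ← Finset.sum_add_distrib, Fintype.sum_prod_type]
  refine Finset.sum_congr rfl fun i _ => ?_
  rw [← Finset.sum_add_distrib]
  refine Finset.sum_congr rfl fun j _ => ?_
  by_cases h : i = j
  · subst h; simp; ring
  · simp [h, Ne.symm h]; ring

theorem isGaussianWeight_exp {N : ℕ} {c : Fin N → Fin N → ℝ} (hc : ∀ i j, 0 < c i j)
    (hs : ∀ i j, c i j = c j i) {w : Matrix (Fin N) (Fin N) ℂ → ℂ}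
    (hw : ∀ H, w H = Complex.exp (-(1 / 2) * ∑ i, ∑ j, (c i j : ℂ) * (H i j * H j i))) :
    IsGaussianWeight c w := by
  refine ⟨hc, hs, fun A => ?_⟩
  rw [hw, sum_mul_hermitianOf c hs, ← Complex.ofReal_prod, ← Real.exp_sum, Complex.ofReal_exp]
  congr 1
  push_cast
  rw [Finset.mul_sum]
  refine Finset.sum_congr rfl fun p _ => ?_
  ring

theorem isGaussianWeight_gue {N : ℕ} (hN : 0 < N) :
    IsGaussianWeight (N := N) (fun _ _ => N)
      (fun H => Complex.exp (-((N : ℂ) / 2) * (H * H).trace)) := by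
  refine isGaussianWeight_exp (fun _ _ => by exact_mod_cast hN) (fun _ _ => rfl) fun H => ?_
  congr 1
  simp only [Matrix.trace, Matrix.diag_apply, Matrix.mul_apply, ← Finset.mul_sum]
  push_cast
  ring

/-- The inverse variances of the external field weight are the inverses of the propagators, times
`N`. -/
theorem isGaussianWeight_kpmm {N : ℕ} (hN : 0 < N) {l : Fin N → ℝ} (hl : ∀ i, 0 < l i) :
    IsGaussianWeight (fun i j => N * (Real.exp (l i + l j) - 1)) (kpmmWeight l) := by
  refine isGaussianWeight_exp (fun i j => ?_) (fun i j => by rw [add_comm]) fun H => ?_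
  · have : 1 < Real.exp (l i + l j) := Real.one_lt_exp_iff.2 (add_pos (hl i) (hl j))
    have hN' : (0 : ℝ) < N := by exact_mod_cast hN
    exact mul_pos hN' (by linarith)
  · rw [kpmmWeight]
    congr 1
    have h1 : (Matrix.diagonal (fun i => (Real.exp (l i) : ℂ)) * H *
        Matrix.diagonal (fun i => (Real.exp (l i) : ℂ)) * H).trace =
        ∑ i, ∑ j, (Real.exp (l i + l j) : ℂ) * (H i j * H j i) := by
      simp only [Matrix.trace, Matrix.diag_apply]
      refine Finset.sum_congr rfl fun i _ => ?_
      rw [Matrix.mul_apply]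
      refine Finset.sum_congr rfl fun j _ => ?_
      rw [Matrix.mul_diagonal, Matrix.diagonal_mul, Real.exp_add]
      push_cast
      ring
    have h2 : (H * H).trace = ∑ i, ∑ j, H i j * H j i := by
      simp only [Matrix.trace, Matrix.diag_apply, Matrix.mul_apply]
    rw [h1, h2]
    push_cast
    simp_rw [mul_sub, mul_one, sub_mul, Finset.sum_sub_distrib, mul_assoc, ← Finset.mul_sum]
    ring

/-! ### Multiplicativity under disjoint unions -/

section DisjointUnion

variable {A B X : Type*} (e : A ⊕ B ≃ X) (α : Perm A) (β : Perm B)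

theorem permCongr_sumCongr_inl (x : A) :
    e.permCongr (Perm.sumCongr α β) (e (Sum.inl x)) = e (Sum.inl (α x)) := by
  simp [Equiv.permCongr_apply]

theorem permCongr_sumCongr_inr (x : B) :
    e.permCongr (Perm.sumCongr α β) (e (Sum.inr x)) = e (Sum.inr (β x)) := by
  simp [Equiv.permCongr_apply]

theorem minimalPeriod_inl (x : A) :
    Function.minimalPeriod (e.permCongr (Perm.sumCongr α β)) (e (Sum.inl x)) =
      Function.minimalPeriod α x :=
  minimalPeriod_semiconj (e := fun x => e (Sum.inl x)) (fun x y h => by simpa using h)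
    (fun x => (permCongr_sumCongr_inl e α β x).symm) x

theorem minimalPeriod_inr (x : B) :
    Function.minimalPeriod (e.permCongr (Perm.sumCongr α β)) (e (Sum.inr x)) =
      Function.minimalPeriod β x :=
  minimalPeriod_semiconj (e := fun x => e (Sum.inr x)) (fun x y h => by simpa using h)
    (fun x => (permCongr_sumCongr_inr e α β x).symm) x

theorem cyc_sumCongr [Finite A] [Finite B] :
    cyc (e.permCongr (Perm.sumCongr α β)) = cyc α + cyc β := by
  have := Fintype.ofFinite A
  have := Fintype.ofFinite B
  have := Fintype.ofEquiv _ e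
  have : (cyc (e.permCongr (Perm.sumCongr α β)) : ℚ) = cyc α + cyc β := by
    rw [cyc_eq_sum, cyc_eq_sum, cyc_eq_sum, ← e.sum_comp, Fintype.sum_sum_type]
    simp_rw [minimalPeriod_inl, minimalPeriod_inr]
  exact_mod_cast this

theorem forall_sum_equiv_iff {P : X → Prop} :
    (∀ x, P x) ↔ (∀ a, P (e (Sum.inl a))) ∧ ∀ b, P (e (Sum.inr b)) := by
  rw [← e.forall_congr_right, Sum.forall]

theorem prod_sum_equiv {M : Type*} [CommMonoid M] [Fintype A] [Fintype B] [Fintype X]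
    (f : X → M) : ∏ x, f x = (∏ a, f (e (Sum.inl a))) * ∏ b, f (e (Sum.inr b)) := by
  rw [← e.prod_comp, Fintype.prod_sum_type]

theorem sum_functions_sum_equiv [Fintype A] [Fintype B] [Fintype X] [DecidableEq A]
    [DecidableEq B] [DecidableEq X] {C R : Type*} [Fintype C]
    [CommRing R] (F : (X → C) → R) (F₁ : (A → C) → R) (F₂ : (B → C) → R)
    (h : ∀ i, F i = F₁ (fun a => i (e (Sum.inl a))) * F₂ (fun b => i (e (Sum.inr b)))) :
    ∑ i, F i = (∑ i, F₁ i) * ∑ i, F₂ i := by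
  rw [Finset.sum_mul_sum, ← Fintype.sum_prod_type']
  refine Fintype.sum_equiv ((e.symm.arrowCongr (Equiv.refl C)).trans
    (Equiv.sumArrowEquivProdArrow A B C)) _ _ fun i => ?_
  rw [h]
  rfl

end DisjointUnion

/-- The condition that all vertices have valency at least three. -/
def MinValency {X : Type*} (σ : Perm X) : Prop := ∀ d, σ d ≠ d ∧ σ (σ d) ≠ d

theorem minValency_sumCongr {A B X : Type*} (e : A ⊕ B ≃ X) (α : Perm A) (β : Perm B) :
    MinValency (e.permCongr (Perm.sumCongr α β)) ↔ MinValency α ∧ MinValency β := by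
  rw [MinValency, forall_sum_equiv_iff e]
  simp only [permCongr_sumCongr_inl, permCongr_sumCongr_inr, ne_eq, e.apply_eq_iff_eq,
    Sum.inl.injEq, Sum.inr.injEq]
  rfl

theorem isPairing_sumCongr {A B X : Type*} (e : A ⊕ B ≃ X) (α : Perm A) (β : Perm B) :
    IsPairing (e.permCongr (Perm.sumCongr α β)) ↔ IsPairing α ∧ IsPairing β := by
  rw [IsPairing, forall_sum_equiv_iff e, forall_sum_equiv_iff e]
  simp only [permCongr_sumCongr_inl, permCongr_sumCongr_inr, ne_eq, e.apply_eq_iff_eq,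
    Sum.inl.injEq, Sum.inr.injEq]
  exact and_and_and_comm

/-- A colouring that is constant on the cycles of `φ`. -/
def FaceColouring {X C : Type*} (φ : Perm X) (i : X → C) : Prop := ∀ d, i (φ d) = i d

theorem faceColouring_sumCongr {A B X C : Type*} (e : A ⊕ B ≃ X) (α α' : Perm A) (β β' : Perm B)
    (i : X → C) :
    FaceColouring (e.permCongr (Perm.sumCongr α β) * e.permCongr (Perm.sumCongr α' β')) i ↔
      FaceColouring (α * α') (fun a => i (e (Sum.inl a))) ∧
        FaceColouring (β * β') (fun b => i (e (Sum.inr b))) := by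
  rw [FaceColouring, forall_sum_equiv_iff e]
  simp only [mul_apply, permCongr_sumCongr_inl, permCongr_sumCongr_inr]
  rfl

/-- The degree `n - 2 V` of a system with `V` vertices. -/
theorem sum_one_sub_minimalPeriod {X : Type*} [Fintype X] (σ : Perm X) :
    ∑ x, (1 - 2 / (Function.minimalPeriod σ x : ℚ)) = Fintype.card X - 2 * cyc σ := by
  rw [Finset.sum_sub_distrib, cyc_eq_sum, Finset.mul_sum]
  simp [div_eq_mul_inv]

/-- The degree is a natural number as the valencies are at least three. -/
theorem exists_degree {n : ℕ} {σ : Perm (Fin n)} (h : MinValency σ) :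
    ∃ m : ℕ, ∑ x, (1 - 2 / (Function.minimalPeriod σ x : ℚ)) = m ∧ n ≤ 3 * m := by
  have h3 := three_mul_cyc_le h
  rw [Nat.card_fin] at h3
  refine ⟨n - 2 * cyc σ, ?_, by omega⟩
  rw [sum_one_sub_minimalPeriod, Fintype.card_fin, Nat.cast_sub (by omega)]
  push_cast; ring

open Classical in
/-- Permutations of the half-edges with the product of the traces of `Y` along the cycles. -/
def vertexWeight {N : ℕ} (Y : Matrix (Fin N) (Fin N) ℂ) : MulWeight Unit where
  w n ρ := if MinValency (ρ ()) then
    (N : ℂ) ^ cyc (ρ ()) * ∑ i : Fin n → Fin N, ∏ d, Y (i d) (i (ρ () d)) else 0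
  δ n ρ x := 1 - 2 / (Function.minimalPeriod (ρ ()) x : ℚ)
  w_zero ρ := by
    have h : cyc (ρ ()) = 0 := by
      have := cyc_eq_sum (ρ ())
      simpa using this
    have h' : MinValency (ρ ()) := fun d => d.elim0
    simp [h, h']
  w_mul n a b e ρ₁ ρ₂ := by
    simp only [disjUnion, minValency_sumCongr, cyc_sumCongr]
    rw [sum_functions_sum_equiv e _ (fun i => ∏ d, Y (i d) (i (ρ₁ () d)))
      (fun i => ∏ d, Y (i d) (i (ρ₂ () d)))]
    · by_cases h1 : MinValency (ρ₁ ()) <;> by_cases h2 : MinValency (ρ₂ ()) <;>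
        simp only [h1, h2, and_true, and_false, if_true, if_false, zero_mul, mul_zero]
      rw [pow_add]; ring
    · intro i
      rw [prod_sum_equiv e]
      simp_rw [permCongr_sumCongr_inl, permCongr_sumCongr_inr]
  δ_inl n a b e ρ₁ ρ₂ x := by rw [disjUnion, minimalPeriod_inl]
  δ_inr n a b e ρ₁ ρ₂ x := by rw [disjUnion, minimalPeriod_inr]
  deg_bound n ρ h := exists_degree (by by_contra h'; exact h (if_neg h'))

open Classical in
/-- Pairs of a permutation (key `true`) and a pairing (key `false`) of the half-edges, with the
vertex factors `N`, the colourings of the faces, and the factors `r i j * r j i` of the edges. -/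
def ribbonWeight {N : ℕ} (r : Fin N → Fin N → ℂ) : MulWeight Bool where
  w n ρ := if MinValency (ρ true) ∧ IsPairing (ρ false) then
    (N : ℂ) ^ cyc (ρ true) * ∑ i : Fin n → Fin N,
      if FaceColouring (ρ true * ρ false) i then ∏ d, r (i d) (i (ρ false d)) else 0 else 0
  δ n ρ x := 1 - 2 / (Function.minimalPeriod (ρ true) x : ℚ)
  w_zero ρ := by
    have h : cyc (ρ true) = 0 := by
      have := cyc_eq_sum (ρ true)
      simpa using this
    have h1 : MinValency (ρ true) := fun d => d.elim0
    have h2 : IsPairing (ρ false) := ⟨fun d => d.elim0, fun d => d.elim0⟩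
    have h3 : ∀ i : Fin 0 → Fin N, FaceColouring (ρ true * ρ false) i := fun i d => d.elim0
    simp [h, h1, h2, h3]
  w_mul n a b e ρ₁ ρ₂ := by
    simp only [disjUnion, minValency_sumCongr, isPairing_sumCongr, cyc_sumCongr]
    rw [sum_functions_sum_equiv e _
      (fun i => if FaceColouring (ρ₁ true * ρ₁ false) i then ∏ d, r (i d) (i (ρ₁ false d)) else 0)
      (fun i => if FaceColouring (ρ₂ true * ρ₂ false) i then ∏ d, r (i d) (i (ρ₂ false d)) else 0)]
    · by_cases h1 : MinValency (ρ₁ true) ∧ IsPairing (ρ₁ false) <;>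
        by_cases h2 : MinValency (ρ₂ true) ∧ IsPairing (ρ₂ false)
      · rw [if_pos ⟨⟨h1.1, h2.1⟩, h1.2, h2.2⟩, if_pos h1, if_pos h2, pow_add]; ring
      · rw [if_neg (fun h => h2 ⟨h.1.2, h.2.2⟩), if_neg h2, mul_zero]
      · rw [if_neg (fun h => h1 ⟨h.1.1, h.2.1⟩), if_neg h1, zero_mul]
      · rw [if_neg (fun h => h1 ⟨h.1.1, h.2.1⟩), if_neg h1, zero_mul]
    · intro i
      rw [prod_sum_equiv e]
      simp_rw [permCongr_sumCongr_inl, permCongr_sumCongr_inr, faceColouring_sumCongr]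
      rw [ite_zero_mul_ite_zero]
  δ_inl n a b e ρ₁ ρ₂ x := by rw [disjUnion, minimalPeriod_inl]
  δ_inr n a b e ρ₁ ρ₂ x := by rw [disjUnion, minimalPeriod_inr]
  deg_bound n ρ h := exists_degree (by by_contra h'; exact h (if_neg fun hh => h' hh.1))

/-! ### The partition function of the matrix model as a sum over ribbon graphs -/

theorem cyc_eq_one {X : Type*} [Nonempty X] {σ : Perm X} (h : ∀ x y, SameCycle σ x y) :
    cyc σ = 1 := by
  rw [cyc, Nat.card_eq_one_iff_unique]
  refine ⟨⟨fun a b => ?_⟩, ⟨Quotient.mk _ (Classical.arbitrary X)⟩⟩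
  induction a using Quotient.inductionOn
  induction b using Quotient.inductionOn
  exact Quotient.sound (s := SameCycle.setoid σ) (h _ _)

theorem sum_unit_arrow {α M : Type*} [Fintype α] [AddCommMonoid M]
    {_ : Fintype (Unit → α)}
    (F : (Unit → α) → M) : ∑ ρ, F ρ = ∑ a, F fun _ => a :=
  Finset.sum_nbij' (fun ρ => ρ ()) (fun a _ => a) (by simp) (by simp) (fun _ _ => rfl)
    (fun _ _ => rfl) (fun _ _ => rfl)

theorem sum_bool_arrow {α M : Type*} [Fintype α] [AddCommMonoid M]
    {_ : Fintype (Bool → α)}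
    (F : (Bool → α) → M) : ∑ ρ, F ρ = ∑ a, ∑ b, F fun k => cond k a b := by
  rw [← Fintype.sum_prod_type']
  have h : ∀ ρ : Bool → α, (fun k => cond k (ρ true) (ρ false)) = ρ :=
    fun ρ => funext fun k => by cases k <;> rfl
  exact Finset.sum_nbij' (fun ρ => (ρ true, ρ false)) (fun a k => cond k a.1 a.2) (by simp)
    (by simp) (fun ρ _ => h ρ) (fun _ _ => rfl) (fun ρ _ => by rw [h])

theorem famConn_unit {X : Type*} {ρ : Unit → Perm X} :
    FamConn ρ ↔ ∀ x y, SameCycle (ρ ()) x y := by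
  simp only [sameCycle_iff_forall_invariant]
  exact ⟨fun h x y f hf => h f (fun _ => hf) x y, fun h f hf x y => h x y f (hf ())⟩

theorem famConn_bool {X : Type*} {ρ : Bool → Perm X} :
    FamConn ρ ↔ Conn (ρ true) (ρ false) :=
  ⟨fun h f h1 h2 => h f (Bool.forall_bool.2 ⟨h2, h1⟩), fun h f hf => h f (hf true) (hf false)⟩

theorem transitive_iff_cycleType {n : ℕ} (hn : 2 ≤ n) {σ : Perm (Fin n)} :
    (∀ x y, SameCycle σ x y) ↔ σ.cycleType = {n} := by
  have : NeZero n := ⟨by omega⟩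
  constructor
  · intro h
    have hfix : ∀ x, σ x ≠ x := by
      intro x hx
      have : ∀ y, y = x := fun y => (SameCycle.congr_invariant (h y x) (f := fun z => z = x)
        fun z => by rw [← hx, σ.apply_eq_iff_eq, hx]).mpr rfl
      have h01 := (this ⟨0, by omega⟩).trans (this ⟨1, by omega⟩).symm
      simp at h01
    have hc : IsCycle σ := ⟨0, hfix 0, fun y _ => h 0 y⟩
    have hs : σ.support = Finset.univ := by ext x; simp [hfix x]
    rw [hc.cycleType, hs]
    simp
  · intro h x y
    have hc : IsCycle σ := by rw [← card_cycleType_eq_one, h]; simp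
    have hs : σ.support.card = n := by rw [← sum_cycleType, h]; simp
    have hs' : σ.support = Finset.univ :=
      Finset.eq_univ_of_card _ (by rw [hs, Fintype.card_fin])
    exact hc.sameCycle (mem_support.1 (hs' ▸ Finset.mem_univ x))
      (mem_support.1 (hs' ▸ Finset.mem_univ y))

/-- For one cycle, the sum over the colourings is the trace of a power. -/
theorem sum_cycle_eq_trace {N n : ℕ} (hn : 2 ≤ n) {σ : Perm (Fin n)} (h : σ.cycleType = {n})
    (Y : Matrix (Fin N) (Fin N) ℂ) :
    ∑ i : Fin n → Fin N, ∏ d, Y (i d) (i (σ d)) = (Y ^ n).trace := by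
  obtain ⟨k, rfl⟩ : ∃ k, n = k + 2 := ⟨n - 2, by omega⟩
  have hconj : IsConj (finRotate (k + 2)) σ := by
    rw [isConj_iff_cycleType_eq, cycleType_finRotate, h]
  obtain ⟨c, hc⟩ := isConj_iff.1 hconj
  rw [trace_pow_eq_sum Y (by omega)]
  refine Fintype.sum_equiv (c.symm.arrowCongr (Equiv.refl _)) _ _ fun i => ?_
  rw [← Equiv.prod_comp c]
  refine Finset.prod_congr rfl fun d _ => ?_
  simp [← hc]

theorem deg_vertexWeight {N n m : ℕ} (Y : Matrix (Fin N) (Fin N) ℂ) (ρ : Unit → Perm (Fin n)) :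
    (vertexWeight Y).deg ρ = m ↔ n = m + 2 * cyc (ρ ()) := by
  have : (vertexWeight Y).deg ρ = n - 2 * cyc (ρ ()) := by
    have := sum_one_sub_minimalPeriod (ρ ())
    rwa [Fintype.card_fin] at this
  rw [this, sub_eq_iff_eq_add]
  exact_mod_cast Iff.rfl

theorem deg_ribbonWeight {N n m : ℕ} (r : Fin N → Fin N → ℂ) (ρ : Bool → Perm (Fin n)) :
    (ribbonWeight r).deg ρ = m ↔ n = m + 2 * cyc (ρ true) := by
  have : (ribbonWeight r).deg ρ = n - 2 * cyc (ρ true) := by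
    have := sum_one_sub_minimalPeriod (ρ true)
    rwa [Fintype.card_fin] at this
  rw [this, sub_eq_iff_eq_add]
  exact_mod_cast Iff.rfl

open Classical in
/-- A transitive permutation of `n` points is one of `(n - 1)!` cycles, which is a single vertex. -/
theorem connected_vertexWeight {N : ℕ} (Y : Matrix (Fin N) (Fin N) ℂ) (n m : ℕ) :
    (vertexWeight Y).connected n m =
      if 0 < m ∧ n = m + 2 then ((n - 1).factorial : ℂ) * (N * (Y ^ n).trace) else 0 := by
  rw [MulWeight.connected, sum_unit_arrow]
  have key : ∀ σ : Perm (Fin n),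
      (if 0 < n ∧ FamConn (fun _ : Unit => σ) ∧
        (vertexWeight Y).deg (fun _ : Unit => σ) = m then
        (vertexWeight Y).w n (fun _ : Unit => σ) else 0) =
      if 0 < m ∧ n = m + 2 then if σ.cycleType = {n} then (N * (Y ^ n).trace) else 0 else 0 := by
    intro σ
    simp only [deg_vertexWeight, famConn_unit]
    by_cases hn : 0 < n
    · have : Nonempty (Fin n) := ⟨⟨0, hn⟩⟩
      by_cases ht : ∀ x y, SameCycle σ x y
      · have h1 := cyc_eq_one ht
        simp only [hn, ht, implies_true, true_and, h1, mul_one]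
        by_cases hm : n = m + 2
        · simp only [hm, if_true, and_true]
          subst hm
          have hct := (transitive_iff_cycleType (by omega)).1 ht
          rw [if_pos hct]
          have hmp : ∀ x, Function.minimalPeriod σ x = m + 2 := by
            intro x
            rw [← card_sameCycle, Nat.card_congr (Equiv.subtypeUnivEquiv (ht x)), Nat.card_fin]
          have hval : MinValency σ ↔ 0 < m := by
            constructor
            · intro h
              have := three_mul_cyc_le h
              rw [Nat.card_fin] at this
              omega
            · intro hm0 d
              constructor
              · intro h
                have : Function.IsPeriodicPt σ 1 d := h
                have := this.minimalPeriod_le one_pos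
                rw [hmp] at this; omega
              · intro h
                have : Function.IsPeriodicPt σ 2 d := h
                have := this.minimalPeriod_le two_pos
                rw [hmp] at this; omega
          change (if MinValency σ then _ else _) = _
          simp only [hval]
          split_ifs
          · change (N : ℂ) ^ cyc σ * ∑ i : Fin (m + 2) → Fin N, ∏ d, Y (i d) (i (σ d)) = _
            rw [sum_cycle_eq_trace (by omega) hct, h1, pow_one]
          · rfl
        · simp only [hm, if_false, and_false]
      · have h2 : ¬ (0 < m ∧ n = m + 2) ∨ σ.cycleType ≠ {n} := by
          by_contra hh
          push Not at hh
          exact ht ((transitive_iff_cycleType (by omega)).2 hh.2)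
        rw [if_neg (fun h => ht h.2.1)]
        rcases h2 with h2 | h2
        · rw [if_neg h2]
        · rw [if_neg h2, ite_self]
    · rw [if_neg (fun h => hn h.1), if_neg (fun h => hn (by omega))]
  rw [Finset.sum_congr rfl fun σ _ => key σ]
  split_ifs with h
  · rw [← Finset.sum_filter, Finset.sum_const, nsmul_eq_mul]
    have := card_of_cycleType_singleton (α := Fin n) (n := n) (by omega)
      (by rw [Fintype.card_fin])
    rw [Fintype.card_fin, Nat.choose_self, mul_one] at this
    rw [← this]
  · simp

/-- The factor `(n - 1)! / n! = 1 / n` is the coefficient in the series of the logarithm. -/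
theorem connectedSeries_vertexWeight {N : ℕ} (Y : Matrix (Fin N) (Fin N) ℂ) :
    (vertexWeight Y).connectedSeries = kpmmInteraction Y := by
  ext m
  rw [MulWeight.connectedSeries, kpmmInteraction, PowerSeries.coeff_mk, PowerSeries.coeff_mk]
  simp_rw [connected_vertexWeight]
  rcases Nat.eq_zero_or_pos m with rfl | hm
  · simp
  · rw [if_neg hm.ne', Finset.sum_eq_single (m + 2)]
    · rw [if_pos ⟨hm, rfl⟩, show m + 2 - 1 = m + 1 from rfl, Nat.factorial_succ (m + 1)]
      have : ((m + 1).factorial : ℂ) ≠ 0 := by exact_mod_cast (m + 1).factorial_ne_zero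
      have h2 : ((m + 2 : ℕ) : ℂ) ≠ 0 := by exact_mod_cast (by omega : m + 2 ≠ 0)
      push_cast at h2 ⊢
      have h3 : (m : ℂ) + 1 + 1 = m + 2 := by ring
      rw [h3]
      field_simp
    · intro n _ hn
      rw [if_neg (fun h => hn h.2), zero_div]
    · intro h
      exact absurd (Finset.mem_range.2 (by omega)) h

open Classical in
theorem total_vertexWeight {N : ℕ} (Y : Matrix (Fin N) (Fin N) ℂ) (n m : ℕ) :
    (vertexWeight Y).total n m = ∑ σ : Perm (Fin n),
      (if MinValency σ ∧ n = m + 2 * cyc σ then (N : ℂ) ^ cyc σ else 0) *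
        ∑ i : Fin n → Fin N, ∏ d, Y (i d) (i (σ d)) := by
  rw [MulWeight.total, sum_unit_arrow]
  refine Finset.sum_congr rfl fun σ _ => ?_
  simp only [deg_vertexWeight]
  change (if n = m + 2 * cyc σ then if MinValency σ then
    (N : ℂ) ^ cyc σ * ∑ i : Fin n → Fin N, ∏ d, Y (i d) (i (σ d)) else 0 else 0) = _
  split_ifs <;> simp_all

open Classical in
theorem ribbonWeight_w {N : ℕ} (r : Fin N → Fin N → ℂ) {n : ℕ} (σ ι : Perm (Fin n)) :
    (ribbonWeight r).w n (fun k => cond k σ ι) = if MinValency σ ∧ IsPairing ι then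
      (N : ℂ) ^ cyc σ * ∑ i : Fin n → Fin N,
        (if FaceColouring (σ * ι) i then ∏ d, r (i d) (i (ι d)) else 0) else 0 := rfl

open Classical in
/-- The sums over pairings and colourings are those of Wick's theorem for the traces in
`total_vertexWeight`. -/
theorem total_ribbonWeight {N : ℕ} (r : Fin N → Fin N → ℂ) (n m : ℕ) :
    (ribbonWeight r).total n m = ∑ σ : Perm (Fin n),
      (if MinValency σ ∧ n = m + 2 * cyc σ then (N : ℂ) ^ cyc σ else 0) *
        ∑ ι ∈ pairingsOn (Finset.univ : Finset (Fin n)),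
          ∑ i ∈ Finset.univ.filter (fun i : Fin n → Fin N => ∀ d, i ((σ * ι) d) = i d),
            ∏ d, r (i d) (i (ι d)) := by
  rw [MulWeight.total, sum_bool_arrow]
  refine Finset.sum_congr rfl fun σ _ => ?_
  have h1 : pairingsOn (Finset.univ : Finset (Fin n)) = Finset.univ.filter IsPairing := by
    ext ι; rw [mem_pairingsOn_univ]; simp
  rw [h1, Finset.sum_filter, Finset.mul_sum]
  refine Finset.sum_congr rfl fun ι _ => ?_
  simp only [deg_ribbonWeight, ribbonWeight_w, cond_true, ← Finset.sum_filter]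
  by_cases h2 : IsPairing ι
  · by_cases h3 : MinValency σ
    · by_cases h4 : n = m + 2 * cyc σ
      · rw [if_pos h4, if_pos ⟨h3, h2⟩, if_pos ⟨h3, h4⟩, if_pos h2]
        refine congrArg _ (Finset.sum_congr ?_ fun _ _ => rfl)
        ext i
        simp only [Finset.mem_filter]
        rfl
      · rw [if_neg h4, if_neg (fun h => h4 h.2), zero_mul]
    · rw [if_neg (c := MinValency σ ∧ IsPairing ι) (fun h => h3 h.1), ite_self,
        if_neg (fun h => h3 h.1), zero_mul]
  · rw [if_neg (c := MinValency σ ∧ IsPairing ι) (fun h => h2 h.2), ite_self, if_neg h2, mul_zero]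

/-- The mean of the exponential of the interaction is a sum over ribbon graphs. -/
theorem hermitianMean_exp_interaction {N : ℕ} {c : Fin N → Fin N → ℝ}
    {w : Matrix (Fin N) (Fin N) ℂ → ℂ} (hw : IsGaussianWeight c w) (m : ℕ) :
    hermitianMean w (fun Y => PowerSeries.coeff m
      ((PowerSeries.exp ℂ).subst (kpmmInteraction Y))) =
      PowerSeries.coeff m (ribbonWeight fun i j =>
        ((Real.sqrt (1 / c i j) : ℝ) : ℂ)).totalSeries := by
  classical
  simp_rw [← connectedSeries_vertexWeight, ← MulWeight.totalSeries_eq_exp, MulWeight.totalSeries,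
    PowerSeries.coeff_mk, total_vertexWeight, total_ribbonWeight,
    (div_eq_inv_mul : ∀ a b : ℂ, a / b = b⁻¹ * a)]
  rw [hermitianMean_sum]
  · refine Finset.sum_congr rfl fun n _ => ?_
    rw [hermitianMean_const_mul, hermitianMean_sum]
    · congr 1
      refine Finset.sum_congr rfl fun σ _ => ?_
      rw [hermitianMean_const_mul]
      refine congrArg _ ?_
      convert hw.mean_traces σ
    · intro σ _
      simp_rw [mul_assoc]
      exact (hw.integrable_traces σ).const_mul _
  · intro n _
    simp_rw [mul_assoc, Finset.sum_mul, mul_assoc]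
    exact (MeasureTheory.integrable_finsetSum _ fun σ _ =>
      (hw.integrable_traces σ).const_mul _).const_mul _

/-- The logarithm of the partition function is the sum over connected ribbon graphs. -/
theorem kpmmPartitionFunction_eq {N : ℕ} (hN : 0 < N) {l : Fin N → ℝ} (hl : ∀ i, 0 < l i) :
    kpmmPartitionFunction l = (PowerSeries.exp ℂ).subst (ribbonWeight fun i j =>
      ((Real.sqrt (1 / (N * (Real.exp (l i + l j) - 1))) : ℝ) : ℂ)).connectedSeries := by
  rw [← MulWeight.totalSeries_eq_exp]
  ext m
  rw [kpmmPartitionFunction, PowerSeries.coeff_mk,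
    hermitianMean_exp_interaction (isGaussianWeight_kpmm hN hl)]

/-! ### Connected ribbon graphs and labelled faces -/

/-- A labelling of the cycles of `φ`. -/
def CycleLabelling {X : Type*} {s : ℕ} (φ : Perm X) (face : X → Fin s) : Prop :=
  Function.Surjective face ∧ ∀ d d', face d = face d' ↔ SameCycle φ d d'

/-- The bijection between the cycles of `φ` and their labels. -/
def CycleLabelling.equiv {X : Type*} {s : ℕ} {φ : Perm X} {face : X → Fin s}
    (h : CycleLabelling φ face) : Quotient (SameCycle.setoid φ) ≃ Fin s :=
  Equiv.ofBijective (fun q => Quotient.lift face (fun d d' hd => (h.2 d d').2 hd) q) <| by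
    constructor
    · intro a b
      induction a using Quotient.inductionOn
      induction b using Quotient.inductionOn
      exact fun hab => Quotient.sound (s := SameCycle.setoid φ) ((h.2 _ _).1 hab)
    · intro I
      obtain ⟨d, rfl⟩ := h.1 I
      exact ⟨Quotient.mk _ d, rfl⟩

theorem CycleLabelling.cyc_eq {X : Type*} {s : ℕ} {φ : Perm X} {face : X → Fin s}
    (h : CycleLabelling φ face) : cyc φ = s := by
  rw [cyc, Nat.card_congr h.equiv, Nat.card_fin]

theorem card_cycleLabelling {X : Type*} [Finite X] (φ : Perm X) :
    Nat.card {face : X → Fin (cyc φ) // CycleLabelling φ face} = (cyc φ).factorial := by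
  classical
  let E : {face : X → Fin (cyc φ) // CycleLabelling φ face} ≃
      (Quotient (SameCycle.setoid φ) ≃ Fin (cyc φ)) :=
    { toFun := fun f => f.2.equiv
      invFun := fun E => ⟨fun x => E (Quotient.mk _ x), by
        constructor
        · intro I
          obtain ⟨q, rfl⟩ := E.surjective I
          induction q using Quotient.inductionOn
          exact ⟨_, rfl⟩
        · intro d d'
          rw [E.apply_eq_iff_eq]
          exact Quotient.eq (r := SameCycle.setoid φ)⟩
      left_inv := fun f => rfl
      right_inv := fun E => by
        ext q
        induction q using Quotient.inductionOn
        rfl }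
  have := Fintype.ofFinite (Quotient (SameCycle.setoid φ))
  have e0 : Quotient (SameCycle.setoid φ) ≃ Fin (cyc φ) := Finite.equivFin _
  rw [Nat.card_congr E, Nat.card_eq_fintype_card, Fintype.card_equiv e0, cyc,
    Nat.card_eq_fintype_card]

open Classical in
/-- Colourings of the cycles, as colourings of their labels. -/
theorem sum_cycleLabelling {X R C : Type*} [Fintype X] [DecidableEq X] [Fintype C] [CommRing R]
    {s : ℕ}
    {φ : Perm X} {face : X → Fin s} (h : CycleLabelling φ face) (F : (X → C) → R) :
    ∑ j : Fin s → C, F (fun d => j (face d)) =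
      ∑ i : X → C, if FaceColouring φ i then F i else 0 := by
  rw [← Finset.sum_filter]
  refine Finset.sum_bij (fun j _ d => j (face d)) ?_ ?_ ?_ ?_
  · intro j _
    simp only [Finset.mem_filter, Finset.mem_univ, true_and]
    intro d
    exact congrArg j ((h.2 _ _).2 (sameCycle_apply_left.2 (SameCycle.refl _ _)))
  · intro j _ j' _ hj
    funext I
    obtain ⟨d, rfl⟩ := h.1 I
    exact congrFun hj d
  · intro i hi
    have hi' : FaceColouring φ i := (Finset.mem_filter.1 hi).2
    choose d hd using h.1
    refine ⟨fun I => i (d I), Finset.mem_univ _, ?_⟩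
    funext x
    exact SameCycle.congr_invariant ((h.2 _ _).1 (hd (face x))) hi'
  · intro j _; rfl

open Classical in
theorem sum_all_cycleLabellings {X R C : Type*} [Fintype X] [DecidableEq X] [Fintype C] [CommRing R]
    (φ : Perm X) (F : (X → C) → R) :
    ∑ face : X → Fin (cyc φ), (if CycleLabelling φ face then
      ∑ j : Fin (cyc φ) → C, F (fun d => j (face d)) else 0) =
      (cyc φ).factorial * ∑ i : X → C, if FaceColouring φ i then F i else 0 := by
  have h : ∀ face : X → Fin (cyc φ), (if CycleLabelling φ face then
      ∑ j : Fin (cyc φ) → C, F (fun d => j (face d)) else 0) =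
      if CycleLabelling φ face then (∑ i : X → C, if FaceColouring φ i then F i else 0) else 0 := by
    intro face
    split_ifs with hf
    · exact sum_cycleLabelling hf F
    · rfl
  rw [Finset.sum_congr rfl fun face _ => h face, ← Finset.sum_filter, Finset.sum_const,
    nsmul_eq_mul, ← card_cycleLabelling φ, Nat.card_eq_fintype_card, Fintype.card_subtype]

/-- The axioms of a fatgraph, separated into those on the ribbon graph and the labelling of its
faces. -/
theorem isFatgraph_iff {X : Type*} {s : ℕ} {σ ι : Perm X} {face : X → Fin s} :
    IsFatgraph σ ι face ↔
      (IsPairing ι ∧ MinValency σ ∧ Conn σ ι) ∧ CycleLabelling (σ * ι) face :=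
  ⟨fun h => ⟨⟨h.pairing, h.valency, h.conn⟩, h.surj, h.face_iff⟩,
    fun h => ⟨h.1.1, h.1.2.1, h.1.2.2, h.2.1, h.2.2⟩⟩

open Classical in
theorem connected_ribbonWeight {N : ℕ} (r : Fin N → Fin N → ℂ) (n m : ℕ) :
    (ribbonWeight r).connected n m = ∑ σ : Perm (Fin n), ∑ ι : Perm (Fin n),
      if 0 < n ∧ (IsPairing ι ∧ MinValency σ ∧ Conn σ ι) ∧ n = m + 2 * cyc σ then
        (N : ℂ) ^ cyc σ * ∑ i : Fin n → Fin N,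
          (if FaceColouring (σ * ι) i then ∏ d, r (i d) (i (ι d)) else 0) else 0 := by
  rw [MulWeight.connected, sum_bool_arrow]
  refine Finset.sum_congr rfl fun σ _ => Finset.sum_congr rfl fun ι _ => ?_
  simp only [deg_ribbonWeight, ribbonWeight_w, famConn_bool, cond_true, cond_false]
  by_cases h2 : IsPairing ι <;> by_cases h3 : MinValency σ <;> simp [h2, h3]

/-- The pairs `(g, s)` that contribute to the coefficient of `t ^ m`. -/
def genusPairs (m : ℕ) : Finset (ℕ × ℕ) :=
  (Finset.range (m + 3) ×ˢ Finset.range (m + 3)).filter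
    (fun p => 0 < p.2 ∧ 2 < 2 * p.1 + p.2 ∧ 2 * (2 * p.1 + p.2) = m + 4)

theorem mem_genusPairs {m : ℕ} {p : ℕ × ℕ} : p ∈ genusPairs m ↔
    0 < p.2 ∧ 2 < 2 * p.1 + p.2 ∧ 2 * (2 * p.1 + p.2) = m + 4 := by
  simp only [genusPairs, Finset.mem_filter, Finset.mem_product, Finset.mem_range,
    and_iff_right_iff_imp]
  omega

open Classical in
/-- A connected ribbon graph, as a sum over the labellings of its faces; the power of `N` is
collected from vertices, edges and faces by Euler's formula. -/
theorem ribbon_eq_sum_fatgraphs {N n m : ℕ} (hN : 0 < N) (hm : 0 < m) (r r' : Fin N → Fin N → ℂ)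
    {q : ℂ} (hq : q ^ 2 = 1 / N) (hr : ∀ i j, r i j = r' i j * q) (σ ι : Perm (Fin n)) :
    (if 0 < n ∧ (IsPairing ι ∧ MinValency σ ∧ Conn σ ι) ∧ n = m + 2 * cyc σ then
        (N : ℂ) ^ cyc σ * ∑ i : Fin n → Fin N,
          (if FaceColouring (σ * ι) i then ∏ d, r (i d) (i (ι d)) else 0) else 0) =
      ∑ p ∈ genusPairs m, (N : ℂ) ^ (2 - 2 * (p.1 : ℤ)) * (1 / (p.2.factorial : ℂ)) *
        ((1 / (N : ℂ) ^ p.2) * ∑ face : Fin n → Fin p.2,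
          if IsFatgraph σ ι face ∧ EulerEq σ p.1 p.2 then
            ∑ j : Fin p.2 → Fin N, ∏ d, r' (j (face d)) (j (face (ι d))) else 0) := by
  have hN0 : (N : ℂ) ≠ 0 := by exact_mod_cast hN.ne'
  by_cases h : 0 < n ∧ (IsPairing ι ∧ MinValency σ ∧ Conn σ ι) ∧ n = m + 2 * cyc σ
  · rw [if_pos h]
    obtain ⟨hn, hb, hd⟩ := h
    have : Nonempty (Fin n) := ⟨⟨0, hn⟩⟩
    obtain ⟨g, hg⟩ := exists_genus hb.1 hb.2.2
    rw [Fintype.card_fin] at hg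
    have hs : 0 < cyc (σ * ι) := by
      rw [cyc]
      have : Nonempty (Quotient (SameCycle.setoid (σ * ι))) := ⟨Quotient.mk _ ⟨0, hn⟩⟩
      exact Nat.card_pos
    have hmem : (g, cyc (σ * ι)) ∈ genusPairs m := by
      rw [mem_genusPairs]; refine ⟨hs, ?_, ?_⟩ <;> simp only <;> omega
    have hE : EulerEq σ g (cyc (σ * ι)) := by
      rw [EulerEq, Nat.card_fin]; omega
    rw [Finset.sum_eq_single (g, cyc (σ * ι))]
    · simp only [isFatgraph_iff, hb, hE, and_true, true_and]
      have hsum := sum_all_cycleLabellings (σ * ι)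
        (fun i : Fin n → Fin N => ∏ d, r' (i d) (i (ι d)))
      beta_reduce at hsum
      rw [hsum]
      have hfac : ((cyc (σ * ι)).factorial : ℂ) ≠ 0 := by
        exact_mod_cast (cyc (σ * ι)).factorial_ne_zero
      obtain ⟨E, hEn⟩ := hb.1.even_card
      rw [Fintype.card_fin] at hEn
      have hprod : ∀ i : Fin n → Fin N, ∏ d, r (i d) (i (ι d)) =
          (∏ d, r' (i d) (i (ι d))) / (N : ℂ) ^ E := by
        intro i
        have hqn : q ^ n = ((N : ℂ) ^ E)⁻¹ := by
          rw [hEn, ← two_mul, pow_mul, hq, one_div, inv_pow]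
        simp_rw [hr]
        rw [Finset.prod_mul_distrib, Finset.prod_const, Finset.card_univ, Fintype.card_fin, hqn,
          div_eq_mul_inv]
      simp_rw [hprod]
      have hz : (N : ℂ) ^ (2 - 2 * (g : ℤ)) * (N : ℂ) ^ E = N ^ cyc σ * N ^ cyc (σ * ι) := by
        rw [← zpow_natCast, ← zpow_natCast, ← zpow_natCast, ← zpow_add₀ hN0, ← zpow_add₀ hN0]
        congr 1
        omega
      have h1 : ∀ i : Fin n → Fin N, (if FaceColouring (σ * ι) i then
          (∏ d, r' (i d) (i (ι d))) / (N : ℂ) ^ E else 0) =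
          (1 / (N : ℂ) ^ E) * (if FaceColouring (σ * ι) i then
          (∏ d, r' (i d) (i (ι d))) else 0) := by
        intro i; split_ifs <;> ring
      simp_rw [h1]
      rw [← Finset.mul_sum]
      generalize (∑ i : Fin n → Fin N, if FaceColouring (σ * ι) i then
          (∏ d, r' (i d) (i (ι d))) else 0) = S
      have hE0 : (N : ℂ) ^ E ≠ 0 := pow_ne_zero _ hN0
      have hF0 : (N : ℂ) ^ cyc (σ * ι) ≠ 0 := pow_ne_zero _ hN0
      field_simp
      linear_combination (-S) * hz
    · rintro ⟨g', s'⟩ hp hne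
      rw [Finset.sum_eq_zero, mul_zero, mul_zero]
      intro face _
      rw [if_neg]
      rintro ⟨hf, hE'⟩
      have hc := (isFatgraph_iff.1 hf).2.cyc_eq
      rw [EulerEq, Nat.card_fin] at hE'
      simp only at hE' hc
      exact hne (Prod.ext (by simp only; omega) hc.symm)
    · intro hh; exact absurd hmem hh
  · rw [if_neg h]
    symm
    refine Finset.sum_eq_zero fun p hp => ?_
    rw [Finset.sum_eq_zero, mul_zero, mul_zero]
    intro face _
    rw [if_neg]
    rintro ⟨hf, hE'⟩
    refine h ⟨?_, (isFatgraph_iff.1 hf).1, ?_⟩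
    · obtain ⟨d, -⟩ := hf.surj ⟨0, (mem_genusPairs.1 hp).1⟩
      exact d.pos
    · rw [mem_genusPairs] at hp
      rw [EulerEq, Nat.card_fin] at hE'
      omega

/-- The connected ribbon graphs with colours at the faces, sorted by genus and number of faces, give
the Laplace transforms of the discrete volumes at the parameters of the colours. -/
theorem connectedSeries_ribbonWeight {N : ℕ} (hN : 0 < N) {l : Fin N → ℝ} (hl : ∀ i, 0 < l i) :
    (ribbonWeight fun i j =>
      ((Real.sqrt (1 / (N * (Real.exp (l i + l j) - 1))) : ℝ) : ℂ)).connectedSeries =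
      volumeGeneratingSeries l := by
  classical
  ext m
  have hgp : PowerSeries.coeff m (volumeGeneratingSeries l) = ∑ p ∈ genusPairs m,
      (N : ℂ) ^ (2 - 2 * (p.1 : ℤ)) * (1 / (p.2.factorial : ℂ)) * ((1 / (N : ℂ) ^ p.2) *
          ∑ i : Fin p.2 → Fin N, laplaceVolume p.1 fun I => ((l (i I) : ℝ) : ℂ)) := by
    rw [volumeGeneratingSeries, PowerSeries.coeff_mk, genusPairs]
  rw [hgp, MulWeight.connectedSeries, PowerSeries.coeff_mk]
  rcases Nat.eq_zero_or_pos m with rfl | hm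
  · rw [Finset.sum_eq_zero (s := genusPairs 0)]
    · simp [MulWeight.connected]
    · intro p hp
      rw [mem_genusPairs] at hp
      omega
  let r' : Fin N → Fin N → ℂ := fun i j => ((Real.sqrt (1 / (Real.exp (l i + l j) - 1)) : ℝ) : ℂ)
  have hpos : ∀ i j, 0 < Real.exp (l i + l j) - 1 := fun i j => by
    have : 1 < Real.exp (l i + l j) := Real.one_lt_exp_iff.2 (add_pos (hl i) (hl j))
    linarith
  have hr : ∀ i j, ((Real.sqrt (1 / (N * (Real.exp (l i + l j) - 1))) : ℝ) : ℂ) =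
      r' i j * ((Real.sqrt (1 / N) : ℝ) : ℂ) := by
    intro i j
    rw [← Complex.ofReal_mul, ← Real.sqrt_mul (one_div_nonneg.2 (hpos i j).le)]
    congr 2
    rw [one_div_mul_one_div, mul_comm]
  have hq : ((Real.sqrt (1 / N) : ℝ) : ℂ) ^ 2 = 1 / N := by
    rw [← Complex.ofReal_pow, Real.sq_sqrt (by positivity)]
    push_cast; rfl
  have hvol : ∀ (g s : ℕ), ∑ j : Fin s → Fin N, laplaceVolume g (fun I => ((l (j I) : ℝ) : ℂ)) =
      ∑ n ∈ Finset.range (12 * g + 6 * s + 1), (∑ σ : Perm (Fin n), ∑ ι : Perm (Fin n),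
        ∑ face : Fin n → Fin s, if IsFatgraph σ ι face ∧ EulerEq σ g s then
          ∑ j : Fin s → Fin N, ∏ d, r' (j (face d)) (j (face (ι d))) else 0) /
            (n.factorial : ℂ) := by
    intro g s
    have h1 : ∀ j : Fin s → Fin N, laplaceVolume g (fun I => ((l (j I) : ℝ) : ℂ)) =
        ∑ G : FatgraphOfGenus g s, (∏ d, r' (j (G.1.face d)) (j (G.1.face (G.1.ι d)))) /
          (G.1.n.factorial : ℂ) := by
      intro j
      rw [(laplaceVolume_eq_shapeSum g fun I => by simpa using hl (j I)).2, shapeSum_eq_sum]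
      refine Finset.sum_congr rfl fun G _ => ?_
      congr 1
      refine prod_propagator_eq G.1 _ _ fun d => ?_
      rw [G.1.ι_ι]
      simp only [r']
      rw [add_comm (l (j (G.1.face (G.1.ι d)))), ← Complex.ofReal_mul,
        Real.mul_self_sqrt (one_div_nonneg.2 (hpos _ _).le)]
      push_cast; rfl
    simp_rw [h1]
    rw [Finset.sum_comm]
    simp_rw [← Finset.sum_div]
    rw [sum_fatgraphOfGenus g s fun n σ ι face =>
      (∑ j : Fin s → Fin N, ∏ d, r' (j (face d)) (j (face (ι d)))) / (n.factorial : ℂ)]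
    refine Finset.sum_congr rfl fun n _ => ?_
    rw [Fintype.sum_prod_type, Finset.sum_div]
    refine Finset.sum_congr rfl fun σ _ => ?_
    rw [Fintype.sum_prod_type, Finset.sum_div]
    refine Finset.sum_congr rfl fun ι _ => ?_
    rw [Finset.sum_div]
    refine Finset.sum_congr rfl fun face _ => ?_
    simp only
    split_ifs <;> simp
  have hext : ∑ n ∈ Finset.range (3 * m + 1), (ribbonWeight fun i j =>
      ((Real.sqrt (1 / (N * (Real.exp (l i + l j) - 1))) : ℝ) : ℂ)).connected n m /
        (n.factorial : ℂ) = ∑ n ∈ Finset.range (3 * m + 13), (ribbonWeight fun i j =>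
      ((Real.sqrt (1 / (N * (Real.exp (l i + l j) - 1))) : ℝ) : ℂ)).connected n m /
        (n.factorial : ℂ) := by
    refine Finset.sum_subset (Finset.range_subset_range.2 (by omega)) fun n _ hn => ?_
    rw [MulWeight.connected_eq_zero _ (by rw [Finset.mem_range] at hn; omega), zero_div]
  rw [hext]
  simp_rw [connected_ribbonWeight, ribbon_eq_sum_fatgraphs hN hm _ r' hq hr]
  have hR : ∀ p ∈ genusPairs m, (N : ℂ) ^ (2 - 2 * (p.1 : ℤ)) * (1 / (p.2.factorial : ℂ)) *
      ((1 / (N : ℂ) ^ p.2) *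
          ∑ i : Fin p.2 → Fin N, laplaceVolume p.1 fun I => ((l (i I) : ℝ) : ℂ)) =
      ∑ n ∈ Finset.range (3 * m + 13), (∑ σ : Perm (Fin n), ∑ ι : Perm (Fin n),
        (N : ℂ) ^ (2 - 2 * (p.1 : ℤ)) * (1 / (p.2.factorial : ℂ)) *
        ((1 / (N : ℂ) ^ p.2) * ∑ face : Fin n → Fin p.2,
          if IsFatgraph σ ι face ∧ EulerEq σ p.1 p.2 then
            ∑ j : Fin p.2 → Fin N, ∏ d, r' (j (face d)) (j (face (ι d))) else 0)) /
              (n.factorial : ℂ) := by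
    intro p hp
    rw [hvol, show 12 * p.1 + 6 * p.2 + 1 = 3 * m + 13 by rw [mem_genusPairs] at hp; omega]
    rw [Finset.mul_sum, Finset.mul_sum]
    refine Finset.sum_congr rfl fun n _ => ?_
    simp_rw [← Finset.mul_sum, mul_div_assoc]
  rw [Finset.sum_congr rfl hR, Finset.sum_comm]
  refine Finset.sum_congr rfl fun n _ => ?_
  rw [← Finset.sum_div]
  congr 1
  rw [Finset.sum_comm (s := genusPairs m)]
  refine Finset.sum_congr rfl fun σ _ => ?_
  rw [Finset.sum_comm (s := genusPairs m)]

theorem kpmmPartitionFunction_eq_exp {N : ℕ} (hN : 0 < N) {l : Fin N → ℝ} (hl : ∀ i, 0 < l i) :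
    kpmmPartitionFunction l = (PowerSeries.exp ℂ).subst (volumeGeneratingSeries l) := by
  rw [kpmmPartitionFunction_eq hN hl, connectedSeries_ribbonWeight hN hl]

/-! ### Möbius inversion on set partitions -/

theorem coeff_one_descPochhammer (m : ℕ) :
    (descPochhammer ℂ (m + 1)).coeff 1 = (-1) ^ m * (m.factorial : ℂ) := by
  induction m with
  | zero => simp
  | succ m ih =>
    have h0 : (descPochhammer ℂ (m + 1)).coeff 0 = 0 := by
      rw [Polynomial.coeff_zero_eq_eval_zero, descPochhammer_ne_zero_eval_zero _ m.succ_ne_zero]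
    have : descPochhammer ℂ (m + 1 + 1) = descPochhammer ℂ (m + 1) * Polynomial.X -
        descPochhammer ℂ (m + 1) * Polynomial.C ((m + 1 : ℕ) : ℂ) := by
      rw [descPochhammer_succ_right]
      simp [mul_sub]
    rw [this, Polynomial.coeff_sub, Polynomial.coeff_mul_X, Polynomial.coeff_mul_C, h0, ih,
      Nat.factorial_succ]
    push_cast; ring

/-- The partition into the fibres of `f` is `p` if and only if `f` is constant exactly on the parts
of `p`. -/
theorem ofSetoid_ker_eq_iff {α β : Type*} [Fintype α] [DecidableEq α] (f : α → β)
    [DecidableRel (Setoid.ker f).r] (p : Finpartition (Finset.univ : Finset α)) :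
    Finpartition.ofSetoid (Setoid.ker f) = p ↔ ∀ i j, f i = f j ↔ p.part i = p.part j := by
  constructor
  · rintro rfl i j
    rw [← Finpartition.mem_part_iff_part_eq_part _ (Finset.mem_univ _) (Finset.mem_univ _),
      Finpartition.mem_part_ofSetoid_iff_rel, Setoid.ker_def]
    exact eq_comm
  · intro h
    have hpart : ∀ i, (Finpartition.ofSetoid (Setoid.ker f)).part i = p.part i := by
      intro i
      ext j
      rw [Finpartition.mem_part_ofSetoid_iff_rel, Setoid.ker_def, h,
        Finpartition.mem_part_iff_part_eq_part _ (Finset.mem_univ _) (Finset.mem_univ _)]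
      exact eq_comm
    ext B
    constructor
    · intro hB
      obtain ⟨i, hi⟩ := Finpartition.nonempty_of_mem_parts _ hB
      rw [← Finpartition.part_eq_of_mem _ hB hi, hpart]
      exact (Finpartition.part_mem _).2 (Finset.mem_univ _)
    · intro hB
      obtain ⟨i, hi⟩ := Finpartition.nonempty_of_mem_parts _ hB
      rw [← Finpartition.part_eq_of_mem _ hB hi, ← hpart]
      exact (Finpartition.part_mem _).2 (Finset.mem_univ _)

/-- Colourings with the given partition into fibres are injective colourings of the parts. -/
theorem card_colourings_of_partition {α : Type*} [Fintype α] [DecidableEq α]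
    (p : Finpartition (Finset.univ : Finset α)) (M : ℕ) :
    Nat.card {f : α → Fin M // ∀ i j, f i = f j ↔ p.part i = p.part j} =
      M.descFactorial p.parts.card := by
  have hmem : ∀ i, p.part i ∈ p.parts := fun i => (Finpartition.part_mem _).2 (Finset.mem_univ _)
  have hne : ∀ B : p.parts, ∃ i, p.part i = B.1 := fun B => by
    obtain ⟨i, hi⟩ := Finpartition.nonempty_of_mem_parts _ B.2
    exact ⟨i, Finpartition.part_eq_of_mem _ B.2 hi⟩
  choose rep hrep using hne
  let E : {f : α → Fin M // ∀ i j, f i = f j ↔ p.part i = p.part j} ≃ (p.parts ↪ Fin M) :=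
    { toFun := fun f => ⟨fun B => f.1 (rep B), fun B B' h => Subtype.ext (by
        rw [← hrep B, ← hrep B']; exact (f.2 _ _).1 h)⟩
      invFun := fun e => ⟨fun i => e ⟨p.part i, hmem i⟩, fun i j => by
        rw [e.apply_eq_iff_eq, Subtype.mk.injEq]⟩
      left_inv := fun f => Subtype.ext (funext fun i => (f.2 _ _).2 (hrep _))
      right_inv := fun e => by
        ext B
        exact congrArg (fun B => (e B).1) (Subtype.ext (hrep B)) }
  rw [Nat.card_congr E, Nat.card_eq_fintype_card, Fintype.card_embedding_eq, Fintype.card_fin,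
    Fintype.card_coe]

open Classical in
/-- The colourings of the classes of `r`, sorted by their fibres. -/
theorem sum_descFactorial_partitions {α : Type*} [Fintype α] [DecidableEq α] (r : Setoid α)
    (M : ℕ) :
    ∑ p : Finpartition (Finset.univ : Finset α),
      (if ∀ i j, r i j → p.part i = p.part j then M.descFactorial p.parts.card else 0) =
      M ^ Nat.card (Quotient r) := by
  let E : {f : α → Fin M // ∀ i j, r i j → f i = f j} ≃ (Quotient r → Fin M) :=
    { toFun := fun f q => Quotient.lift f.1 f.2 q
      invFun := fun g => ⟨fun i => g (Quotient.mk _ i), fun i j h =>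
        congrArg g (Quotient.sound h)⟩
      left_inv := fun f => rfl
      right_inv := fun g => by
        ext q
        induction q using Quotient.inductionOn
        rfl }
  have h1 : Nat.card {f : α → Fin M // ∀ i j, r i j → f i = f j} = M ^ Nat.card (Quotient r) := by
    rw [Nat.card_congr E, Nat.card_fun, Nat.card_fin]
  rw [← h1, Nat.card_eq_fintype_card, Fintype.card_subtype,
    Finset.card_eq_sum_card_fiberwise (f := fun f : α → Fin M =>
      Finpartition.ofSetoid (Setoid.ker f)) (t := Finset.univ) (fun _ _ => Finset.mem_univ _)]
  refine Finset.sum_congr rfl fun p _ => ?_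
  split_ifs with h
  · rw [← card_colourings_of_partition, Nat.card_eq_fintype_card, Fintype.card_subtype,
      Finset.filter_filter]
    congr 1
    ext f
    simp only [Finset.mem_filter, Finset.mem_univ, true_and, ofSetoid_ker_eq_iff]
    exact ⟨fun hf => ⟨fun i j hij => (hf i j).2 (h i j hij), hf⟩, fun hf => hf.2⟩
  · symm
    rw [Finset.card_eq_zero, Finset.filter_filter, Finset.filter_eq_empty_iff]
    rintro f - ⟨h2, h3⟩
    rw [ofSetoid_ker_eq_iff] at h3
    exact h fun i j hij => (h3 i j).1 (h2 i j hij)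

open Classical in
/-- The weights of the cumulants, summed over the partitions coarser than `r`, vanish unless `r`
has only one class: they are the coefficients at the first power of `M` in the numbers
of injective colourings, whose sum is the number of all colourings of the classes of `r`. -/
theorem sum_cumulant_weights {α : Type*} [Fintype α] [DecidableEq α] [Nonempty α]
    (r : Setoid α) :
    ∑ p : Finpartition (Finset.univ : Finset α),
      (if ∀ i j, r i j → p.part i = p.part j then
        (-1 : ℂ) ^ (p.parts.card - 1) * ((p.parts.card - 1).factorial : ℂ) else 0) =
      if ∀ i j, r i j then 1 else 0 := by
  have hpoly : ∑ p : Finpartition (Finset.univ : Finset α),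
      (if ∀ i j, r i j → p.part i = p.part j then descPochhammer ℂ p.parts.card else 0) =
      Polynomial.X ^ Nat.card (Quotient r) := by
    refine Polynomial.eq_of_infinite_eval_eq _ _
      ((Set.infinite_range_of_injective (Nat.cast_injective (R := ℂ))).mono ?_)
    rintro _ ⟨M, rfl⟩
    simp only [Set.mem_ofPred_eq]
    rw [Polynomial.eval_finsetSum, Polynomial.eval_pow, Polynomial.eval_X, ← Nat.cast_pow,
      ← sum_descFactorial_partitions r M, Nat.cast_sum]
    refine Finset.sum_congr rfl fun p _ => ?_
    split_ifs
    · exact descPochhammer_eval_eq_descFactorial _ _ _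
    · simp
  have := congrArg (fun q : Polynomial ℂ => q.coeff 1) hpoly
  simp only [Polynomial.finsetSum_coeff, Polynomial.coeff_X_pow] at this
  refine Eq.trans (Finset.sum_congr rfl fun p _ => ?_) (this.trans ?_)
  · split_ifs
    · have hp : 0 < p.parts.card := by
        rw [Finset.card_pos]
        exact ⟨_, (Finpartition.part_mem p (a := Classical.arbitrary α)).2 (Finset.mem_univ _)⟩
      obtain ⟨m, hm⟩ : ∃ m, p.parts.card = m + 1 := ⟨p.parts.card - 1, by omega⟩
      rw [hm, coeff_one_descPochhammer, Nat.add_sub_cancel]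
    · simp
  · have : (1 = Nat.card (Quotient r)) ↔ ∀ i j, r i j := by
      rw [eq_comm, Nat.card_eq_one_iff_unique]
      constructor
      · rintro ⟨h, -⟩ i j
        exact Quotient.exact (h.elim (Quotient.mk r i) (Quotient.mk r j))
      · intro h
        refine ⟨⟨fun a b => ?_⟩, ⟨Quotient.mk r (Classical.arbitrary α)⟩⟩
        induction a using Quotient.inductionOn
        induction b using Quotient.inductionOn
        exact Quotient.sound (h _ _)
    simp only [this]

/-! ### Permutations of a disjoint union of a finite family -/

open Classical in
/-- Permutations that preserve the summands of a disjoint union. -/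
theorem sum_sigmaCongrRight {C R : Type*} {Y : C → Type*} [Fintype C] [DecidableEq C]
    [∀ c, Fintype (Y c)] [∀ c, DecidableEq (Y c)] [AddCommMonoid R] (F : Perm (Σ c, Y c) → R) :
    ∑ ι : Perm (Σ c, Y c), (if ∀ x, (ι x).1 = x.1 then F ι else 0) =
      ∑ τ : ∀ c, Perm (Y c), F (Perm.sigmaCongrRight τ) := by
  rw [← Finset.sum_filter]
  symm
  refine Finset.sum_nbij (fun τ => Perm.sigmaCongrRight τ) ?_ ?_ ?_ (fun _ _ => rfl)
  · intro τ _
    simp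
  · exact (Perm.sigmaCongrRightHom_injective (β := Y)).injOn
  · intro ι hι
    have hι' : ∀ x, (ι x).1 = x.1 := by simpa using hι
    have h : ∀ c (y : Y c), ∃ y' : Y c, ι ⟨c, y⟩ = ⟨c, y'⟩ := by
      intro c y
      have := hι' ⟨c, y⟩
      generalize ι ⟨c, y⟩ = z at this
      obtain ⟨c', y'⟩ := z
      simp only at this
      subst this
      exact ⟨y', rfl⟩
    choose τ hτ using h
    have hinj : ∀ c, Function.Injective (τ c) := by
      intro c y y' hy
      have : ι ⟨c, y⟩ = ι ⟨c, y'⟩ := by rw [hτ, hτ, hy]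
      simpa using ι.injective this
    refine ⟨fun c => Equiv.ofBijective (τ c) (Finite.injective_iff_bijective.1 (hinj c)),
      Finset.mem_coe.2 (Finset.mem_univ _), ?_⟩
    ext1 ⟨c, y⟩
    rw [hτ]
    rfl

theorem cyc_sigmaCongrRight {C : Type*} {Y : C → Type*} [Fintype C] [∀ c, Fintype (Y c)]
    (τ : ∀ c, Perm (Y c)) : cyc (Perm.sigmaCongrRight τ) = ∑ c, cyc (τ c) := by
  have : (cyc (Perm.sigmaCongrRight τ) : ℚ) = ∑ c, (cyc (τ c) : ℚ) := by
    rw [cyc_eq_sum, Fintype.sum_sigma]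
    refine Finset.sum_congr rfl fun c _ => ?_
    rw [cyc_eq_sum]
    refine Finset.sum_congr rfl fun y _ => ?_
    rw [minimalPeriod_semiconj (σ := τ c) (τ := Perm.sigmaCongrRight τ)
      (e := fun y => (⟨c, y⟩ : Σ c, Y c)) sigma_mk_injective (fun y => rfl) y]
  exact_mod_cast this

theorem isPairing_sigmaCongrRight {C : Type*} {Y : C → Type*} (τ : ∀ c, Perm (Y c)) :
    IsPairing (Perm.sigmaCongrRight τ) ↔ ∀ c, IsPairing (τ c) := by
  have h : ∀ c y, Perm.sigmaCongrRight τ ⟨c, y⟩ = ⟨c, τ c y⟩ := fun _ _ => rfl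
  simp only [IsPairing, Sigma.forall, h, ne_eq, Sigma.mk.injEq, heq_eq_eq, true_and, ← forall_and]

/-! ### Connected means as sums over connected pairings -/

/-- The half-edges of stars with `k i` legs, `i ∈ B`. -/
abbrev Legs {s : ℕ} (k : Fin s → ℕ) (B : Finset (Fin s)) : Type :=
  Σ i : {i // i ∈ B}, Fin (k i.1)

/-- The cyclic orders of the stars. -/
def legsRotation {s : ℕ} (k : Fin s → ℕ) (B : Finset (Fin s)) : Perm (Legs k B) :=
  Perm.sigmaCongrRight fun i => finRotate (k i.1)

open Classical in
/-- The Gaussian weight of a pairing. -/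
def pairingWeight (N : ℕ) {X : Type*} (φ ι : Perm X) : ℂ :=
  if IsPairing ι then (N : ℂ) ^ cyc (φ * ι) * ((Real.sqrt (1 / N) : ℝ) : ℂ) ^ Nat.card X else 0

open Classical in
/-- The moments as sums over all pairings of the legs; a pairing of `E` pairs has the weight
`N ^ (F - E)` where `F` is its number of colour loops, the cycles of `φ * ι`. -/
theorem gaussianMean_eq {N : ℕ} (hN : 0 < N) {s : ℕ} {k : Fin s → ℕ} (hk : ∀ i, 0 < k i)
    (B : Finset (Fin s)) :
    gaussianMean N k B = ∑ ι : Perm (Legs k B), pairingWeight N (legsRotation k B) ι := by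
  have h1 : ∀ H : Matrix (Fin N) (Fin N) ℂ, ∏ i ∈ B, (H ^ k i).trace =
      ∑ u : Legs k B → Fin N, ∏ d, H (u d) (u (legsRotation k B d)) := by
    intro H
    rw [← Finset.prod_coe_sort]
    simp_rw [trace_pow_eq_sum H (hk _)]
    rw [Finset.prod_univ_sum, Fintype.piFinset_univ]
    refine Fintype.sum_equiv (Equiv.piCurry fun _ _ => Fin N).symm _ _ fun u => ?_
    rw [Fintype.prod_sigma]
    rfl
  rw [gaussianMean]
  simp_rw [h1]
  refine Eq.trans (by congr!) (((isGaussianWeight_gue hN).mean_traces (legsRotation k B)).trans ?_)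
  have h2 : pairingsOn (Finset.univ : Finset (Legs k B)) = Finset.univ.filter IsPairing := by
    ext ι; rw [mem_pairingsOn_univ]; simp
  rw [h2, Finset.sum_filter]
  refine Finset.sum_congr rfl fun ι _ => ?_
  rw [pairingWeight]
  split_ifs
  · rw [Finset.sum_congr rfl fun i _ => by rw [Finset.prod_const], Finset.sum_const, nsmul_eq_mul,
      Finset.card_univ, Nat.card_eq_fintype_card, ← Nat.cast_pow,
      ← card_invariant_functions (legsRotation k B * ι) N, Nat.card_eq_fintype_card,
      Fintype.card_subtype]
    congr!
  · rfl

theorem pairingWeight_congr (N : ℕ) {X Y : Type*} {φ ι : Perm X} {φ' ι' : Perm Y} (e : X ≃ Y)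
    (h1 : ∀ x, e (φ x) = φ' (e x)) (h2 : ∀ x, e (ι x) = ι' (e x)) :
    pairingWeight N φ ι = pairingWeight N φ' ι' := by
  have hp : IsPairing ι ↔ IsPairing ι' := by
    refine ⟨fun h => h.congr e h2, fun h => h.congr e.symm fun y => ?_⟩
    rw [symm_apply_eq, h2, apply_symm_apply]
  have hc : cyc (φ * ι) = cyc (φ' * ι') := cyc_congr e fun x => by simp [h1, h2]
  rw [pairingWeight, pairingWeight, hc, Nat.card_congr e]
  by_cases h : IsPairing ι
  · rw [if_pos h, if_pos (hp.1 h)]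
  · rw [if_neg h, if_neg (fun h' => h (hp.2 h'))]

theorem pairingWeight_sigmaCongrRight (N : ℕ) {C : Type*} {Y : C → Type*} [Fintype C]
    [∀ c, Fintype (Y c)] (φ τ : ∀ c, Perm (Y c)) :
    pairingWeight N (Perm.sigmaCongrRight φ) (Perm.sigmaCongrRight τ) =
      ∏ c, pairingWeight N (φ c) (τ c) := by
  have hmul : Perm.sigmaCongrRight φ * Perm.sigmaCongrRight τ =
      Perm.sigmaCongrRight (fun c => φ c * τ c) := Equiv.ext fun _ => rfl
  rw [pairingWeight, isPairing_sigmaCongrRight, hmul, cyc_sigmaCongrRight, Nat.card_sigma]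
  split_ifs with h
  · simp only [pairingWeight, h, if_true]
    rw [Finset.prod_mul_distrib, Finset.prod_pow_eq_pow_sum, Finset.prod_pow_eq_pow_sum]
  · push Not at h
    obtain ⟨c, hc⟩ := h
    refine (Finset.prod_eq_zero (Finset.mem_univ c) ?_).symm
    rw [pairingWeight, if_neg hc]

/-- The half-edges of stars with `k i` legs. -/
abbrev Stars {s : ℕ} (k : Fin s → ℕ) : Type := Σ i : Fin s, Fin (k i)

/-- The cyclic orders of the stars. -/
def starsRotation {s : ℕ} (k : Fin s → ℕ) : Perm (Stars k) :=
  Perm.sigmaCongrRight fun i => finRotate (k i)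

/-- The legs of all stars, grouped by the blocks of a partition of the stars. -/
def groupLegs {s : ℕ} (k : Fin s → ℕ) (p : Finpartition (Finset.univ : Finset (Fin s))) :
    (Σ B : {B // B ∈ p.parts}, Legs k B.1) ≃ Stars k where
  toFun x := ⟨x.2.1.1, x.2.2⟩
  invFun x := ⟨⟨p.part x.1, (Finpartition.part_mem _).2 (Finset.mem_univ _)⟩,
    ⟨x.1, (Finpartition.mem_part_self p).2 (Finset.mem_univ _)⟩, x.2⟩
  left_inv := by
    rintro ⟨⟨B, hB⟩, ⟨i, hi⟩, j⟩
    obtain rfl := p.part_eq_of_mem hB hi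
    rfl
  right_inv x := rfl

open Classical in
/-- A product of moments, one for each block of a partition, is the sum over the pairings that do
not link different blocks. -/
theorem prod_gaussianMean_eq {N : ℕ} (hN : 0 < N) {s : ℕ} {k : Fin s → ℕ} (hk : ∀ i, 0 < k i)
    (p : Finpartition (Finset.univ : Finset (Fin s))) :
    ∏ B ∈ p.parts, gaussianMean N k B = ∑ ι : Perm (Stars k),
      if ∀ x, p.part (ι x).1 = p.part x.1 then pairingWeight N (starsRotation k) ι else 0 := by
  rw [← Finset.prod_coe_sort]
  simp_rw [gaussianMean_eq hN hk]
  rw [Finset.prod_univ_sum, Fintype.piFinset_univ]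
  simp_rw [← pairingWeight_sigmaCongrRight]
  rw [← sum_sigmaCongrRight fun ι => pairingWeight N
    (Perm.sigmaCongrRight fun B : {B // B ∈ p.parts} => legsRotation k B.1) ι]
  refine Fintype.sum_equiv (groupLegs k p).permCongr _ _ fun ι => ?_
  have h1 : pairingWeight N
      (Perm.sigmaCongrRight fun B : {B // B ∈ p.parts} => legsRotation k B.1) ι =
      pairingWeight N (starsRotation k) ((groupLegs k p).permCongr ι) :=
    pairingWeight_congr N (groupLegs k p) (fun x => rfl) fun x => by
      simp [Equiv.permCongr_apply]
  have h2 : (∀ x, (ι x).1 = x.1) ↔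
      ∀ x, p.part ((groupLegs k p).permCongr ι x).1 = p.part x.1 := by
    have hpart : ∀ x : (Σ B : {B // B ∈ p.parts}, Legs k B.1),
        p.part (groupLegs k p x).1 = x.1.1 := fun x => p.part_eq_of_mem x.1.2 x.2.1.2
    constructor
    · intro h x
      obtain ⟨y, rfl⟩ := (groupLegs k p).surjective x
      rw [Equiv.permCongr_apply, symm_apply_apply, hpart, hpart, h]
    · intro h x
      have := h (groupLegs k p x)
      rw [Equiv.permCongr_apply, symm_apply_apply, hpart, hpart] at this
      exact Subtype.ext this
  simp only [h1, h2]

theorem sameCycle_finRotate {n : ℕ} (i j : Fin n) : SameCycle (finRotate n) i j := by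
  match n, i, j with
  | 1, i, j => rw [Subsingleton.elim i j]
  | n + 2, i, j =>
    exact (transitive_iff_cycleType (by omega)).2 (cycleType_finRotate) i j

/-- The stars that are linked by the pairing `ι`. -/
def linkSetoid {s : ℕ} {k : Fin s → ℕ} (ι : Perm (Stars k)) : Setoid (Fin s) where
  r i j := ∀ f : Fin s → Prop, (∀ x, f (ι x).1 ↔ f x.1) → (f i ↔ f j)
  iseqv := ⟨fun _ _ _ => Iff.rfl, fun h f hf => (h f hf).symm,
    fun h h' f hf => (h f hf).trans (h' f hf)⟩

theorem linkSetoid_iff {s : ℕ} {k : Fin s → ℕ} (ι : Perm (Stars k)) {α : Type*} (g : Fin s → α) :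
    (∀ i j, linkSetoid ι i j → g i = g j) ↔ ∀ x, g (ι x).1 = g x.1 := by
  constructor
  · intro h x
    exact h _ _ fun f hf => hf x
  · intro h i j hij
    exact (hij (fun i' => g i' = g j) fun x => by rw [h]).2 rfl

theorem linkSetoid_eq_top_iff {s : ℕ} {k : Fin s → ℕ} (hk : ∀ i, 0 < k i) (ι : Perm (Stars k)) :
    (∀ i j, linkSetoid ι i j) ↔ Conn (starsRotation k) ι := by
  constructor
  · intro h f h1 h2 x y
    have hf : ∀ (i : Fin s) (j j' : Fin (k i)), f ⟨i, j⟩ ↔ f ⟨i, j'⟩ := by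
      intro i j j'
      exact (sameCycle_iff_forall_invariant _ _ _).1 (sameCycle_finRotate j j')
        (fun j => f ⟨i, j⟩) fun j => h1 ⟨i, j⟩
    have := h x.1 y.1 (fun i => f ⟨i, ⟨0, hk i⟩⟩) fun z => by
      rw [hf _ _ (ι z).2, hf _ _ z.2]
      exact h2 z
    rw [hf _ _ x.2, hf _ _ y.2] at this
    exact this
  · intro h i j f hf
    exact h (fun x => f x.1) (fun x => Iff.rfl) hf ⟨i, ⟨0, hk i⟩⟩ ⟨j, ⟨0, hk j⟩⟩

open Classical in
/-- A joint cumulant of traces is the sum over the pairings that connect all of them. -/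
theorem gaussianConnectedMean_eq {N : ℕ} (hN : 0 < N) {s : ℕ} (hs : 0 < s) {k : Fin s → ℕ}
    (hk : ∀ i, 0 < k i) :
    gaussianConnectedMean N k = ∑ ι : Perm (Stars k),
      if Conn (starsRotation k) ι then pairingWeight N (starsRotation k) ι else 0 := by
  have : Nonempty (Fin s) := ⟨⟨0, hs⟩⟩
  rw [gaussianConnectedMean]
  simp_rw [prod_gaussianMean_eq hN hk, Finset.mul_sum]
  rw [Finset.sum_comm]
  refine Finset.sum_congr rfl fun ι _ => ?_
  have h := sum_cumulant_weights (linkSetoid ι)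
  simp only [linkSetoid_iff, linkSetoid_eq_top_iff hk] at h
  have h' := congrArg (· * pairingWeight N (starsRotation k) ι) h
  simp only [Finset.sum_mul, ite_mul, one_mul, zero_mul] at h'
  rw [← h']
  refine Finset.sum_congr rfl fun p _ => ?_
  split_ifs <;> ring

/-! ### The genus expansion -/

/-- The pairing `ι` glues the cycles of `φ` to a connected surface; for `s` cycles the genus
is `g`. -/
def GluesTo {X : Type*} (φ : Perm X) (g s : ℕ) (ι : Perm X) : Prop :=
  IsPairing ι ∧ Conn φ ι ∧ EulerEq (φ * ι) g s

/-- The number of pairings of the legs of `s` stars that give a connected surface of genus `g`. -/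
def gluingCount (g : ℕ) {s : ℕ} (k : Fin s → ℕ) : ℕ :=
  Nat.card {ι : Perm (Stars k) // GluesTo (starsRotation k) g s ι}

theorem cyc_starsRotation {s : ℕ} {k : Fin s → ℕ} (hk : ∀ i, 0 < k i) :
    cyc (starsRotation k) = s := by
  rw [starsRotation, cyc_sigmaCongrRight, Finset.sum_congr rfl fun i _ => ?_]
  · exact (Finset.card_eq_sum_ones _).symm.trans (Finset.card_fin s)
  · have : Nonempty (Fin (k i)) := ⟨⟨0, hk i⟩⟩
    exact cyc_eq_one sameCycle_finRotate

theorem exists_eulerEq {s : ℕ} (hs : 0 < s) {k : Fin s → ℕ} (hk : ∀ i, 0 < k i)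
    {ι : Perm (Stars k)} (h1 : IsPairing ι) (h2 : Conn (starsRotation k) ι) :
    ∃ g : ℕ, EulerEq (starsRotation k * ι) g s := by
  have : Nonempty (Stars k) := ⟨⟨⟨0, hs⟩, ⟨0, hk _⟩⟩⟩
  obtain ⟨g, hg⟩ := exists_genus h1 h2
  refine ⟨g, ?_⟩
  rw [cyc_starsRotation hk] at hg
  rw [EulerEq, Nat.card_eq_fintype_card]
  linarith

theorem eulerEq_unique {X : Type*} {σ : Perm X} {g g' s : ℕ} (h : EulerEq σ g s)
    (h' : EulerEq σ g' s) : g = g' := by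
  rw [EulerEq] at h h'
  omega

/-- Euler's formula in the exponent of `N`. -/
theorem zpow_mul_pairingWeight {N : ℕ} (hN : 0 < N) {s g : ℕ} {k : Fin s → ℕ}
    {ι : Perm (Stars k)} (h1 : IsPairing ι) (hg : EulerEq (starsRotation k * ι) g s) :
    (N : ℂ) ^ ((s : ℤ) - 2) * pairingWeight N (starsRotation k) ι = (N : ℂ) ^ (-2 * (g : ℤ)) := by
  have hN0 : (N : ℂ) ≠ 0 := by exact_mod_cast hN.ne'
  obtain ⟨E, hE⟩ := h1.even_card
  have hq : ((Real.sqrt (1 / N) : ℝ) : ℂ) ^ 2 = (N : ℂ)⁻¹ := by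
    rw [← Complex.ofReal_pow, Real.sq_sqrt (by positivity)]
    push_cast; rw [one_div]
  rw [EulerEq] at hg
  rw [Nat.card_eq_fintype_card, hE] at hg
  rw [pairingWeight, if_pos h1, Nat.card_eq_fintype_card, hE, ← two_mul, pow_mul, hq, inv_pow,
    ← zpow_natCast, ← zpow_natCast, ← zpow_neg, ← zpow_add₀ hN0, ← zpow_add₀ hN0]
  congr 1
  push_cast at hg
  omega

/-- The coefficients of the genus expansion count the connected pairings by their genus. -/
theorem exists_genusExpansion {s : ℕ} (hs : 0 < s) {k : Fin s → ℕ} (hk : ∀ i, 0 < k i) :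
    ∃ c : ℕ →₀ ℂ, IsGenusExpansion k c ∧ ∀ g, c g = gluingCount g k := by
  classical
  let T : Finset (Perm (Stars k)) :=
    Finset.univ.filter fun ι => IsPairing ι ∧ Conn (starsRotation k) ι
  have hT : ∀ ι, ι ∈ T ↔ IsPairing ι ∧ Conn (starsRotation k) ι := by simp [T]
  have hex : ∀ ι : Perm (Stars k), ∃ g : ℕ, ι ∈ T → EulerEq (starsRotation k * ι) g s := by
    intro ι
    by_cases h : ι ∈ T
    · obtain ⟨g, hg⟩ := exists_eulerEq hs hk ((hT ι).1 h).1 ((hT ι).1 h).2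
      exact ⟨g, fun _ => hg⟩
    · exact ⟨0, fun h' => absurd h' h⟩
  choose γ hγ using hex
  refine ⟨∑ ι ∈ T, Finsupp.single (γ ι) 1, fun N hN => ?_, fun g => ?_⟩
  · rw [gaussianConnectedMean_eq hN hs hk, Finset.mul_sum, ← Finsupp.sum_finsetSum_index]
    · simp only [Finsupp.sum_single_index, zero_mul, one_mul]
      rw [← Finset.sum_filter_add_sum_filter_not Finset.univ
        (fun ι => IsPairing ι ∧ Conn (starsRotation k) ι)]
      rw [Finset.sum_eq_zero (s := Finset.univ.filter
        (fun ι => ¬ (IsPairing ι ∧ Conn (starsRotation k) ι))), add_zero]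
      · refine Finset.sum_congr rfl fun ι hι => ?_
        have h := (hT ι).1 hι
        rw [if_pos h.2, zpow_mul_pairingWeight hN h.1 (hγ ι hι)]
      · intro ι hι
        have h : ¬ (IsPairing ι ∧ Conn (starsRotation k) ι) := by simpa using hι
        by_cases hc : Conn (starsRotation k) ι
        · rw [if_pos hc, pairingWeight, if_neg (fun hp => h ⟨hp, hc⟩), mul_zero]
        · rw [if_neg hc, mul_zero]
    · simp
    · intro g a b; ring
  · rw [Finsupp.finsetSum_apply]
    simp only [Finsupp.single_apply]
    rw [← Finset.sum_filter, Finset.sum_const, nsmul_eq_mul, mul_one, gluingCount,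
      Nat.card_eq_fintype_card, Fintype.card_subtype]
    congr 2
    ext ι
    rw [Finset.mem_filter, hT, Finset.mem_filter]
    simp only [Finset.mem_univ, true_and]
    constructor
    · rintro ⟨h, rfl⟩
      exact ⟨h.1, h.2, hγ ι ((hT ι).2 h)⟩
    · rintro ⟨h1, h2, h3⟩
      exact ⟨⟨h1, h2⟩, eulerEq_unique (hγ ι ((hT ι).2 ⟨h1, h2⟩)) h3⟩

/-- Expansions in powers of `N⁻²` are unique, as polynomials with infinitely many zeros vanish. -/
theorem genusExpansion_unique {s : ℕ} {k : Fin s → ℕ} {c c' : ℕ →₀ ℂ}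
    (h : IsGenusExpansion k c) (h' : IsGenusExpansion k c') : c = c' := by
  let P : (ℕ →₀ ℂ) → Polynomial ℂ := fun c => ∑ g ∈ c.support, Polynomial.monomial g (c g)
  have hev : ∀ c : ℕ →₀ ℂ, ∀ N : ℕ, (P c).eval (((N : ℂ) ^ 2)⁻¹) =
      c.sum fun g a => a * (N : ℂ) ^ (-2 * (g : ℤ)) := by
    intro c N
    simp only [P, Polynomial.eval_finsetSum, Polynomial.eval_monomial, Finsupp.sum]
    refine Finset.sum_congr rfl fun g _ => ?_
    rw [inv_pow, ← pow_mul, neg_mul, zpow_neg]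
    norm_cast
  have hcoeff : ∀ (c : ℕ →₀ ℂ) g, (P c).coeff g = c g := by
    intro c g
    simp only [P, Polynomial.finsetSum_coeff, Polynomial.coeff_monomial, Finset.sum_ite_eq']
    split_ifs with hg
    · rfl
    · exact (Finsupp.notMem_support_iff.1 hg).symm
  have hinj : Function.Injective fun N : ℕ => (((N + 1 : ℕ) : ℂ) ^ 2)⁻¹ := by
    intro N N' hNN
    simp only [inv_inj] at hNN
    norm_cast at hNN
    have := Nat.pow_left_injective two_ne_zero hNN
    omega
  have hP : P c = P c' := by
    refine Polynomial.eq_of_infinite_eval_eq _ _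
      ((Set.infinite_range_of_injective hinj).mono ?_)
    rintro _ ⟨N, rfl⟩
    simp only [Set.mem_ofPred_eq]
    rw [hev, hev, ← h (N + 1) (by omega), ← h' (N + 1) (by omega)]
  ext g
  rw [← hcoeff, ← hcoeff, hP]

theorem existsUnique_genusExpansion {s : ℕ} (hs : 0 < s) {k : Fin s → ℕ} (hk : ∀ i, 0 < k i) :
    ∃! c : ℕ →₀ ℂ, IsGenusExpansion k c := by
  obtain ⟨c, hc, -⟩ := exists_genusExpansion hs hk
  exact ⟨c, hc, fun c' h' => genusExpansion_unique h' hc⟩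

theorem genusMean_eq_gluingCount {s : ℕ} (hs : 0 < s) {k : Fin s → ℕ} (hk : ∀ i, 0 < k i)
    (g : ℕ) : genusMean g k = gluingCount g k := by
  obtain ⟨c, hc, hcg⟩ := exists_genusExpansion hs hk
  have hex : ∃ c : ℕ →₀ ℂ, IsGenusExpansion k c := ⟨c, hc⟩
  rw [genusMean, dif_pos hex, genusExpansion_unique hex.choose_spec hc, hcg]

/-! ### Removal of backtracking edges -/

/-- The number of pairings that glue the cycles of `φ` to a connected surface of genus `g` and do
not pair `x` with `φ x` for `x` in `D`. -/
def reducedCount {X : Type*} (φ : Perm X) (D : X → Prop) (g s : ℕ) : ℕ :=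
  Nat.card {ι : Perm X // GluesTo φ g s ι ∧ ∀ x, D x → ι x ≠ φ x}

theorem GluesTo.congr {X Y : Type*} {φ ι : Perm X} {φ' ι' : Perm Y} {g s : ℕ} (e : X ≃ Y)
    (h1 : ∀ x, e (φ x) = φ' (e x)) (h2 : ∀ x, e (ι x) = ι' (e x)) (h : GluesTo φ g s ι) :
    GluesTo φ' g s ι' := by
  refine ⟨h.1.congr e h2, h.2.1.congr e h1 h2, ?_⟩
  have h3 := h.2.2
  rw [EulerEq] at h3 ⊢
  rw [← Nat.card_congr e, ← cyc_congr (σ := φ * ι) e fun x => by simp [h1, h2]]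
  exact h3

theorem reducedCount_congr {X Y : Type*} {φ : Perm X} {φ' : Perm Y} {D : X → Prop} {D' : Y → Prop}
    (e : X ≃ Y) (h1 : ∀ x, e (φ x) = φ' (e x)) (hD : ∀ x, D x ↔ D' (e x)) (g s : ℕ) :
    reducedCount φ D g s = reducedCount φ' D' g s := by
  refine Nat.card_congr (Equiv.subtypeEquiv e.permCongr fun ι => ?_)
  have h2 : ∀ x, e (ι x) = e.permCongr ι (e x) := fun x => by simp [Equiv.permCongr_apply]
  refine and_congr ⟨fun h => h.congr e h1 h2, fun h => h.congr e.symm ?_ ?_⟩ ?_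
  · intro y; rw [symm_apply_eq, h1, apply_symm_apply]
  · intro y; rw [symm_apply_eq, h2, apply_symm_apply]
  · rw [← e.forall_congr_right]
    refine forall_congr' fun x => ?_
    rw [← hD, ← h2, ← h1, ne_eq, ne_eq, e.apply_eq_iff_eq]

/-- The data for the removal of two consecutive elements `a = E (inr false)` and
`b = E (inr true)` from a cycle of `φ` of length at least three; `φ'` is the cyclic order of the
remaining elements, and `c` is the successor of `b`. -/
structure Removal {X Y : Type*} (E : Y ⊕ Bool ≃ X) (φ : Perm X) (φ' : Perm Y) (c : Y) : Prop where
  map_a : φ (E (Sum.inr false)) = E (Sum.inr true)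
  map_b : φ (E (Sum.inr true)) = E (Sum.inl c)
  map_other : ∀ y, φ (E (Sum.inl y)) = E (Sum.inl (φ' y)) ∨
    (φ (E (Sum.inl y)) = E (Sum.inr false) ∧ φ' y = c)

namespace Removal

variable {X Y : Type*} {E : Y ⊕ Bool ≃ X} {φ : Perm X} {φ' : Perm Y} {c : Y}

/-- The pairing of all elements in which `a` is paired with `b`. -/
def extend (E : Y ⊕ Bool ≃ X) (ι : Perm Y) : Perm X :=
  E.permCongr (Perm.sumCongr ι (swap false true))

theorem extend_inl (ι : Perm Y) (y : Y) : extend E ι (E (Sum.inl y)) = E (Sum.inl (ι y)) :=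
  permCongr_sumCongr_inl _ _ _ _

theorem extend_a (ι : Perm Y) : extend E ι (E (Sum.inr false)) = E (Sum.inr true) :=
  permCongr_sumCongr_inr _ _ _ _

theorem extend_b (ι : Perm Y) : extend E ι (E (Sum.inr true)) = E (Sum.inr false) :=
  permCongr_sumCongr_inr _ _ _ _

/-- The removed pair is linked to the other elements through the cycle of `φ` only. -/
theorem conn_iff (h : Removal E φ φ' c) (ι : Perm Y) : Conn φ (extend E ι) ↔ Conn φ' ι := by
  constructor
  · intro hc f h1 h2 y z
    have hsplit := hc (fun x => Sum.elim f (fun _ => f c) (E.symm x)) (fun x => ?_) (fun x => ?_)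
      (E (Sum.inl y)) (E (Sum.inl z))
    · simpa using hsplit
    · obtain ⟨t, rfl⟩ := E.surjective x
      rcases t with y | _ | _
      · rcases h.map_other y with h3 | ⟨h3, h4⟩
        · rw [h3]; simpa using h1 y
        · rw [h3]; simpa [← h4] using h1 y
      · rw [h.map_a]; simp
      · rw [h.map_b]; simp
    · obtain ⟨t, rfl⟩ := E.surjective x
      rcases t with y | _ | _
      · rw [extend_inl]; simpa using h2 y
      · rw [extend_a]; simp
      · rw [extend_b]; simp
  · intro hc f h1 h2
    have hab : f (E (Sum.inr false)) ↔ f (E (Sum.inr true)) := by rw [← h.map_a, h1]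
    have hbc : f (E (Sum.inr true)) ↔ f (E (Sum.inl c)) := by rw [← h.map_b, h1]
    have hY := hc (fun y => f (E (Sum.inl y))) (fun y => ?_) (fun y => ?_)
    · have key : ∀ x, f x ↔ f (E (Sum.inl c)) := by
        intro x
        obtain ⟨t, rfl⟩ := E.surjective x
        rcases t with y | _ | _
        · exact hY y c
        · exact hab.trans hbc
        · exact hbc
      intro x y
      rw [key x, key y]
    · rcases h.map_other y with h3 | ⟨h3, h4⟩
      · rw [← h3, h1]
      · rw [h4, ← hbc, ← hab, ← h3, h1]
    · rw [← extend_inl, h2]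

/-- The backtracking edge has a free end, a univalent vertex, which is lost when it is removed. -/
theorem cyc_eq [Finite Y] (h : Removal E φ φ' c) (ι : Perm Y) :
    cyc (φ * extend E ι) = cyc (φ' * ι) + 1 := by
  classical
  have : Finite X := Finite.of_equiv _ E
  have hne : E (Sum.inr false) ≠ E (Sum.inl c) := fun hh => by simpa using E.injective hh
  have hσa : (φ * extend E ι) (E (Sum.inr false)) = E (Sum.inl c) := by
    rw [mul_apply, extend_a, h.map_b]
  have hσb : (φ * extend E ι) (E (Sum.inr true)) = E (Sum.inr true) := by
    rw [mul_apply, extend_b, h.map_a]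
  have hsame : SameCycle (φ * extend E ι) (E (Sum.inr false)) (E (Sum.inl c)) := by
    rw [← hσa, sameCycle_apply_right]
  have h1 := cyc_swap_mul_of_sameCycle hne hsame
  have h2 : swap (E (Sum.inr false)) (E (Sum.inl c)) * (φ * extend E ι) =
      E.permCongr (Perm.sumCongr (φ' * ι) 1) := by
    ext x
    obtain ⟨t, rfl⟩ := E.surjective x
    rcases t with y | _ | _
    · rw [permCongr_sumCongr_inl, mul_apply, mul_apply, extend_inl, mul_apply]
      rcases h.map_other (ι y) with h3 | ⟨h3, h4⟩
      · rw [h3, swap_apply_of_ne_of_ne]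
        · simp
        · intro h5
          rw [h5, ← h.map_b, φ.apply_eq_iff_eq] at h3
          simp at h3
      · rw [h3, h4, swap_apply_left]
    · rw [permCongr_sumCongr_inr, mul_apply, hσa, swap_apply_right]; rfl
    · rw [permCongr_sumCongr_inr, mul_apply, hσb, swap_apply_of_ne_of_ne] <;> simp
  rw [h2, cyc_sumCongr] at h1
  have h3 : cyc (1 : Perm Bool) = 2 := by
    have := cyc_eq_sum (1 : Perm Bool)
    have hm : ∀ x, Function.minimalPeriod (1 : Perm Bool) x = 1 := fun x =>
      Function.minimalPeriod_eq_one_iff_isFixedPt.2 rfl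
    simp only [hm] at this
    norm_num at this
    exact_mod_cast this
  omega

/-- The removal of a backtracking edge loses two half-edges and one vertex, and keeps the genus. -/
theorem gluesTo_iff [Finite Y] (h : Removal E φ φ' c) (ι : Perm Y) (g s : ℕ) :
    GluesTo φ g s (extend E ι) ↔ GluesTo φ' g s ι := by
  have hp : IsPairing (swap false true) := by
    constructor <;> decide
  have hcard : Nat.card X = Nat.card Y + 2 := by
    rw [← Nat.card_congr E, Nat.card_sum, Nat.card_eq_fintype_card (α := Bool), Fintype.card_bool]
  rw [GluesTo, GluesTo, h.conn_iff, EulerEq, EulerEq, h.cyc_eq, hcard, extend, isPairing_sumCongr]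
  refine and_congr (and_iff_left hp) (and_congr_right fun _ => ?_)
  push_cast
  constructor <;> intro h <;> linarith

theorem exists_extend [Finite Y] {ι : Perm X} (hι : IsPairing ι)
    (hab : ι (E (Sum.inr false)) = E (Sum.inr true)) : ∃ ι', extend E ι' = ι := by
  classical
  have hba : ι (E (Sum.inr true)) = E (Sum.inr false) := by rw [← hab, hι.1]
  obtain ⟨ρ₁, ρ₂, h⟩ := exists_disjUnion E (fun _ : Unit => ι) (fun _ y => by
    obtain ⟨t, ht⟩ := E.surjective (ι (E (Sum.inl y)))
    rcases t with z | _ | _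
    · exact ⟨z, ht.symm⟩
    · rw [← hba, ι.apply_eq_iff_eq] at ht; simp at ht
    · rw [← hab, ι.apply_eq_iff_eq] at ht; simp at ht)
  have h' := congrFun h ()
  refine ⟨ρ₁ (), ?_⟩
  ext x
  obtain ⟨t, rfl⟩ := E.surjective x
  rcases t with y | _ | _
  · rw [extend_inl, ← h', disjUnion_inl]
  · rw [extend_a, hab]
  · rw [extend_b, hba]

/-- Either `a` is not paired with `b`, or the pair can be removed. -/
theorem reducedCount_eq [Finite Y] (h : Removal E φ φ' c) {D : X → Prop}
    (hD : ¬ D (E (Sum.inr false))) (g s : ℕ) :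
    reducedCount φ D g s = reducedCount φ (fun x => D x ∨ x = E (Sum.inr false)) g s +
      reducedCount φ' (fun y => D (E (Sum.inl y)) ∧ φ (E (Sum.inl y)) ≠ E (Sum.inr false)) g s := by
  classical
  have : Finite X := Finite.of_equiv _ E
  have := Fintype.ofFinite X
  have h1 : ∀ p q : Perm X → Prop, Nat.card {ι // p ι} =
      Nat.card {ι // p ι ∧ ¬ q ι} + Nat.card {ι // p ι ∧ q ι} := by
    intro p q
    simp only [Nat.card_eq_fintype_card, Fintype.card_subtype]
    rw [← Finset.filter_filter, ← Finset.filter_filter, add_comm]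
    exact (Finset.card_filter_add_card_filter_not _).symm
  rw [reducedCount, h1 _ fun ι => ι (E (Sum.inr false)) = E (Sum.inr true)]
  congr 1
  · refine Nat.card_congr (Equiv.subtypeEquivRight fun ι => ?_)
    rw [and_assoc]
    refine and_congr_right fun _ => ?_
    constructor
    · rintro ⟨h2, h3⟩ x (hx | rfl)
      · exact h2 x hx
      · rwa [h.map_a]
    · intro h2
      exact ⟨fun x hx => h2 x (Or.inl hx), by rw [← h.map_a]; exact h2 _ (Or.inr rfl)⟩
  · symm
    have hQ : ∀ ι : Perm Y, (∀ x, D x → extend E ι x ≠ φ x) ↔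
        ∀ y, D (E (Sum.inl y)) ∧ φ (E (Sum.inl y)) ≠ E (Sum.inr false) → ι y ≠ φ' y := by
      intro ι
      constructor
      · rintro h2 y ⟨h3, h4⟩ h5
        rcases h.map_other y with h6 | ⟨h6, -⟩
        · exact h2 _ h3 (by rw [extend_inl, h6, h5])
        · exact h4 h6
      · intro h2 x hx
        obtain ⟨t, rfl⟩ := E.surjective x
        rcases t with y | _ | _
        · rw [extend_inl]
          rcases h.map_other y with h6 | ⟨h6, -⟩
          · rw [h6]
            intro h7
            refine h2 y ⟨hx, ?_⟩ (by simpa using h7)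
            rw [h6]; simp
          · rw [h6]; simp
        · exact absurd hx hD
        · rw [extend_b, h.map_b]; simp
    refine Nat.card_congr (Equiv.ofBijective (fun ι => ⟨extend E ι.1,
      ⟨(h.gluesTo_iff ι.1 g s).2 ι.2.1, (hQ ι.1).2 ι.2.2⟩, extend_a ι.1⟩) ⟨?_, ?_⟩)
    · intro ι ι' hh
      refine Subtype.ext (Equiv.ext fun y => ?_)
      have := congrArg (fun τ : Perm X => τ (E (Sum.inl y))) (congrArg Subtype.val hh)
      simpa [extend_inl] using this
    · rintro ⟨ι, ⟨h2, h3⟩, h4⟩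
      obtain ⟨ι', rfl⟩ := exists_extend h2.1 h4
      exact ⟨⟨ι', (h.gluesTo_iff ι' g s).1 h2, (hQ ι').1 h3⟩, rfl⟩

end Removal

/-! ### Expansion of powers in Chebyshev polynomials -/

/-- The coefficient of the `P`-th Chebyshev polynomial `z ^ P + z ^ (-P)` in the power
`(z + z⁻¹) ^ n`; for `P = 0` the polynomial is replaced by one. -/
def backtrackCount : ℕ → ℕ → ℕ
  | 0, P => if P = 0 then 1 else 0
  | n + 1, 0 => 2 * backtrackCount n 1
  | n + 1, P + 1 => backtrackCount n P + backtrackCount n (P + 2)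

theorem backtrackCount_eq_zero {n P : ℕ} (h : n < P) : backtrackCount n P = 0 := by
  induction n generalizing P with
  | zero => simp [backtrackCount, h.ne']
  | succ n ih =>
    obtain ⟨P, rfl⟩ : ∃ Q, P = Q + 1 := ⟨P - 1, by omega⟩
    rw [backtrackCount, ih (by omega), ih (by omega)]

open Polynomial in
/-- The expansion that defines `backtrackCount`, for the Chebyshev polynomials normalized by
`C n (z + z⁻¹) = z ^ n + z ^ (-n)`. -/
theorem X_pow_eq_sum_chebyshev (n : ℕ) :
    (X : ℤ[X]) ^ n = ∑ P ∈ Finset.range (n + 1), (backtrackCount n P : ℤ[X]) *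
      (if P = 0 then 1 else Chebyshev.C ℤ P) := by
  induction n with
  | zero => simp [backtrackCount]
  | succ n ih =>
    rw [Finset.sum_range_succ', pow_succ, ih, Finset.sum_mul]
    have h1 : ∀ P : ℕ, (if P = 0 then 1 else Chebyshev.C ℤ (P : ℤ)) * X =
        Chebyshev.C ℤ ((P + 1 : ℕ) : ℤ) + (if P = 0 then 0 else if P = 1 then 2 else
          Chebyshev.C ℤ ((P - 1 : ℕ) : ℤ)) := by
      intro P
      rcases P with _ | _ | P
      · simp
      · have := Chebyshev.C_add_two ℤ 0
        simp only [zero_add, Chebyshev.C_zero, Chebyshev.C_one] at this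
        simp only [zero_add, one_ne_zero, if_false, if_true, Nat.cast_one, Chebyshev.C_one]
        rw [show ((1 + 1 : ℕ) : ℤ) = 2 by norm_num, this]
        ring
      · have := Chebyshev.C_add_two ℤ (P + 1 : ℤ)
        rw [if_neg (by omega), if_neg (by omega), if_neg (by omega)]
        have e1 : ((P + 1 + 1 + 1 : ℕ) : ℤ) = (P : ℤ) + 1 + 2 := by push_cast; ring
        have e2 : ((P + 1 + 1 - 1 : ℕ) : ℤ) = (P : ℤ) + 1 := by push_cast; omega
        have e3 : ((P + 1 + 1 : ℕ) : ℤ) = (P : ℤ) + 1 + 1 := by push_cast; ring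
        rw [e1, e2, e3, this]
        ring
    simp_rw [mul_assoc, h1, mul_add]
    rw [Finset.sum_add_distrib]
    have h2 : ∑ P ∈ Finset.range (n + 1), (backtrackCount n P : ℤ[X]) *
        (if P = 0 then 0 else if P = 1 then 2 else Chebyshev.C ℤ ((P - 1 : ℕ) : ℤ)) =
        ∑ P ∈ Finset.range (n + 1 + 2), (backtrackCount n P : ℤ[X]) *
        (if P = 0 then 0 else if P = 1 then 2 else Chebyshev.C ℤ ((P - 1 : ℕ) : ℤ)) := by
      refine Finset.sum_subset (Finset.range_subset_range.2 (by omega)) fun P _ hP => ?_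
      rw [backtrackCount_eq_zero (by simpa using hP), Nat.cast_zero, zero_mul]
    rw [h2, Finset.sum_range_succ' _ (n + 1 + 1), Finset.sum_range_succ' _ (n + 1)]
    simp only [backtrackCount]
    simp only [Nat.add_eq_zero_iff, one_ne_zero, and_false, if_false, if_true, mul_zero, add_zero,
      zero_add, Nat.add_eq_right, mul_one, Nat.cast_add, add_mul,
      Finset.sum_add_distrib, Nat.cast_mul, Nat.cast_ofNat, add_tsub_cancel_right]
    ring

open Polynomial in
/-- The difference of the two counts in the last step, the closing of the cycle, in
`expand_of_recursion`. -/
theorem chebyshev_C_eq_S_sub (n : ℕ) :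
    Chebyshev.C ℤ ((n + 2 : ℕ) : ℤ) = Chebyshev.S ℤ ((n + 2 : ℕ) : ℤ) - Chebyshev.S ℤ (n : ℤ) := by
  have h1 := Chebyshev.C_eq_S_sub_X_mul_S ℤ ((n + 2 : ℕ) : ℤ)
  have h2 := Chebyshev.S_add_two ℤ (n : ℤ)
  have e1 : ((n + 2 : ℕ) : ℤ) = (n : ℤ) + 2 := by push_cast; ring
  have e2 : (n : ℤ) + 2 - 1 = (n : ℤ) + 1 := by ring
  rw [e1, e2] at h1
  rw [e1, h1, h2]
  ring

/-- Inversion of the recursion that imposes the conditions along a cycle one after the other. Here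
`F n j` counts objects on a cycle of length `n` that satisfy the first `j` conditions. Each
condition on a path obeys the recursion of the Chebyshev polynomials `S`, and the last condition,
which closes the cycle, turns them into the polynomials `C`. -/
theorem expand_of_recursion {F : ℕ → ℕ → ℤ} (h0 : ∀ j, F 0 j = 0) (h1 : F 1 0 = F 1 1)
    (hR : ∀ m j, j ≤ m → F (m + 2) j = F (m + 2) (j + 1) + F m (j - 1))
    (hC : ∀ m, F (m + 2) (m + 1) = F (m + 2) (m + 2) + F m (m - 1)) (n : ℕ) :
    F n 0 = ∑ P ∈ Finset.Icc 1 n, (backtrackCount n P : ℤ) * F P P := by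
  classical
  -- the linear functional with the unconditioned counts as moments
  let L : Polynomial ℤ →ₗ[ℤ] ℤ := (Polynomial.basisMonomials ℤ).constr ℤ fun n => F n 0
  have hL : ∀ n, L (Polynomial.X ^ n) = F n 0 := by
    intro n
    have := (Polynomial.basisMonomials ℤ).constr_basis ℤ (fun n => F n 0) n
    rw [Polynomial.coe_basisMonomials] at this
    beta_reduce at this
    rwa [Polynomial.monomial_one_right_eq_X_pow] at this
  -- `j` conditions on a cycle of length `j + m + 1` are encoded by the polynomial `S (j + 1)`
  have hS : ∀ j m : ℕ, F (j + m + 1) j =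
      L (Polynomial.X ^ m * Polynomial.Chebyshev.S ℤ ((j + 1 : ℕ) : ℤ)) := by
    intro j
    induction j using Nat.strong_induction_on with
    | _ j ih =>
      intro m
      rcases j with _ | _ | j
      · rw [zero_add, Nat.cast_one, Polynomial.Chebyshev.S_one, ← pow_succ, hL]
      · have h2 := hR m 0 (by omega)
        have h3 : (((0 + 1 + 1 : ℕ)) : ℤ) = 2 := by norm_num
        rw [show 0 + 1 + m + 1 = m + 2 by ring, h3, Polynomial.Chebyshev.S_two, mul_sub, mul_one,
          ← pow_add, map_sub, hL, hL, h2]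
        simp
      · have h2 := hR (j + 1 + m) (j + 1) (by omega)
        have h3 := ih (j + 1) (by omega) (m + 1)
        have h4 := ih j (by omega) m
        have h5 := Polynomial.Chebyshev.S_add_two ℤ ((j + 1 : ℕ) : ℤ)
        have e1 : ((j + 1 + 1 + 1 : ℕ) : ℤ) = ((j + 1 : ℕ) : ℤ) + 2 := by push_cast; ring
        have e2 : ((j + 1 + 1 : ℕ) : ℤ) = ((j + 1 : ℕ) : ℤ) + 1 := by push_cast; ring
        rw [e2] at h3
        rw [e1, h5, mul_sub, map_sub, ← h4, ← mul_assoc, ← pow_succ, ← h3]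
        rw [show j + 1 + (m + 1) + 1 = j + 1 + m + 2 by ring,
          show j + 1 + 1 + m + 1 = j + 1 + m + 2 by ring,
          show j + m + 1 = j + 1 + m by ring, h2]
        simp
  have hone : L 1 = 0 := by rw [← pow_zero Polynomial.X, hL, h0]
  -- all conditions are encoded by the polynomial `C P`
  have hCC : ∀ P : ℕ, L (if P = 0 then 1 else Polynomial.Chebyshev.C ℤ (P : ℤ)) =
      if P = 0 then 0 else F P P := by
    intro P
    rcases P with _ | _ | P
    · simp [hone]
    · have := hL 1
      rw [pow_one] at this
      simp [this, h1]
    · rw [if_neg (by omega), if_neg (by omega), show P + 1 + 1 = P + 2 from rfl,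
        chebyshev_C_eq_S_sub, map_sub]
      have h2 := hS (P + 1) 0
      rw [pow_zero, one_mul] at h2
      rw [show P + 2 = P + 1 + 1 from rfl, ← h2]
      have h3 := hC P
      rw [show P + 1 + 0 + 1 = P + 2 from rfl, h3]
      rcases P with _ | P
      · simp [hone, h0]
      · have h4 := hS P 0
        rw [pow_zero, one_mul] at h4
        rw [← h4]
        simp
  rw [← hL, X_pow_eq_sum_chebyshev, map_sum, Finset.sum_range_eq_add_Ico _ (by omega)]
  have hmul : ∀ (a : ℕ) (p : Polynomial ℤ), L ((a : Polynomial ℤ) * p) = a * L p := by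
    intro a p
    rw [← nsmul_eq_mul, map_nsmul, nsmul_eq_mul]
  simp_rw [hmul, hCC]
  simp only [if_true, hone, mul_zero, zero_add]
  refine Finset.sum_congr ?_ fun P hP => ?_
  · ext P; simp
  · rw [if_neg (by simp at hP; omega)]

/-! ### Reduction of one cycle -/

theorem reducedCount_congr_pred {X : Type*} {φ : Perm X} {D D' : X → Prop}
    (hD : ∀ x, D x ↔ D' x) (g s : ℕ) : reducedCount φ D g s = reducedCount φ D' g s :=
  reducedCount_congr (φ := φ) (φ' := φ) (Equiv.refl _) (fun _ => rfl) hD g s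

section Circle

variable {Z : Type*}

/-- Gluings of `ψ` and of one more cycle of length `n`; the first `j` elements of this cycle are
not paired with their successors. -/
def circleCount (ψ : Perm Z) (D : Z → Prop) (g s n j : ℕ) : ℕ :=
  reducedCount (Perm.sumCongr ψ (finRotate n)) (Sum.elim D fun x => x.val < j) g s

theorem finRotate_val {n : ℕ} (x : Fin n) :
    (finRotate n x).val = if x.val + 1 = n then 0 else x.val + 1 := by
  obtain ⟨n, rfl⟩ : ∃ k, n = k + 1 := ⟨n - 1, by have := x.pos; omega⟩
  rw [finRotate_apply, Fin.val_add_one]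
  have : x = Fin.last n ↔ x.val + 1 = n + 1 := by rw [Fin.ext_iff]; simp
  simp only [this]

/-- The elements of a cycle of length `m + 2` other than `j` and `j + 1`. -/
def skipMap (m j : ℕ) (hj : j ≤ m) : Fin m ⊕ Bool → Fin (m + 2)
  | Sum.inl y => ⟨if y.val < j then y.val else y.val + 2, by have := y.2; split_ifs <;> omega⟩
  | Sum.inr false => ⟨j, by omega⟩
  | Sum.inr true => ⟨j + 1, by omega⟩

/-- The elements of a cycle of length `m + 2` other than the last and the first one. -/
def skipLastMap (m : ℕ) : Fin m ⊕ Bool → Fin (m + 2)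
  | Sum.inl y => ⟨y.val + 1, by have := y.2; omega⟩
  | Sum.inr false => ⟨m + 1, by omega⟩
  | Sum.inr true => ⟨0, by omega⟩

theorem skipMap_bijective (m j : ℕ) (hj : j ≤ m) : Function.Bijective (skipMap m j hj) := by
  rw [Fintype.bijective_iff_injective_and_card]
  refine ⟨?_, by simp⟩
  rintro (x | _ | _) (y | _ | _) h <;> simp only [skipMap, Fin.mk.injEq] at h
  · rw [Sum.inl.injEq, Fin.ext_iff]; split_ifs at h <;> omega
  all_goals first | rfl | (exfalso; try split_ifs at h) <;> omega

theorem skipLastMap_bijective (m : ℕ) : Function.Bijective (skipLastMap m) := by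
  rw [Fintype.bijective_iff_injective_and_card]
  refine ⟨?_, by simp⟩
  rintro (x | _ | _) (y | _ | _) h <;> simp only [skipLastMap, Fin.mk.injEq] at h
  · rw [Sum.inl.injEq, Fin.ext_iff]; omega
  all_goals first | rfl | (exfalso; omega)

/-- Removal of two elements from the cycle of length `m + 2`. -/
def circleEquiv (Z : Type*) {m : ℕ} {f : Fin m ⊕ Bool → Fin (m + 2)} (hf : Function.Bijective f) :
    (Z ⊕ Fin m) ⊕ Bool ≃ Z ⊕ Fin (m + 2) :=
  (Equiv.sumAssoc Z (Fin m) Bool).trans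
    (Equiv.sumCongr (Equiv.refl Z) (Equiv.ofBijective f hf))

/-- The removal of two elements from a cycle, when the other cycles are kept. -/
theorem circle_removal (ψ : Perm Z) {m : ℕ} {f : Fin m ⊕ Bool → Fin (m + 2)}
    (hf : Function.Bijective f) (c : Fin m)
    (ha : finRotate (m + 2) (f (Sum.inr false)) = f (Sum.inr true))
    (hb : finRotate (m + 2) (f (Sum.inr true)) = f (Sum.inl c))
    (hy : ∀ y, finRotate (m + 2) (f (Sum.inl y)) = f (Sum.inl (finRotate m y)) ∨
      (finRotate (m + 2) (f (Sum.inl y)) = f (Sum.inr false) ∧ finRotate m y = c)) :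
    Removal (circleEquiv Z hf) (Perm.sumCongr ψ (finRotate (m + 2)))
      (Perm.sumCongr ψ (finRotate m)) (Sum.inr c) where
  map_a := congrArg Sum.inr ha
  map_b := congrArg Sum.inr hb
  map_other := by
    rintro (z | y)
    · exact Or.inl rfl
    · rcases hy y with h | ⟨h, h'⟩
      · exact Or.inl (congrArg Sum.inr h)
      · exact Or.inr ⟨congrArg Sum.inr h, congrArg Sum.inr h'⟩

/-- Either the element `j` is not paired with its successor, or this pair is removed; then the
condition at the element `j - 1` becomes void, as its successor has changed. -/
theorem circleCount_path [Finite Z] (ψ : Perm Z) (D : Z → Prop) (g s : ℕ) {m j : ℕ} (hm : 0 < m)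
    (hj : j ≤ m) : circleCount ψ D g s (m + 2) j =
      circleCount ψ D g s (m + 2) (j + 1) + circleCount ψ D g s m (j - 1) := by
  let c : Fin m := ⟨if j < m then j else 0, by split_ifs <;> omega⟩
  have hrem := circle_removal ψ (skipMap_bijective m j hj) c
    (by rw [Fin.ext_iff, finRotate_val]; simp only [skipMap]; grind)
    (by rw [Fin.ext_iff, finRotate_val]; simp only [skipMap, c]; grind)
    (by
      intro y
      have := y.2
      rw [Fin.ext_iff, Fin.ext_iff, Fin.ext_iff, finRotate_val]
      simp only [skipMap, c, finRotate_val]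
      grind)
  rw [circleCount, hrem.reducedCount_eq (D := Sum.elim D fun x => x.val < j)
    (lt_irrefl j)]
  congr 1
  · refine reducedCount_congr_pred (fun x => ?_) g s
    revert x
    rintro (z | x)
    · exact or_iff_left (by rintro ⟨⟩)
    · change (x.val < j ∨ Sum.inr x = Sum.inr _) ↔ x.val < j + 1
      rw [Sum.inr.injEq, Fin.ext_iff]
      simp only [Equiv.ofBijective_apply, skipMap]
      omega
  · refine reducedCount_congr_pred (fun x => ?_) g s
    revert x
    rintro (z | x)
    · exact and_iff_left (by rintro ⟨⟩)
    · change ((skipMap m j hj (Sum.inl x)).val < j ∧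
        Sum.inr (finRotate (m + 2) (skipMap m j hj (Sum.inl x))) ≠
          Sum.inr (skipMap m j hj (Sum.inr false))) ↔ x.val < j - 1
      rw [ne_eq, Sum.inr.injEq, Fin.ext_iff, finRotate_val]
      simp only [skipMap]
      have := x.2
      split_ifs <;> omega

/-- The condition at the last element, whose successor is the first one. When the pair is removed,
the condition at the element before the last one becomes void as well. -/
theorem circleCount_close [Finite Z] (ψ : Perm Z) (D : Z → Prop) (g s : ℕ) {m : ℕ} (hm : 0 < m) :
    circleCount ψ D g s (m + 2) (m + 1) =
      circleCount ψ D g s (m + 2) (m + 2) + circleCount ψ D g s m (m - 1) := by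
  have hrem := circle_removal ψ (skipLastMap_bijective m) ⟨0, hm⟩
    (by rw [Fin.ext_iff, finRotate_val]; simp [skipLastMap])
    (by rw [Fin.ext_iff, finRotate_val]; simp [skipLastMap])
    (by
      intro y
      have := y.2
      rw [Fin.ext_iff, Fin.ext_iff, Fin.ext_iff, finRotate_val]
      simp only [skipLastMap, finRotate_val]
      grind)
  rw [circleCount, hrem.reducedCount_eq (D := Sum.elim D fun x => x.val < m + 1)
    (lt_irrefl (m + 1))]
  congr 1
  · refine reducedCount_congr_pred (fun x => ?_) g s
    revert x
    rintro (z | x)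
    · exact or_iff_left (by rintro ⟨⟩)
    · change (x.val < m + 1 ∨ Sum.inr x = Sum.inr _) ↔ x.val < m + 2
      rw [Sum.inr.injEq, Fin.ext_iff]
      simp only [Equiv.ofBijective_apply, skipLastMap]
      omega
  · refine reducedCount_congr_pred (fun x => ?_) g s
    revert x
    rintro (z | x)
    · exact and_iff_left (by rintro ⟨⟩)
    · change ((skipLastMap m (Sum.inl x)).val < m + 1 ∧
        Sum.inr (finRotate (m + 2) (skipLastMap m (Sum.inl x))) ≠
          Sum.inr (skipLastMap m (Sum.inr false))) ↔ x.val < m - 1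
      rw [ne_eq, Sum.inr.injEq, Fin.ext_iff, finRotate_val]
      simp only [skipLastMap]
      have := x.2
      grind

/-- On a cycle of length one the condition says that a pairing has no fixed points. -/
theorem circleCount_one (ψ : Perm Z) (D : Z → Prop) (g s : ℕ) :
    circleCount ψ D g s 1 0 = circleCount ψ D g s 1 1 := by
  refine Nat.card_congr (Equiv.subtypeEquivRight fun ι => and_congr_right fun hι => ?_)
  rw [Sum.forall, Sum.forall]
  refine and_congr_right fun _ => ⟨fun _ x _ => ?_, fun _ x hx => absurd hx (Nat.not_lt_zero _)⟩
  have : Perm.sumCongr ψ (finRotate 1) (Sum.inr x) = Sum.inr x :=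
    congrArg Sum.inr (Subsingleton.elim _ _)
  rw [this]
  exact hι.1.2 _

/-- A cycle of length two cannot be glued to itself, as the surface would be a sphere with one
face. -/
theorem not_gluesTo_two [Finite Z] {ψ : Perm Z} {g s : ℕ} (hgs : 2 < 2 * g + s)
    {ι : Perm (Z ⊕ Fin 2)} (hι : GluesTo (Perm.sumCongr ψ (finRotate 2)) g s ι) :
    ι (Sum.inr 0) ≠ Sum.inr 1 := by
  intro h01
  have h10 : ι (Sum.inr 1) = Sum.inr 0 := by rw [← h01, hι.1.1]
  have hZ : ∀ z : Z, False := by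
    intro z
    have hf : ∀ x, (ι x).isRight = true ↔ x.isRight = true := by
      refine invariant_of_mapsTo (σ := ι) (A := fun x => x.isRight = true) fun x hx => ?_
      obtain ⟨y, rfl⟩ := Sum.isRight_iff.1 hx
      fin_cases y
      · exact congrArg Sum.isRight h01
      · exact congrArg Sum.isRight h10
    have := hι.2.1 (fun x => x.isRight = true) (by rintro (x | x) <;> simp) hf
      (Sum.inl z) (Sum.inr 0)
    simp at this
  have : IsEmpty Z := ⟨hZ⟩
  have hone : Perm.sumCongr ψ (finRotate 2) * ι = 1 := by
    ext x
    rcases x with z | x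
    · exact (hZ z).elim
    · fin_cases x
      · exact (congrArg (Perm.sumCongr ψ (finRotate 2)) h01).trans rfl
      · exact (congrArg (Perm.sumCongr ψ (finRotate 2)) h10).trans rfl
  have hE := hι.2.2
  have hcyc : cyc (1 : Perm (Z ⊕ Fin 2)) = 2 := by
    have := Fintype.ofFinite Z
    have h := cyc_eq_sum (1 : Perm (Z ⊕ Fin 2))
    have hm : ∀ x, Function.minimalPeriod (1 : Perm (Z ⊕ Fin 2)) x = 1 := fun x =>
      Function.minimalPeriod_eq_one_iff_isFixedPt.2 rfl
    simp only [hm] at h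
    rw [Fintype.sum_sum_type] at h
    norm_num at h
    exact_mod_cast h
  rw [hone, EulerEq, hcyc, Nat.card_sum, Nat.card_of_isEmpty, Nat.card_fin] at hE
  omega

/-- On a cycle of length two all conditions hold automatically. -/
theorem circleCount_two [Finite Z] (ψ : Perm Z) (D : Z → Prop) {g s : ℕ} (hgs : 2 < 2 * g + s)
    (j : ℕ) : circleCount ψ D g s 2 j = circleCount ψ D g s 2 0 := by
  refine Nat.card_congr (Equiv.subtypeEquivRight fun ι => and_congr_right fun hι => ?_)
  rw [Sum.forall, Sum.forall]
  refine and_congr_right fun _ => ⟨fun _ x hx => absurd hx (Nat.not_lt_zero _), fun _ x _ => ?_⟩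
  have h01 := not_gluesTo_two hgs hι
  fin_cases x
  · exact h01
  · intro h
    have h' : ι (Sum.inr 1) = Sum.inr 0 := h
    exact h01 (by rw [← h', hι.1.1])

/-- The gluings of a cycle of length `n`, sorted by the length of the cycle that is left when
all backtracking edges are removed. -/
theorem circleCount_expand [Finite Z] (ψ : Perm Z) (D : Z → Prop) {g s : ℕ} (hgs : 2 < 2 * g + s)
    {n : ℕ} (hn : 0 < n) : circleCount ψ D g s n 0 =
      ∑ P ∈ Finset.Icc 1 n, backtrackCount n P * circleCount ψ D g s P P := by
  have h := expand_of_recursion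
    (F := fun n j => if n = 0 then 0 else (circleCount ψ D g s n j : ℤ)) (fun j => by simp)
    (by simp [circleCount_one]) (fun m j hj => ?_) (fun m => ?_) n
  · have h' : (circleCount ψ D g s n 0 : ℤ) =
        ∑ P ∈ Finset.Icc 1 n, (backtrackCount n P : ℤ) * circleCount ψ D g s P P := by
      rw [if_neg hn.ne'] at h
      rw [h]
      refine Finset.sum_congr rfl fun P hP => ?_
      rw [if_neg (by simp at hP; omega)]
    exact_mod_cast h'
  · rcases Nat.eq_zero_or_pos m with rfl | hm
    · simp [circleCount_two ψ D hgs j, circleCount_two ψ D hgs (j + 1)]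
    · simp only [hm.ne', if_false, Nat.add_eq_zero_iff, OfNat.ofNat_ne_zero, and_false]
      exact_mod_cast circleCount_path ψ D g s hm hj
  · rcases Nat.eq_zero_or_pos m with rfl | hm
    · simp [circleCount_two ψ D hgs 1, circleCount_two ψ D hgs 2]
    · simp only [hm.ne', if_false, Nat.add_eq_zero_iff, OfNat.ofNat_ne_zero, and_false]
      exact_mod_cast circleCount_close ψ D g s hm

end Circle

/-! ### Reduction of all cycles -/

/-- Separation of the first star. -/
def consStars {t : ℕ} (k : Fin (t + 1) → ℕ) :
    Fin (k 0) ⊕ Stars (fun i => k (Fin.succ i)) ≃ Stars k where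
  toFun := Sum.elim (fun x => ⟨0, x⟩) fun x => ⟨x.1.succ, x.2⟩
  invFun x := Fin.cases (motive := fun i => Fin (k i) → Fin (k 0) ⊕ Stars (fun i => k (Fin.succ i)))
    (fun y => Sum.inl y) (fun i y => Sum.inr ⟨i, y⟩) x.1 x.2
  left_inv := by rintro (x | ⟨i, x⟩) <;> rfl
  right_inv := by
    rintro ⟨i, x⟩
    induction i using Fin.cases <;> rfl

theorem sum_piFinset_cons {t : ℕ} (A : Fin (t + 1) → Finset ℕ) (f : (Fin (t + 1) → ℕ) → ℕ) :
    ∑ P ∈ Fintype.piFinset A, f P =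
      ∑ a ∈ A 0, ∑ P ∈ Fintype.piFinset fun i : Fin t => A i.succ,
        f (Fin.cons (α := fun _ => ℕ) a P) := by
  rw [← Finset.sum_product']
  refine Finset.sum_nbij' (fun P => (P 0, fun i => P (Fin.succ i)))
    (fun p => Fin.cons (α := fun _ => ℕ) p.1 p.2) ?_ ?_ ?_ ?_ ?_
  · intro P hP
    rw [Fintype.mem_piFinset] at hP
    exact Finset.mem_product.2 ⟨hP 0, Fintype.mem_piFinset.2 fun i => hP _⟩
  · intro p hp
    rw [Finset.mem_product, Fintype.mem_piFinset] at hp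
    rw [Fintype.mem_piFinset]
    intro i
    induction i using Fin.cases with
    | zero => exact hp.1
    | succ i => exact hp.2 i
  · intro P _
    funext i
    induction i using Fin.cases <;> rfl
  · intro p _; rfl
  · intro P _
    congr 1
    funext i
    induction i using Fin.cases <;> rfl

/-- Induction on the number `t` of stars that are not yet reduced. The reduced cycles are moved into
`ψ`, where the conditions are in force on `D`. -/
theorem reducedCount_expand {g s : ℕ} (hgs : 2 < 2 * g + s) : ∀ (t : ℕ) (Z : Type) [Finite Z]
    (ψ : Perm Z) (D : Z → Prop) (k : Fin t → ℕ), (∀ i, 0 < k i) →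
    reducedCount (Perm.sumCongr ψ (starsRotation k)) (Sum.elim D fun _ => False) g s =
      ∑ P ∈ Fintype.piFinset fun i => Finset.Icc 1 (k i), (∏ i, backtrackCount (k i) (P i)) *
        reducedCount (Perm.sumCongr ψ (starsRotation P)) (Sum.elim D fun _ => True) g s := by
  intro t
  induction t with
  | zero =>
    intro Z _ ψ D k _
    rw [Finset.sum_eq_single k (fun P _ hP => absurd (Subsingleton.elim P k) hP)
      (fun h => absurd (Fintype.mem_piFinset.2 fun i => i.elim0) h),
      Finset.prod_of_isEmpty, one_mul]
    refine reducedCount_congr_pred ?_ g s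
    rintro (z | x)
    · rfl
    · exact x.1.elim0
  | succ t ih =>
    intro Z _ ψ D k hk
    have h1 : reducedCount (Perm.sumCongr ψ (starsRotation k)) (Sum.elim D fun _ => False) g s =
        circleCount (Perm.sumCongr ψ (starsRotation fun i => k (Fin.succ i)))
          (Sum.elim D fun _ => False) g s (k 0) 0 := by
      refine (reducedCount_congr (((Equiv.sumAssoc Z _ _).trans (Equiv.sumCongr (Equiv.refl Z)
        ((Equiv.sumComm _ _).trans (consStars k))))) ?_ ?_ g s).symm
      · rintro ((z | x) | x) <;> rfl
      · rintro ((z | x) | x)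
        · rfl
        · rfl
        · exact iff_of_false (Nat.not_lt_zero _) id
    have h2 : ∀ p : ℕ, circleCount (Perm.sumCongr ψ (starsRotation fun i => k (Fin.succ i)))
          (Sum.elim D fun _ => False) g s p p =
        reducedCount (Perm.sumCongr (Perm.sumCongr ψ (finRotate p))
          (starsRotation fun i => k (Fin.succ i)))
          (Sum.elim (Sum.elim D fun _ => True) fun _ => False) g s := by
      intro p
      refine reducedCount_congr ((Equiv.sumAssoc Z _ _).trans ((Equiv.sumCongr (Equiv.refl Z)
        (Equiv.sumComm _ _)).trans (Equiv.sumAssoc Z _ _).symm)) ?_ ?_ g s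
      · rintro ((z | x) | x) <;> rfl
      · rintro ((z | x) | x)
        · rfl
        · rfl
        · exact iff_of_true x.2 trivial
    have h3 : ∀ P : Fin (t + 1) → ℕ, reducedCount (Perm.sumCongr (Perm.sumCongr ψ (finRotate (P 0)))
          (starsRotation fun i => P (Fin.succ i)))
          (Sum.elim (Sum.elim D fun _ => True) fun _ => True) g s =
        reducedCount (Perm.sumCongr ψ (starsRotation P)) (Sum.elim D fun _ => True) g s := by
      intro P
      refine reducedCount_congr ((Equiv.sumAssoc Z _ _).trans
        (Equiv.sumCongr (Equiv.refl Z) (consStars P))) ?_ ?_ g s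
      · rintro ((z | x) | x) <;> rfl
      · rintro ((z | x) | x) <;> rfl
    rw [h1, circleCount_expand _ _ hgs (hk 0), sum_piFinset_cons]
    refine Finset.sum_congr rfl fun p _ => ?_
    rw [h2, ih _ _ _ _ fun i => hk _, Finset.mul_sum]
    refine Finset.sum_congr rfl fun P _ => ?_
    rw [← h3, Fin.prod_univ_succ, ← mul_assoc]
    rfl

/-- The gluings of stars, sorted by the lengths of the cycles that are left when all backtracking
edges are removed. -/
theorem gluingCount_expand {g s : ℕ} (hgs : 2 < 2 * g + s) {k : Fin s → ℕ} (hk : ∀ i, 0 < k i) :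
    gluingCount g k = ∑ P ∈ Fintype.piFinset fun i => Finset.Icc 1 (k i),
      (∏ i, backtrackCount (k i) (P i)) * reducedCount (starsRotation P) (fun _ => True) g s := by
  have h1 : gluingCount g k = reducedCount (Perm.sumCongr (1 : Perm Empty) (starsRotation k))
      (Sum.elim (fun _ => True) fun _ => False) g s := by
    rw [← reducedCount_congr (φ := starsRotation k) (D := fun _ => False)
      (Equiv.emptySum Empty _).symm (fun _ => rfl) (fun _ => Iff.rfl)]
    exact Nat.card_congr (Equiv.subtypeEquivRight fun ι => by simp)
  rw [h1, reducedCount_expand hgs s Empty 1 _ k hk]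
  refine Finset.sum_congr rfl fun P _ => ?_
  congr 1
  exact (reducedCount_congr (Equiv.emptySum Empty _).symm (fun _ => rfl) (fun _ => Iff.rfl) _ _).symm

/-! ### Cyclic placements of segments -/

/-- The cycles of `φ` are labelled by `fc`, and the cycle with the label `I` has `P I` elements. -/
structure CircleSystem {X : Type*} {s : ℕ} (φ : Perm X) (fc : X → Fin s) (P : Fin s → ℕ) :
    Prop where
  lab : CycleLabelling φ fc
  card_fibre : ∀ I, Nat.card {x // fc x = I} = P I

theorem CycleLabelling.exists_iterate {X : Type*} [Finite X] {s : ℕ} {φ : Perm X}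
    {fc : X → Fin s} (h : CycleLabelling φ fc) {x y : X} (hxy : fc x = fc y) :
    ∃ m, φ^[m] x = y := by
  obtain ⟨m, hm⟩ := ((h.2 x y).1 hxy).exists_nat_pow_eq
  exact ⟨m, by rw [iterate_eq_pow, hm]⟩

theorem CycleLabelling.apply {X : Type*} {s : ℕ} {φ : Perm X} {fc : X → Fin s}
    (h : CycleLabelling φ fc) (x : X) : fc (φ x) = fc x :=
  (h.2 _ _).2 (sameCycle_apply_left.2 (SameCycle.refl _ _))

theorem CycleLabelling.iterate {X : Type*} {s : ℕ} {φ : Perm X} {fc : X → Fin s}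
    (h : CycleLabelling φ fc) (m : ℕ) (x : X) : fc (φ^[m] x) = fc x := by
  induction m with
  | zero => rfl
  | succ m ih => rw [Function.iterate_succ_apply', h.apply, ih]

theorem CycleLabelling.card_fibre_eq {X : Type*} [Finite X] {s : ℕ} {φ : Perm X}
    {fc : X → Fin s} (h : CycleLabelling φ fc) (x : X) :
    Nat.card {y // fc y = fc x} = Function.minimalPeriod φ x := by
  rw [← card_sameCycle]
  exact Nat.card_congr (Equiv.subtypeEquivRight fun y => by rw [h.2, sameCycle_comm])

theorem CircleSystem.minimalPeriod_eq {X : Type*} [Finite X] {s : ℕ} {φ : Perm X} {fc : X → Fin s}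
    {P : Fin s → ℕ} (h : CircleSystem φ fc P) (x : X) :
    Function.minimalPeriod φ x = P (fc x) := by
  rw [← h.card_fibre, h.lab.card_fibre_eq]

theorem CircleSystem.iterate_eq {X : Type*} [Finite X] {s : ℕ} {φ : Perm X} {fc : X → Fin s}
    {P : Fin s → ℕ} (h : CircleSystem φ fc P) (x : X) : φ^[P (fc x)] x = x := by
  rw [← h.minimalPeriod_eq]
  exact Function.iterate_minimalPeriod

/-- The positions `β` of segments of lengths `len` on the cycles of `φ`: the segment of `d` is
followed by the segment of `τ d`. -/
def IsPlacement {X Y : Type*} {s : ℕ} (φ : Perm X) (fc : X → Fin s) (τ : Perm Y)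
    (fcY : Y → Fin s) (len : Y → ℕ) (β : Y → X) : Prop :=
  (∀ d, φ^[len d] (β d) = β (τ d)) ∧ ∀ d, fc (β d) = fcY d

/-- A placement is determined by the position of one segment on each cycle. -/
theorem IsPlacement.eq_of_eq {X Y : Type*} [Finite Y] {s : ℕ} {φ : Perm X} {fc : X → Fin s}
    {τ : Perm Y} {fcY : Y → Fin s} {len : Y → ℕ} {β β' : Y → X} (hY : CycleLabelling τ fcY)
    (h : IsPlacement φ fc τ fcY len β) (h' : IsPlacement φ fc τ fcY len β') {base : Fin s → Y}
    (hbase : ∀ I, fcY (base I) = I) (heq : ∀ I, β (base I) = β' (base I)) : β = β' := by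
  funext d
  have hinv : ∀ d, (β (τ d) = β' (τ d)) ↔ β d = β' d :=
    invariant_of_mapsTo (σ := τ) (A := fun d => β d = β' d) fun d hd => by
      rw [← h.1, ← h'.1, hd]
  exact ((sameCycle_iff_forall_invariant τ _ _).1 ((hY.2 (base (fcY d)) d).1 (hbase _))
    (fun d => β d = β' d) hinv).1 (heq _)

/-- The lengths along one turn around a cycle add up to the perimeter of its face. -/
theorem sum_iterate_eq {Y : Type*} [Fintype Y] {s : ℕ} {τ : Perm Y}
    {fcY : Y → Fin s} (hY : CycleLabelling τ fcY) (len : Y → ℕ) (d₀ : Y) :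
    ∑ i ∈ Finset.range (Function.minimalPeriod τ d₀), len (τ^[i] d₀) =
      ∑ d ∈ Finset.univ.filter (fun d => fcY d = fcY d₀), len d := by
  have hinj : Set.InjOn (fun i => τ^[i] d₀) (Finset.range (Function.minimalPeriod τ d₀)) := by
    intro i hi j hj hij
    exact Function.iterate_injOn_Iio_minimalPeriod (by simpa using hi) (by simpa using hj) hij
  refine Finset.sum_nbij (fun i => τ^[i] d₀) ?_ hinj ?_ (fun _ _ => rfl)
  · intro i _
    simp [hY.iterate]
  · intro d hd
    have hd' : fcY d₀ = fcY d := by simpa using (Finset.mem_filter.1 hd).2.symm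
    obtain ⟨m, hm⟩ := hY.exists_iterate hd'
    refine ⟨m % Function.minimalPeriod τ d₀, ?_, ?_⟩
    · rw [Finset.coe_range]
      refine Nat.mod_lt _ ?_
      rw [← card_sameCycle]
      exact Nat.card_pos_iff.2 ⟨⟨⟨d₀, SameCycle.refl _ _⟩⟩, inferInstance⟩
    · simp only [Function.iterate_mod_minimalPeriod_eq, hm]

/-- The segments are put one behind the other; they close up as the lengths add up to the length of
the cycle. -/
theorem exists_placement {X Y : Type*} [Finite X] [Fintype Y] {s : ℕ} {φ : Perm X}
    {fc : X → Fin s} {P : Fin s → ℕ} (hX : CircleSystem φ fc P) {τ : Perm Y} {fcY : Y → Fin s}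
    (hY : CycleLabelling τ fcY) {len : Y → ℕ}
    (hlen : ∀ I, ∑ d ∈ Finset.univ.filter (fun d => fcY d = I), len d = P I) {base : Fin s → Y}
    (hbase : ∀ I, fcY (base I) = I) {b : Fin s → X} (hb : ∀ I, fc (b I) = I) :
    ∃ β, IsPlacement φ fc τ fcY len β ∧ ∀ I, β (base I) = b I := by
  classical
  have hex : ∀ d, ∃ m, τ^[m] (base (fcY d)) = d := fun d => hY.exists_iterate (hbase _)
  -- the distance from the base segment, along the cycle
  let T : Fin s → ℕ → ℕ := fun I m => ∑ i ∈ Finset.range m, len (τ^[i] (base I))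
  have hT0 : ∀ I, T I 0 = 0 := fun I => rfl
  have hTs : ∀ I m, T I (m + 1) = T I m + len (τ^[m] (base I)) := fun I m =>
    Finset.sum_range_succ _ _
  let m : Y → ℕ := fun d => Nat.find (hex d)
  have hm : ∀ d, τ^[m d] (base (fcY d)) = d := fun d => Nat.find_spec (hex d)
  have hTP : ∀ I, T I (Function.minimalPeriod τ (base I)) = P I := by
    intro I
    rw [← hlen I]
    simp only [T]
    rw [sum_iterate_eq hY len (base I), hbase]
  have hmbase : ∀ I, m (base I) = 0 := by
    intro I
    rw [Nat.find_eq_zero]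
    simp [hbase]
  refine ⟨fun d => φ^[T (fcY d) (m d)] (b (fcY d)), ⟨fun d => ?_, fun d => ?_⟩, fun I => ?_⟩
  · have hfc : fcY (τ d) = fcY d := hY.apply d
    change φ^[len d] (φ^[T (fcY d) (m d)] (b (fcY d))) =
      φ^[T (fcY (τ d)) (m (τ d))] (b (fcY (τ d)))
    rw [← Function.iterate_add_apply, hfc]
    have h1 : T (fcY d) (m d + 1) = T (fcY d) (m d) + len d := by rw [hTs, hm]
    have h2 : τ^[m d + 1] (base (fcY d)) = τ d := by rw [Function.iterate_succ_apply', hm]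
    have h3 : m (τ d) ≤ m d + 1 := Nat.find_min' _ (by rw [hfc, h2])
    rcases h3.lt_or_eq with h4 | h4
    · have h5 : τ d = base (fcY d) := by
        by_contra hne
        have hpos : m (τ d) ≠ 0 := by
          intro h0
          have := hm (τ d)
          rw [h0, hfc] at this
          exact hne this.symm
        obtain ⟨q, hq⟩ : ∃ q, m (τ d) = q + 1 := ⟨m (τ d) - 1, by omega⟩
        have h6 := hm (τ d)
        rw [hq, hfc, Function.iterate_succ_apply', τ.apply_eq_iff_eq] at h6
        have : m d ≤ q := Nat.find_min' _ h6
        omega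
      have h6 : m (τ d) = 0 := by rw [h5, hmbase]
      have h7 : Function.minimalPeriod τ (base (fcY d)) = m d + 1 := by
        refine Nat.le_antisymm ?_ ?_
        · exact Function.IsPeriodicPt.minimalPeriod_le (Nat.succ_pos _) (h2.trans h5)
        · by_contra hlt
          push Not at hlt
          have hp : 0 < Function.minimalPeriod τ (base (fcY d)) := by
            rw [← card_sameCycle]
            exact Nat.card_pos_iff.2 ⟨⟨⟨_, SameCycle.refl _ _⟩⟩, inferInstance⟩
          have h8 : τ^[m d % Function.minimalPeriod τ (base (fcY d))] (base (fcY d)) = d := by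
            rw [Function.iterate_mod_minimalPeriod_eq, hm]
          have h9 : m d ≤ m d % Function.minimalPeriod τ (base (fcY d)) := Nat.find_min' _ h8
          have h10 := Nat.mod_lt (m d) hp
          omega
      rw [h6, hT0, add_comm, ← h1, ← h7, hTP]
      have := hX.iterate_eq (b (fcY d))
      rw [hb] at this
      simpa using this
    · rw [h4, h1, add_comm]
  · simp only [hX.lab.iterate, hb]
  · simp only [hbase, hmbase, hT0, Function.iterate_zero, id]

/-- The number of placements: the position of one segment on each cycle can be chosen. -/
theorem card_placements {X Y : Type*} [Finite X] [Fintype Y] {s : ℕ} {φ : Perm X}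
    {fc : X → Fin s} {P : Fin s → ℕ} (hX : CircleSystem φ fc P) {τ : Perm Y} {fcY : Y → Fin s}
    (hY : CycleLabelling τ fcY) {len : Y → ℕ}
    (hlen : ∀ I, ∑ d ∈ Finset.univ.filter (fun d => fcY d = I), len d = P I) :
    Nat.card {β // IsPlacement φ fc τ fcY len β} = ∏ I, P I := by
  choose base hbase using hY.1
  simp_rw [← hX.card_fibre]
  rw [← Nat.card_pi]
  refine Nat.card_congr (Equiv.ofBijective (fun β I => ⟨β.1 (base I), by rw [β.2.2, hbase]⟩)
    ⟨fun β β' h => ?_, fun b => ?_⟩)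
  · exact Subtype.ext (β.2.eq_of_eq hY β'.2 hbase fun I => congrArg Subtype.val (congrFun h I))
  · obtain ⟨β, h1, h2⟩ := exists_placement hX hY hlen hbase (b := fun I => (b I).1)
      fun I => (b I).2
    exact ⟨⟨β, h1⟩, funext fun I => Subtype.ext (h2 I)⟩

/-! ### Contraction of the bivalent vertices -/

section Contraction

variable {X Y : Type*} {s : ℕ}

/-- The segments with the starting points `β d` and the lengths `len d` on the cycles of `φ` are
the sides of chains of edges of the pairing `ι`; the contraction of each chain to a single edge
yields the ribbon graph with the permutations `σ'` and `ι'`. -/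
structure IsContraction (φ ι : Perm X) (σ' ι' : Perm Y) (len : Y → ℕ) (β : Y → X) : Prop where
  pos : ∀ d, 0 < len d
  len_eq : ∀ d, len (ι' d) = len d
  rev : ∀ d j, j < len d → ι (φ^[j] (β d)) = φ^[len d - 1 - j] (β (ι' d))
  next : ∀ d, φ^[len d] (β d) = β (σ' (ι' d))

/-- The map `β` takes the vertices of the contracted graph, the cycles of `σ'`, to vertices of the
gluing, the cycles of `φ * ι`. -/
theorem IsContraction.apply_apply {φ ι : Perm X} {σ' ι' : Perm Y} {len : Y → ℕ} {β : Y → X}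
    (h : IsContraction φ ι σ' ι' len β) (hι' : IsPairing ι') (d : Y) :
    φ (ι (β d)) = β (σ' d) := by
  have h1 := h.rev d 0 (h.pos d)
  have h2 := h.next (ι' d)
  rw [h.len_eq, hι'.1] at h2
  have h3 := h.pos d
  rw [Function.iterate_zero_apply] at h1
  rw [h1, ← Function.iterate_succ_apply' φ, ← h2]
  congr 2
  omega

/-- The points in the interior of a segment belong to vertices of valency two. -/
theorem IsContraction.interior {φ ι : Perm X} {σ' ι' : Perm Y} {len : Y → ℕ} {β : Y → X}
    (h : IsContraction φ ι σ' ι' len β) (hι' : IsPairing ι') {d : Y} {j : ℕ} (h0 : 0 < j)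
    (hj : j < len d) : φ (ι (φ (ι (φ^[j] (β d))))) = φ^[j] (β d) := by
  rw [h.rev d j hj, ← Function.iterate_succ_apply' φ, h.rev (ι' d) _ (by rw [h.len_eq]; omega),
    ← Function.iterate_succ_apply' φ, hι'.1, h.len_eq]
  congr 2
  omega

/-- The segments cover all cycles. -/
theorem exists_mem_segment [Finite X] {φ : Perm X} {fc : X → Fin s} (hX : CycleLabelling φ fc)
    {τ : Perm Y} {face : Y → Fin s} (hface : Function.Surjective face) {len : Y → ℕ}
    (hpos : ∀ d, 0 < len d) {β : Y → X} (hβ : IsPlacement φ fc τ face len β) (x : X) :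
    ∃ d j, j < len d ∧ φ^[j] (β d) = x := by
  obtain ⟨d, hd⟩ := hface (fc x)
  have hinv := invariant_of_mapsTo (σ := φ) (A := fun x => ∃ d j, j < len d ∧ φ^[j] (β d) = x) <| by
    rintro x ⟨d, j, hj, rfl⟩
    rcases Nat.lt_or_ge (j + 1) (len d) with h | h
    · exact ⟨d, j + 1, h, Function.iterate_succ_apply' φ _ _⟩
    · refine ⟨τ d, 0, hpos _, ?_⟩
      rw [Function.iterate_zero_apply, ← hβ.1, ← Function.iterate_succ_apply' φ]
      congr 2
      omega
  have hsc : SameCycle φ (β d) x := (hX.2 _ _).1 ((hβ.2 d).trans hd)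
  exact ((sameCycle_iff_forall_invariant φ _ _).1 hsc
    (fun x => ∃ d j, j < len d ∧ φ^[j] (β d) = x) hinv).1 ⟨d, 0, hpos d, rfl⟩

/-- The segments are disjoint. -/
theorem segment_injective [Fintype X] [Fintype Y] {φ : Perm X} {fc : X → Fin s} {P : Fin s → ℕ}
    (hX : CircleSystem φ fc P) {τ : Perm Y} {face : Y → Fin s} (hface : Function.Surjective face)
    {len : Y → ℕ} (hpos : ∀ d, 0 < len d)
    (hlen : ∀ I, ∑ d ∈ Finset.univ.filter (fun d => face d = I), len d = P I)
    {β : Y → X} (hβ : IsPlacement φ fc τ face len β) {d d' : Y} {j j' : ℕ} (hj : j < len d)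
    (hj' : j' < len d') (heq : φ^[j] (β d) = φ^[j'] (β d')) : d = d' ∧ j = j' := by
  classical
  let e : (Σ d, Fin (len d)) → X := fun p => φ^[p.2.1] (β p.1)
  have hsurj : Function.Surjective e := fun x => by
    obtain ⟨d, j, hj, hx⟩ := exists_mem_segment hX.lab hface hpos hβ x
    exact ⟨⟨d, j, hj⟩, hx⟩
  have hcard : Fintype.card (Σ d, Fin (len d)) = Fintype.card X := by
    rw [Fintype.card_sigma]
    simp only [Fintype.card_fin]
    rw [← Finset.sum_fiberwise (s := Finset.univ) (g := face), ← Finset.card_univ,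
      Finset.card_eq_sum_card_fiberwise (f := fc) (t := Finset.univ) fun _ _ => Finset.mem_coe.2 (Finset.mem_univ _)]
    refine Finset.sum_congr rfl fun I _ => ?_
    rw [hlen, ← hX.card_fibre, Nat.card_eq_fintype_card, Fintype.card_subtype]
  have hb := (Fintype.bijective_iff_surjective_and_card e).2 ⟨hsurj, hcard⟩
  have := hb.1 (a₁ := ⟨d, j, hj⟩) (a₂ := ⟨d', j', hj'⟩) heq
  rw [Sigma.mk.injEq] at this
  obtain ⟨rfl, h2⟩ := this
  exact ⟨rfl, by simpa using h2⟩

/-- Vertices of valency two do not contribute to the Euler characteristic. -/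
theorem eulerEq_iff_of_bivalent [Finite X] [Finite Y] {σ : Perm X} {σ' : Perm Y} {β : Y → X}
    (hβ : Function.Injective β) (hσ : ∀ d, σ (β d) = β (σ' d))
    (hbi : ∀ x, x ∉ Set.range β → σ x ≠ x ∧ σ (σ x) = x) (g : ℕ) :
    EulerEq σ g s ↔ EulerEq σ' g s := by
  classical
  have := Fintype.ofFinite X
  have := Fintype.ofFinite Y
  have h1 := sum_one_sub_minimalPeriod σ
  have h2 := sum_one_sub_minimalPeriod σ'
  have h3 : ∑ x, (1 - 2 / (Function.minimalPeriod σ x : ℚ)) =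
      ∑ d, (1 - 2 / (Function.minimalPeriod σ' d : ℚ)) := by
    rw [← Finset.sum_subset (Finset.subset_univ (Finset.univ.image β)),
      Finset.sum_image fun _ _ _ _ h => hβ h]
    · exact Finset.sum_congr rfl fun d _ => by
        rw [minimalPeriod_semiconj hβ fun d => (hσ d).symm]
    · intro x _ hx
      have hb := hbi x fun ⟨d, hd⟩ => hx (Finset.mem_image.2 ⟨d, Finset.mem_univ _, hd⟩)
      have hp : Function.minimalPeriod σ x = 2 :=
        Function.minimalPeriod_eq_prime (p := 2) hb.2 hb.1
      rw [hp]
      norm_num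
  rw [h1, h2] at h3
  have h4 : (Fintype.card X : ℤ) - 2 * cyc σ = Fintype.card Y - 2 * cyc σ' := by exact_mod_cast h3
  rw [EulerEq, EulerEq, Nat.card_eq_fintype_card, Nat.card_eq_fintype_card]
  omega

/-- A reduced gluing with a numbering `β` of the half-edges at the vertices of valency at least
three. -/
structure IsReducedGluing (φ : Perm X) (g s : ℕ) (ι : Perm X) (β : Y → X) : Prop where
  glues : GluesTo φ g s ι
  reduced : ∀ x, ι x ≠ φ x
  inj : Function.Injective β
  range : ∀ x, x ∈ Set.range β ↔ φ (ι (φ (ι x))) ≠ x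

/-- A fatgraph with lengths of edges, the boundaries of its faces placed on the cycles of `φ`. -/
structure IsPlacedFatgraph [Fintype Y] (φ : Perm X) (fc : X → Fin s) (P : Fin s → ℕ) (g : ℕ)
    (σ' ι' : Perm Y) (face : Y → Fin s) (len : Y → ℕ) (β : Y → X) : Prop where
  fat : IsFatgraph σ' ι' face
  euler : EulerEq σ' g s
  pos : ∀ d, 0 < len d
  len_eq : ∀ d, len (ι' d) = len d
  perim : ∀ I, ∑ d ∈ Finset.univ.filter (fun d => face d = I), len d = P I
  placed : IsPlacement φ fc (σ' * ι') face len β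

/-- A reduced gluing has no univalent vertices. -/
theorem IsReducedGluing.ne {φ : Perm X} {g : ℕ} {ι : Perm X} {β : Y → X}
    (h : IsReducedGluing φ g s ι β) (x : X) : φ (ι x) ≠ x := by
  intro hx
  refine h.reduced (ι x) ?_
  rw [h.glues.1.1, hx]

/-- Subdivision of the edges of a placed fatgraph. -/
theorem IsPlacedFatgraph.exists_gluing [Finite X] [Fintype Y] {φ : Perm X} {fc : X → Fin s}
    {P : Fin s → ℕ} (hX : CircleSystem φ fc P) {g : ℕ} {σ' ι' : Perm Y} {face : Y → Fin s}
    {len : Y → ℕ} {β : Y → X} (h : IsPlacedFatgraph φ fc P g σ' ι' face len β) :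
    ∃ ι : Perm X, IsReducedGluing φ g s ι β ∧ IsContraction φ ι σ' ι' len β := by
  classical
  have := Fintype.ofFinite X
  have hp := h.fat.pairing
  have hex := exists_mem_segment hX.lab h.fat.surj h.pos h.placed
  have hinj : ∀ {d d' : Y} {j j' : ℕ}, j < len d → j' < len d' →
      φ^[j] (β d) = φ^[j'] (β d') → d = d' ∧ j = j' :=
    segment_injective hX h.fat.surj h.pos h.perim h.placed
  choose D J hJ hDJ using hex
  let f : X → X := fun x => φ^[len (D x) - 1 - J x] (β (ι' (D x)))
  have hf : ∀ d j, j < len d → f (φ^[j] (β d)) = φ^[len d - 1 - j] (β (ι' d)) := by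
    intro d j hj
    obtain ⟨h1, h2⟩ := hinj (hJ _) hj (hDJ (φ^[j] (β d)))
    simp only [f]
    rw [h1, h2]
  have hff : Function.Involutive f := by
    intro x
    obtain ⟨d, j, hj, rfl⟩ : ∃ d j, j < len d ∧ φ^[j] (β d) = x := ⟨_, _, hJ x, hDJ x⟩
    rw [hf d j hj, hf _ _ (by rw [h.len_eq]; omega), hp.1, h.len_eq]
    congr 2
    omega
  obtain ⟨ι, hι⟩ : ∃ ι : Perm X, ∀ x, ι x = f x := ⟨Function.Involutive.toPerm f hff, fun _ => rfl⟩
  have hcon : IsContraction φ ι σ' ι' len β :=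
    ⟨h.pos, h.len_eq, fun d j hj => (hι _).trans (hf d j hj), h.placed.1⟩
  have hβ : Function.Injective β := fun d d' hd =>
    (hinj (h.pos d) (h.pos d') (by simpa using hd)).1
  have hS := hcon.apply_apply hp
  have hne : ∀ x, ι x ≠ x := by
    intro x hx
    obtain ⟨d, j, hj, rfl⟩ : ∃ d j, j < len d ∧ φ^[j] (β d) = x := ⟨_, _, hJ x, hDJ x⟩
    rw [hcon.rev d j hj] at hx
    exact hp.2 d (hinj (by rw [h.len_eq]; omega) hj hx).1
  have hred : ∀ x, ι x ≠ φ x := by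
    intro x hx
    obtain ⟨d, j, hj, rfl⟩ : ∃ d j, j < len d ∧ φ^[j] (β d) = x := ⟨_, _, hJ x, hDJ x⟩
    rw [hcon.rev d j hj, ← Function.iterate_succ_apply' φ] at hx
    rcases Nat.lt_or_ge (j + 1) (len d) with h1 | h1
    · exact hp.2 d (hinj (by rw [h.len_eq]; omega) h1 hx).1
    · rw [show j.succ = len d by omega, hcon.next, show len d - 1 - j = 0 by omega,
        Function.iterate_zero_apply] at hx
      exact (h.fat.valency (ι' d)).1 (hβ hx).symm
  have hrange : ∀ x, x ∈ Set.range β ↔ φ (ι (φ (ι x))) ≠ x := by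
    intro x
    constructor
    · rintro ⟨d, rfl⟩ hx
      rw [hS, hS] at hx
      exact (h.fat.valency d).2 (hβ hx)
    · intro hx
      obtain ⟨d, j, hj, rfl⟩ : ∃ d j, j < len d ∧ φ^[j] (β d) = x := ⟨_, _, hJ x, hDJ x⟩
      rcases Nat.eq_zero_or_pos j with rfl | h0
      · exact ⟨d, rfl⟩
      · exact absurd (hcon.interior hp h0 hj) hx
  have hpair : IsPairing ι := ⟨fun x => by rw [hι, hι, hff], hne⟩
  refine ⟨ι, ⟨⟨hpair, ?_, ?_⟩, hred, hβ, hrange⟩, hcon⟩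
  · intro q h1 h2
    have hit : ∀ j x, q (φ^[j] x) ↔ q x := by
      intro j x
      induction j with
      | zero => rfl
      | succ j ih => rw [Function.iterate_succ_apply', h1, ih]
    have hY := h.fat.conn (fun d => q (β d)) (fun d => by rw [← hS, h1, h2]) fun d => by
      have := hcon.rev d 0 (h.pos d)
      rw [Function.iterate_zero_apply] at this
      rw [← hit (len d - 1 - 0), ← this, h2]
    intro x y
    rw [← hDJ x, ← hDJ y, hit, hit]
    exact hY _ _
  · refine (eulerEq_iff_of_bivalent (σ := φ * ι) hβ hS (fun x hx => ⟨fun h3 => ?_, ?_⟩) g).2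
      h.euler
    · refine hred (ι x) ?_
      rw [hpair.1]
      exact h3.symm
    · by_contra h3
      exact hx ((hrange x).2 h3)

namespace IsReducedGluing

variable {φ ι : Perm X} {g : ℕ} {β : Y → X}

/-- The elements `ι x` and `φ x = φ (ι (ι x))` lie at the same vertex. -/
theorem mem_range_iff (h : IsReducedGluing φ g s ι β) (x : X) :
    ι x ∈ Set.range β ↔ φ x ∈ Set.range β := by
  rw [h.range, h.range, h.glues.1.1]
  refine not_congr ⟨fun h1 => ?_, fun h1 => ?_⟩
  · rw [h1, h.glues.1.1]
  · exact (h.glues.1.1 _).symm.trans (congrArg ι (φ.injective h1))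

/-- The contracted graph has the genus of the gluing. -/
theorem eulerEq [Finite X] [Finite Y] (h : IsReducedGluing φ g s ι β) {σ' : Perm Y}
    (hσ : ∀ d, φ (ι (β d)) = β (σ' d)) : EulerEq σ' g s :=
  (eulerEq_iff_of_bivalent (σ := φ * ι) h.inj hσ (fun x hx => ⟨h.ne x, by
    by_contra h3
    exact hx ((h.range x).2 h3)⟩) g).1 h.glues.2.2

/-- Each cycle of `φ` passes through a vertex of valency at least three; otherwise the surface
would be a sphere glued from two discs along a circle. -/
theorem exists_sameCycle [Finite X] [Finite Y] (h : IsReducedGluing φ g s ι β)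
    (hgs : 2 < 2 * g + s) (x : X) : ∃ d, SameCycle φ x (β d) := by
  by_contra hno
  push Not at hno
  have hC : ∀ y, SameCycle φ x y → y ∉ Set.range β := by
    rintro y hy ⟨d, rfl⟩
    exact hno d hy
  have hall : ∀ y, SameCycle φ x y ∨ SameCycle φ x (ι y) := by
    intro y
    refine (h.glues.2.1 (fun y => SameCycle φ x y ∨ SameCycle φ x (ι y)) ?_ ?_ x y).1
      (Or.inl (SameCycle.refl _ _))
    · refine invariant_of_mapsTo (σ := φ) (A := fun y => SameCycle φ x y ∨ SameCycle φ x (ι y)) ?_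
      rintro y (hy | hy)
      · exact Or.inl (sameCycle_apply_right.2 hy)
      · right
        have h1 := hC _ hy
        rw [h.range, not_not, h.glues.1.1] at h1
        rw [← h1, sameCycle_apply_right] at hy
        exact hy
    · intro y
      rw [h.glues.1.1, or_comm]
  have hY : IsEmpty Y := ⟨fun d => by
    rcases hall (β d) with h1 | h1
    · exact hno d h1
    · refine hC (φ (ι (β d))) (sameCycle_apply_right.2 h1) ?_
      rw [← h.mem_range_iff, h.glues.1.1]
      exact ⟨d, rfl⟩⟩
  have h1 := h.eulerEq (σ' := 1) fun d => hY.elim d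
  have h2 : cyc (1 : Perm Y) = 0 := Nat.card_eq_zero.2 (Or.inl
    ⟨fun q => Quotient.inductionOn q fun d => hY.elim d⟩)
  rw [EulerEq, h2, Nat.card_of_isEmpty] at h1
  omega

/-- Removal of the vertices of valency two from a reduced gluing. -/
theorem exists_fatgraph [Fintype X] [Fintype Y] (h : IsReducedGluing φ g s ι β)
    (hgs : 2 < 2 * g + s) {fc : X → Fin s} {P : Fin s → ℕ} (hX : CircleSystem φ fc P) :
    ∃ (σ' ι' : Perm Y) (face : Y → Fin s) (len : Y → ℕ),
      IsPlacedFatgraph φ fc P g σ' ι' face len β ∧ IsContraction φ ι σ' ι' len β := by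
  classical
  have hι := h.glues.1
  have hex : ∀ d, ∃ m, 0 < m ∧ φ^[m] (β d) ∈ Set.range β := fun d => by
    refine ⟨orderOf φ, orderOf_pos φ, d, ?_⟩
    rw [iterate_eq_pow, pow_orderOf_eq_one, one_apply]
  -- the first return to the vertices of valency at least three
  let len : Y → ℕ := fun d => Nat.find (hex d)
  have hpos : ∀ d, 0 < len d := fun d => (Nat.find_spec (hex d)).1
  have hret : ∀ d, φ^[len d] (β d) ∈ Set.range β := fun d => (Nat.find_spec (hex d)).2
  have hint : ∀ d j, 0 < j → j < len d → φ^[j] (β d) ∉ Set.range β := fun d j h0 hj hm =>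
    Nat.find_min (hex d) hj ⟨h0, hm⟩
  have hσm : ∀ d, φ (ι (β d)) ∈ Set.range β := fun d => by
    rw [← h.mem_range_iff, hι.1]
    exact ⟨d, rfl⟩
  have hιm : ∀ d, ι (φ^[len d - 1] (β d)) ∈ Set.range β := fun d => by
    rw [h.mem_range_iff, ← Function.iterate_succ_apply' φ, Nat.succ_eq_add_one,
      Nat.sub_add_cancel (hpos d)]
    exact hret d
  choose σf hσf using hσm
  choose ιf hιf using hιm
  have hσinj : Function.Injective σf := fun d d' hd => by
    have h1 := congrArg β hd
    rw [hσf, hσf] at h1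
    exact h.inj (ι.injective (φ.injective h1))
  have hrev : ∀ d i, i < len d → ι (φ^[len d - 1 - i] (β d)) = φ^[i] (β (ιf d)) := by
    intro d i
    induction i with
    | zero => intro _; exact (hιf d).symm
    | succ i ih =>
      intro hi
      -- at a vertex of valency two the two sides of a chain of edges run in opposite directions
      have h1 : φ (φ^[len d - 1 - (i + 1)] (β d)) = φ^[len d - 1 - i] (β d) := by
        rw [← Function.iterate_succ_apply' φ]
        congr 2
        omega
      have h2 : φ (φ^[len d - 1 - (i + 1)] (β d)) ∉ Set.range β := by
        rw [h1]
        exact hint d _ (by omega) (by omega)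
      rw [← h.mem_range_iff, h.range, not_not, hι.1, h1, ih (by omega)] at h2
      rw [← h2, ← Function.iterate_succ_apply' φ]
  have hend : ∀ d, φ^[len d] (β (ιf d)) = β (σf d) := by
    intro d
    have h1 := hrev d (len d - 1) (by have := hpos d; omega)
    rw [Nat.sub_self, Function.iterate_zero_apply] at h1
    rw [hσf, h1, ← Function.iterate_succ_apply' φ, Nat.succ_eq_add_one,
      Nat.sub_add_cancel (hpos d)]
  have hlen : ∀ d, len (ιf d) = len d := by
    intro d
    rw [Nat.find_eq_iff]
    refine ⟨⟨hpos d, by rw [hend]; exact ⟨_, rfl⟩⟩, ?_⟩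
    rintro i hi ⟨h0, hm⟩
    rw [← hrev d i hi, h.mem_range_iff, ← Function.iterate_succ_apply' φ] at hm
    exact hint d _ (Nat.succ_pos _) (by omega) hm
  have hιι : Function.Involutive ιf := fun d => by
    refine h.inj ?_
    have h1 := hrev d (len d - 1) (by have := hpos d; omega)
    rw [Nat.sub_self, Function.iterate_zero_apply] at h1
    rw [hιf, hlen, ← h1, hι.1]
  have hιne : ∀ d, ιf d ≠ d := by
    intro d hd
    have h0 := hpos d
    -- the middle of the chain is fixed by `ι`, or it is the centre of a backtracking edge
    rcases Nat.even_or_odd' (len d) with ⟨k, hk | hk⟩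
    · have h1 := hrev d k (by omega)
      rw [hd, show k = (k - 1) + 1 by omega, show len d - 1 - (k - 1 + 1) = k - 1 by omega,
        Function.iterate_succ_apply'] at h1
      exact h.reduced _ h1
    · have h1 := hrev d k (by omega)
      rw [hd, show len d - 1 - k = k by omega] at h1
      exact hι.2 _ h1
  obtain ⟨ι', hι'⟩ : ∃ ι' : Perm Y, ∀ x, ι' x = ιf x :=
    ⟨Function.Involutive.toPerm ιf hιι, fun _ => rfl⟩
  obtain ⟨σ', hσ'⟩ : ∃ σ' : Perm Y, ∀ x, σ' x = σf x :=
    ⟨Equiv.ofBijective σf (Finite.injective_iff_bijective.1 hσinj), fun _ => rfl⟩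
  have hp : IsPairing ι' := ⟨fun d => by rw [hι', hι', hιι], fun d => by rw [hι']; exact hιne d⟩
  have hnext : ∀ d, φ^[len d] (β d) = β (σ' (ι' d)) := fun d => by
    have h1 := hend (ιf d)
    rw [hιι, hlen] at h1
    rw [hι', hσ', h1]
  have hcon : IsContraction φ ι σ' ι' len β :=
    ⟨hpos, fun d => by rw [hι', hlen], fun d j hj => by
      have := hrev d (len d - 1 - j) (by omega)
      rw [← show j = len d - 1 - (len d - 1 - j) by omega] at this
      rw [this, hι'], hnext⟩
  have hS := hcon.apply_apply hp
  have hplace : IsPlacement φ fc (σ' * ι') (fun d => fc (β d)) len β := ⟨hnext, fun _ => rfl⟩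
  have hsurj : Function.Surjective fun d => fc (β d) := by
    intro I
    obtain ⟨x, rfl⟩ := hX.lab.1 I
    obtain ⟨d, hd⟩ := h.exists_sameCycle hgs x
    exact ⟨d, ((hX.lab.2 _ _).2 hd).symm⟩
  have hcover := exists_mem_segment hX.lab hsurj hpos hplace
  have hzero : ∀ d j d', j < len d → φ^[j] (β d) = β d' → j = 0 := by
    intro d j d' hj heq
    by_contra h0
    exact hint d j (Nat.pos_of_ne_zero h0) hj ⟨d', heq.symm⟩
  have hinj : ∀ d j d' j', j < len d → j' < len d' → j ≤ j' →
      φ^[j] (β d) = φ^[j'] (β d') → d = d' ∧ j = j' := by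
    intro d j d' j' hj hj' hle heq
    rw [← Nat.add_sub_cancel' hle, Function.iterate_add_apply] at heq
    have h1 := (φ.injective.iterate j) heq
    have h2 := hzero _ _ _ (by omega) h1.symm
    rw [h2, Function.iterate_zero_apply] at h1
    exact ⟨h.inj h1, by omega⟩
  refine ⟨σ', ι', fun d => fc (β d), len, ⟨⟨hp, fun d => ⟨fun hd => ?_, fun hd => ?_⟩, ?_, hsurj,
    fun d d' => ⟨fun hd => ?_, fun hd => ?_⟩⟩, h.eulerEq fun d => hS d, hpos, hcon.len_eq,
    fun I => ?_, hplace⟩, hcon⟩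
  · exact h.ne (β d) (by rw [hS, hd])
  · exact (h.range (β d)).1 ⟨d, rfl⟩ (by rw [hS, hS, hd])
  · intro q h1 h2
    -- the invariant set of half-edges, extended along the segments
    have h3 := h.glues.2.1 (fun x => ∃ d j, j < len d ∧ φ^[j] (β d) = x ∧ q d)
      (invariant_of_mapsTo (σ := φ) (A := fun x => ∃ d j, j < len d ∧ φ^[j] (β d) = x ∧ q d) <| by
        rintro x ⟨d, j, hj, rfl, hq⟩
        rcases Nat.lt_or_ge (j + 1) (len d) with h4 | h4
        · exact ⟨d, j + 1, h4, Function.iterate_succ_apply' φ _ _, hq⟩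
        · refine ⟨σ' (ι' d), 0, hpos _, ?_, (h1 _).2 ((h2 _).2 hq)⟩
          rw [Function.iterate_zero_apply, ← hnext, ← Function.iterate_succ_apply' φ]
          congr 2
          omega)
      (invariant_of_mapsTo (σ := ι) (A := fun x => ∃ d j, j < len d ∧ φ^[j] (β d) = x ∧ q d) <| by
        rintro x ⟨d, j, hj, rfl, hq⟩
        exact ⟨ι' d, len d - 1 - j, by rw [hcon.len_eq]; omega, (hcon.rev d j hj).symm,
          (h2 d).2 hq⟩)
    have h4 : ∀ d d', q d → q d' := by
      intro d d' hq
      obtain ⟨d'', j, hj, heq, hq'⟩ := (h3 (β d) (β d')).1 ⟨d, 0, hpos d, rfl, hq⟩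
      have := hzero _ _ _ hj heq
      rw [this, Function.iterate_zero_apply] at heq
      rwa [← h.inj heq]
    exact fun d d' => ⟨h4 d d', h4 d' d⟩
  · obtain ⟨m, hm⟩ := hX.lab.exists_iterate hd
    clear hd
    induction m using Nat.strong_induction_on generalizing d with
    | _ m ih =>
      rcases Nat.lt_or_ge m (len d) with h1 | h1
      · have h2 := hzero _ _ _ h1 hm
        rw [h2, Function.iterate_zero_apply] at hm
        rw [h.inj hm]
      · refine sameCycle_apply_left.1 (ih (m - len d) (by have := hpos d; omega) _ ?_)
        rw [Perm.mul_apply, ← hnext, ← Function.iterate_add_apply, Nat.sub_add_cancel h1, hm]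
  · exact ((sameCycle_iff_forall_invariant _ _ _).1 hd (fun d'' => fc (β d) = fc (β d''))
      fun d'' => by rw [Perm.mul_apply, ← hnext, hX.lab.iterate]).1 rfl
  · rw [← hX.card_fibre, Nat.card_eq_fintype_card, Fintype.card_subtype]
    rw [Finset.sum_congr rfl fun d _ => (Finset.card_range (len d)).symm, ← Finset.card_sigma]
    refine Finset.card_bij (fun p _ => φ^[p.2] (β p.1)) ?_ ?_ ?_
    · intro p hpm
      simpa [hX.lab.iterate] using (Finset.mem_sigma.1 hpm).1
    · rintro ⟨d, j⟩ h1 ⟨d', j'⟩ h2 heq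
      have hj := Finset.mem_range.1 (Finset.mem_sigma.1 h1).2
      have hj' := Finset.mem_range.1 (Finset.mem_sigma.1 h2).2
      rcases le_total j j' with hle | hle
      · obtain ⟨rfl, rfl⟩ := hinj _ _ _ _ hj hj' hle heq
        rfl
      · obtain ⟨rfl, rfl⟩ := hinj _ _ _ _ hj' hj hle heq.symm
        rfl
    · intro x hx
      obtain ⟨d, j, hj, rfl⟩ := hcover x
      refine ⟨⟨d, j⟩, Finset.mem_sigma.2 ⟨?_, Finset.mem_range.2 hj⟩, rfl⟩
      simpa [hX.lab.iterate] using hx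

end IsReducedGluing

theorem card_eq_of_existsUnique {α β : Type*} (r : α → β → Prop) (h1 : ∀ a, ∃! b, r a b)
    (h2 : ∀ b, ∃! a, r a b) : Nat.card α = Nat.card β := by
  choose f hf hf' using h1
  choose e he he' using h2
  exact Nat.card_congr ⟨f, e, fun a => (he' _ _ (hf a)).symm, fun b => (hf' _ _ (he b)).symm⟩

/-- The edge of a half-edge and its length are determined by the subdivided graph. -/
theorem IsContraction.unique {φ ι : Perm X} {g : ℕ} {β : Y → X} (h : IsReducedGluing φ g s ι β)
    {σ₁ ι₁ σ₂ ι₂ : Perm Y} {len₁ len₂ : Y → ℕ} (h₁ : IsContraction φ ι σ₁ ι₁ len₁ β)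
    (h₂ : IsContraction φ ι σ₂ ι₂ len₂ β) (hp₁ : IsPairing ι₁) (hp₂ : IsPairing ι₂) :
    σ₁ = σ₂ ∧ ι₁ = ι₂ ∧ len₁ = len₂ := by
  have key : ∀ {σ₁ ι₁ σ₂ ι₂ : Perm Y} {len₁ len₂ : Y → ℕ},
      IsContraction φ ι σ₁ ι₁ len₁ β → IsContraction φ ι σ₂ ι₂ len₂ β → IsPairing ι₁ →
      ∀ d, len₁ d ≤ len₂ d := by
    intro σ₁ ι₁ σ₂ ι₂ len₁ len₂ h₁ h₂ hp d
    by_contra! hlt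
    have h3 := h₁.interior hp (h₂.pos d) hlt
    rw [h₂.next] at h3
    exact (h.range _).1 ⟨_, rfl⟩ h3
  have hlen : len₁ = len₂ := funext fun d => le_antisymm (key h₁ h₂ hp₁ d) (key h₂ h₁ hp₂ d)
  subst hlen
  refine ⟨?_, ?_, rfl⟩
  · ext d
    rw [h.inj ((h₁.apply_apply hp₁ d).symm.trans (h₂.apply_apply hp₂ d))]
  · ext d
    have h3 := h₁.rev d (len₁ d - 1) (by have := h₁.pos d; omega)
    rw [h₂.rev d (len₁ d - 1) (by have := h₁.pos d; omega), Nat.sub_self] at h3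
    rw [h.inj h3]

/-- Reduced gluings correspond to placed fatgraphs. -/
theorem card_reducedGluings [Fintype X] {φ : Perm X} {fc : X → Fin s} {P : Fin s → ℕ+}
    (hX : CircleSystem φ fc fun I => (P I : ℕ)) {g : ℕ} (hgs : 2 < 2 * g + s) (n : ℕ) :
    Nat.card {t : Perm X × (Fin n → X) // IsReducedGluing φ g s t.1 t.2} =
      Nat.card (Σ t : {t : Perm (Fin n) × Perm (Fin n) × (Fin n → Fin s) //
          IsFatgraph t.1 t.2.1 t.2.2 ∧ EulerEq t.1 g s},
        Σ len : {len : Fin n → ℕ+ // (∀ d, len (t.1.2.1 d) = len d) ∧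
          ∀ I, ∑ d ∈ Finset.univ.filter (fun d => t.1.2.2 d = I), (len d : ℕ) = (P I : ℕ)},
        {β : Fin n → X //
          IsPlacement φ fc (t.1.1 * t.1.2.1) t.1.2.2 (fun d => (len.1 d : ℕ)) β}) := by
  refine card_eq_of_existsUnique (fun a b => a.1.2 = b.2.2.1 ∧
    IsContraction φ a.1.1 b.1.1.1 b.1.1.2.1 (fun d => (b.2.1.1 d : ℕ)) a.1.2) ?_ ?_
  · rintro ⟨⟨ι, β⟩, h⟩
    obtain ⟨σ', ι', face, len, hF, hC⟩ := h.exists_fatgraph hgs hX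
    refine ⟨⟨⟨⟨σ', ι', face⟩, hF.fat, hF.euler⟩, ⟨fun d => ⟨len d, hF.pos d⟩,
      fun d => PNat.eq (hF.len_eq d), hF.perim⟩, ⟨β, hF.placed⟩⟩, ⟨rfl, hC⟩, ?_⟩
    rintro ⟨⟨⟨σ₂, ι₂, face₂⟩, hf₂, he₂⟩, ⟨len₂, hl₂, hp₂⟩, ⟨β₂, hβ₂⟩⟩ ⟨heq, hC₂⟩
    dsimp only at heq hC hC₂ hβ₂ hf₂ hF
    subst heq
    obtain ⟨rfl, rfl, h3⟩ := hC₂.unique h hC hf₂.pairing hF.fat.pairing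
    obtain rfl : face₂ = face := funext fun d => (hβ₂.2 d).symm.trans (hF.placed.2 d)
    obtain rfl : len₂ = fun d => ⟨len d, hF.pos d⟩ := funext fun d => PNat.eq (congrFun h3 d)
    rfl
  · rintro ⟨⟨⟨σ', ι', face⟩, hf, he⟩, ⟨len, hl, hp⟩, ⟨β, hβ⟩⟩
    have hF : IsPlacedFatgraph φ fc (fun I => (P I : ℕ)) g σ' ι' face (fun d => (len d : ℕ)) β :=
      ⟨hf, he, fun d => (len d).pos, fun d => congrArg PNat.val (hl d), hp, hβ⟩
    obtain ⟨ι, hι, hC⟩ := hF.exists_gluing hX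
    refine ⟨⟨⟨ι, β⟩, hι⟩, ⟨rfl, hC⟩, ?_⟩
    rintro ⟨⟨ι₂, β₂⟩, hι₂⟩ ⟨heq, hC₂⟩
    dsimp only at heq hC₂
    subst heq
    have : ι₂ = ι := by
      ext x
      obtain ⟨d, j, hj, rfl⟩ := exists_mem_segment hX.lab hf.surj hF.pos hβ x
      rw [hC.rev d j hj, hC₂.rev d j hj]
    subst this
    rfl

open Classical in
/-- For each fatgraph with lengths there are `∏ I, P I` placements. -/
theorem card_placedFatgraphs [Fintype X] {φ : Perm X} {fc : X → Fin s} {P : Fin s → ℕ+}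
    (hX : CircleSystem φ fc fun I => (P I : ℕ)) {g : ℕ} (hgs : 2 < 2 * g + s) (n : ℕ) :
    Nat.card {t : Perm X × (Fin n → X) // IsReducedGluing φ g s t.1 t.2} =
      (∏ I, (P I : ℕ)) * ∑ t : Perm (Fin n) × Perm (Fin n) × (Fin n → Fin s),
        if IsFatgraph t.1 t.2.1 t.2.2 ∧ EulerEq t.1 g s then
          Nat.card {len : Fin n → ℕ+ // (∀ d, len (t.2.1 d) = len d) ∧
            ∀ I, ∑ d ∈ Finset.univ.filter (fun d => t.2.2 d = I), (len d : ℕ) = (P I : ℕ)}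
        else 0 := by
  have hfin : ∀ t : {t : Perm (Fin n) × Perm (Fin n) × (Fin n → Fin s) //
      IsFatgraph t.1 t.2.1 t.2.2 ∧ EulerEq t.1 g s},
      Finite {len : Fin n → ℕ+ // (∀ d, len (t.1.2.1 d) = len d) ∧
      ∀ I, ∑ d ∈ Finset.univ.filter (fun d => t.1.2.2 d = I), (len d : ℕ) = (P I : ℕ)} :=
    fun t => Fatgraph.finite_lengths (Fatgraph.ofIsFatgraph t.2.1) P
  rw [card_reducedGluings hX hgs, Nat.card_sigma, ← Finset.sum_filter]
  rw [Finset.sum_subtype (p := fun t : Perm (Fin n) × Perm (Fin n) × (Fin n → Fin s) =>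
    IsFatgraph t.1 t.2.1 t.2.2 ∧ EulerEq t.1 g s) _ (by simp), Finset.mul_sum]
  refine Finset.sum_congr rfl fun t _ => ?_
  have := Fintype.ofFinite {len : Fin n → ℕ+ // (∀ d, len (t.1.2.1 d) = len d) ∧
      ∀ I, ∑ d ∈ Finset.univ.filter (fun d => t.1.2.2 d = I), (len d : ℕ) = (P I : ℕ)}
  rw [Nat.card_sigma, Finset.sum_congr rfl fun len _ =>
    card_placements hX ⟨t.2.1.surj, t.2.1.face_iff⟩ len.2.2]
  rw [Finset.sum_const, Finset.card_univ, smul_eq_mul, mul_comm, Nat.card_eq_fintype_card]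

/-- The subset `D` has `n!` numberings if it has `n` elements, and no numberings of other
lengths. -/
theorem card_numberings [Finite X] (D : X → Prop) (n : ℕ) :
    Nat.card {β : Fin n → X // Function.Injective β ∧ ∀ x, x ∈ Set.range β ↔ D x} =
      if n = Nat.card {x // D x} then n.factorial else 0 := by
  classical
  have := Fintype.ofFinite X
  have e : {β : Fin n → X // Function.Injective β ∧ ∀ x, x ∈ Set.range β ↔ D x} ≃
      (Fin n ≃ {x // D x}) :=
    { toFun := fun β => Equiv.ofBijective (fun d => ⟨β.1 d, (β.2.2 _).1 ⟨d, rfl⟩⟩)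
        ⟨fun d d' h => β.2.1 (congrArg Subtype.val h), fun x => by
          obtain ⟨d, hd⟩ := (β.2.2 x.1).2 x.2
          exact ⟨d, Subtype.ext hd⟩⟩
      invFun := fun e => ⟨fun d => (e d).1, fun d d' h => e.injective (Subtype.ext h), fun x =>
        ⟨by rintro ⟨d, rfl⟩; exact (e d).2, fun hx => ⟨e.symm ⟨x, hx⟩, by simp⟩⟩⟩
      left_inv := fun β => rfl
      right_inv := fun e => Equiv.ext fun d => rfl }
  rw [Nat.card_congr e]
  split_ifs with h
  · have hn : Fintype.card (Fin n) = Fintype.card {x // D x} := by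
      rw [Fintype.card_fin, h, Nat.card_eq_fintype_card]
    rw [Nat.card_eq_fintype_card, Fintype.card_equiv (Fintype.equivOfCardEq hn), Fintype.card_fin]
  · refine Nat.card_eq_zero.2 (Or.inl ⟨fun f => h ?_⟩)
    rw [← Nat.card_congr f, Nat.card_fin]

/-- The numberings of the half-edges at vertices of valency at least three cancel the factor
`1 / n!`. -/
theorem sum_card_reducedGluings [Finite X] (φ : Perm X) (g s : ℕ) {M : ℕ} (hM : Nat.card X < M) :
    ∑ n ∈ Finset.range M, (Nat.card {t : Perm X × (Fin n → X) // IsReducedGluing φ g s t.1 t.2} : ℚ) /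
      (n.factorial : ℚ) = reducedCount φ (fun _ => True) g s := by
  classical
  have := Fintype.ofFinite X
  let D : Perm X → X → Prop := fun ι x => φ (ι (φ (ι x))) ≠ x
  have h1 : ∀ n, Nat.card {t : Perm X × (Fin n → X) // IsReducedGluing φ g s t.1 t.2} =
      ∑ ι : {ι : Perm X // GluesTo φ g s ι ∧ ∀ x, True → ι x ≠ φ x},
        if n = Nat.card {x // D ι.1 x} then n.factorial else 0 := by
    intro n
    have e : {t : Perm X × (Fin n → X) // IsReducedGluing φ g s t.1 t.2} ≃
        Σ ι : {ι : Perm X // GluesTo φ g s ι ∧ ∀ x, True → ι x ≠ φ x},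
          {β : Fin n → X // Function.Injective β ∧ ∀ x, x ∈ Set.range β ↔ D ι.1 x} :=
      { toFun := fun t => ⟨⟨t.1.1, t.2.glues, fun x _ => t.2.reduced x⟩,
          ⟨t.1.2, t.2.inj, t.2.range⟩⟩
        invFun := fun t => ⟨(t.1.1, t.2.1), t.1.2.1, fun x => t.1.2.2 x trivial, t.2.2.1, t.2.2.2⟩
        left_inv := fun _ => rfl
        right_inv := fun _ => rfl }
    rw [Nat.card_congr e, Nat.card_sigma]
    exact Finset.sum_congr rfl fun ι _ => card_numberings _ n
  simp_rw [h1]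
  push_cast
  simp_rw [Finset.sum_div]
  rw [Finset.sum_comm, reducedCount, Nat.card_eq_fintype_card, ← Finset.card_univ,
    Finset.card_eq_sum_ones, Nat.cast_sum]
  refine Finset.sum_congr rfl fun ι _ => ?_
  rw [Finset.sum_eq_single (Nat.card {x // D ι.1 x})]
  · rw [if_pos rfl, div_self (by exact_mod_cast Nat.factorial_ne_zero _), Nat.cast_one]
  · intro n _ hn
    rw [if_neg hn, zero_div]
  · intro hn
    refine absurd (Finset.mem_range.2 (lt_of_le_of_lt ?_ hM)) hn
    exact Nat.card_le_card_of_injective _ Subtype.val_injective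

open Classical in
/-- The discrete volume as a sum over labelled fatgraphs with lengths, weighted by `1 / n!`. -/
theorem discreteVolume_eq_sum_range (g s : ℕ) (P : Fin s → ℕ+) {M : ℕ}
    (hM : 12 * g + 6 * s + 1 ≤ M) :
    discreteVolume g s P = ∑ n ∈ Finset.range M,
      (∑ t : Perm (Fin n) × Perm (Fin n) × (Fin n → Fin s),
        if IsFatgraph t.1 t.2.1 t.2.2 ∧ EulerEq t.1 g s then
          (Nat.card {len : Fin n → ℕ+ // (∀ d, len (t.2.1 d) = len d) ∧
            ∀ I, ∑ d ∈ Finset.univ.filter (fun d => t.2.2 d = I), (len d : ℕ) = (P I : ℕ)} : ℚ)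
        else 0) / (n.factorial : ℚ) := by
  have h1 := sum_fatgraphOfGenus g s fun n _ ι face =>
    (Nat.card {len : Fin n → ℕ+ // (∀ d, len (ι d) = len d) ∧
      ∀ I, ∑ d ∈ Finset.univ.filter (fun d => face d = I), (len d : ℕ) = (P I : ℕ)} : ℚ) /
        (n.factorial : ℚ)
  rw [discreteVolume_eq_sum]
  refine Eq.trans ?_ (h1.trans ?_)
  · refine Finset.sum_congr rfl fun G _ => ?_
    simp only [Fatgraph.Lengths]
  · rw [← Finset.sum_subset (Finset.range_subset_range.2 hM)]
    · refine Finset.sum_congr rfl fun n _ => ?_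
      rw [Finset.sum_div]
      refine Finset.sum_congr rfl fun t _ => ?_
      rw [ite_div, zero_div]
    · intro n _ hn
      rw [Finset.sum_eq_zero, zero_div]
      intro t _
      rw [if_neg]
      rintro ⟨h2, h3⟩
      refine hn (Finset.mem_range.2 ?_)
      exact (Fatgraph.ofIsFatgraph h2).n_lt ((Fatgraph.hasGenus_iff _ g).2 h3)

/-- Reduced gluings are subdivided fatgraphs with a marked point on the boundary of each face. -/
theorem CircleSystem.reducedCount_eq [Finite X] {φ : Perm X} {fc : X → Fin s} {P : Fin s → ℕ+}
    (hX : CircleSystem φ fc fun I => (P I : ℕ)) {g : ℕ} (hgs : 2 < 2 * g + s) :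
    (reducedCount φ (fun _ => True) g s : ℚ) = (∏ I, (P I : ℚ)) * discreteVolume g s P := by
  classical
  have := Fintype.ofFinite X
  rw [← sum_card_reducedGluings φ g s (M := Nat.card X + 1 + (12 * g + 6 * s + 1)) (by omega),
    discreteVolume_eq_sum_range g s P (M := Nat.card X + 1 + (12 * g + 6 * s + 1)) (by omega),
    Finset.mul_sum]
  refine Finset.sum_congr rfl fun n _ => ?_
  rw [card_placedFatgraphs hX hgs, ← mul_div_assoc]
  push_cast
  rfl

theorem circleSystem_starsRotation {P : Fin s → ℕ} (hP : ∀ I, 0 < P I) :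
    CircleSystem (starsRotation P) Sigma.fst P := by
  refine ⟨⟨fun I => ⟨⟨I, ⟨0, hP I⟩⟩, rfl⟩, ?_⟩, fun I => ?_⟩
  · rintro ⟨I, j⟩ ⟨I', j'⟩
    constructor
    · rintro (rfl : I = I')
      refine (sameCycle_iff_forall_invariant _ _ _).2 fun f hf => ?_
      exact (sameCycle_iff_forall_invariant _ _ _).1 (sameCycle_finRotate j j')
        (fun j => f ⟨I, j⟩) fun j => hf ⟨I, j⟩
    · intro h
      exact ((sameCycle_iff_forall_invariant _ _ _).1 h (fun x => I = x.1) fun _ => Iff.rfl).1 rfl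
  · refine (Nat.card_congr ?_).trans (Nat.card_fin (P I))
    exact { toFun := fun x => x.2 ▸ x.1.2
            invFun := fun j => ⟨⟨I, j⟩, rfl⟩
            left_inv := by rintro ⟨⟨I, j⟩, rfl⟩; rfl
            right_inv := fun _ => rfl }

/-- A gluing of stars is a fatgraph with lengths of edges and marked boundaries, to which trees are
attached. -/
theorem genusMean_eq_sum {g : ℕ} (hs : 0 < s) (hgs : 2 < 2 * g + s) (k : Fin s → ℕ+) :
    genusMean g (fun i => (k i : ℕ)) = ∑ P ∈ Fintype.piFinset fun i => Finset.Icc 1 (k i),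
      (∏ i, (backtrackCount (k i) (P i) : ℂ)) *
        ((∏ i, ((P i : ℕ) : ℂ)) * (discreteVolume g s P : ℂ)) := by
  rw [genusMean_eq_gluingCount hs (fun i => (k i).pos), gluingCount_expand hgs fun i => (k i).pos]
  push_cast
  symm
  refine Finset.sum_nbij' (fun P i => (P i : ℕ)) (fun P i => (P i).toPNat') ?_ ?_ ?_ ?_ ?_
  · intro P hP
    rw [Fintype.mem_piFinset] at hP ⊢
    intro i
    have := Finset.mem_Icc.1 (hP i)
    exact Finset.mem_Icc.2 ⟨(P i).pos, by exact_mod_cast this.2⟩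
  · intro P hP
    rw [Fintype.mem_piFinset] at hP ⊢
    intro i
    have := Finset.mem_Icc.1 (hP i)
    refine Finset.mem_Icc.2 ⟨one_le, ?_⟩
    rw [← PNat.coe_le_coe, Nat.toPNat'_coe, if_pos (by omega)]
    exact this.2
  · intro P _
    funext i
    exact PNat.eq (by rw [Nat.toPNat'_coe, if_pos (P i).pos])
  · intro P hP
    rw [Fintype.mem_piFinset] at hP
    funext i
    have := Finset.mem_Icc.1 (hP i)
    dsimp only
    rw [Nat.toPNat'_coe, if_pos (by omega)]
  · intro P _
    congr 1
    have := (circleSystem_starsRotation fun I => (P I).pos).reducedCount_eq (P := P) hgs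
    have h2 := congrArg (fun q : ℚ => (q : ℂ)) this
    push_cast at h2
    exact h2.symm

end Contraction

/-! ### Resolvents -/

theorem backtrackCount_le (n P : ℕ) : backtrackCount n P ≤ 2 ^ n := by
  induction n generalizing P with
  | zero => rw [backtrackCount]; split_ifs <;> simp
  | succ n ih =>
    cases P with
    | zero => rw [backtrackCount, pow_succ]; linarith [ih 1]
    | succ P => rw [backtrackCount, pow_succ]; linarith [ih P, ih (P + 2)]

theorem norm_zpow_mul_backtrackCount_le {x : ℂ} (hx : 2 < ‖x‖) (n P : ℕ) :
    ‖x ^ (-(n : ℤ) - 1) * (backtrackCount n P : ℂ)‖ ≤ ‖x‖⁻¹ * (2 * ‖x‖⁻¹) ^ n := by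
  have h0 : 0 < ‖x‖ := by linarith
  have hx0 : x ≠ 0 := norm_pos_iff.1 h0
  have h1 : (backtrackCount n P : ℝ) ≤ 2 ^ n := by exact_mod_cast backtrackCount_le n P
  have h2 : x ^ (-(n : ℤ) - 1) = x⁻¹ * (x⁻¹) ^ n := by
    rw [zpow_sub₀ hx0, zpow_neg, zpow_natCast, zpow_one, inv_pow]
    field_simp
  rw [h2, norm_mul, norm_mul, norm_pow, norm_inv, Complex.norm_natCast, mul_pow, mul_assoc]
  rw [mul_comm (2 ^ n)]
  gcongr

theorem summable_backtrack {x : ℂ} (hx : 2 < ‖x‖) (P : ℕ) :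
    Summable fun n : ℕ => x ^ (-(n : ℤ) - 1) * (backtrackCount n P : ℂ) := by
  refine Summable.of_norm_bounded (g := fun n : ℕ => ‖x‖⁻¹ * (2 * ‖x‖⁻¹) ^ n) ?_
    fun n => norm_zpow_mul_backtrackCount_le hx n P
  refine (summable_geometric_of_lt_one (by positivity) ?_).mul_left _
  rw [← div_eq_mul_inv, div_lt_one (by linarith)]
  exact hx

/-- The generating function of the backtracking walks. By the recursion of Pascal's triangle, it is
the solution of a linear recursion that does not grow. -/
theorem tsum_backtrack {q : ℂ} (hq : q ≠ 0) (hq1 : ‖q‖ < 1) (hx : 2 < ‖q⁻¹ + q‖) (P : ℕ) :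
    ∑' n : ℕ, (q⁻¹ + q) ^ (-(n : ℤ) - 1) * (backtrackCount n P : ℂ) = q ^ P / (q⁻¹ - q) := by
  set x := q⁻¹ + q with hxdef
  have hx0 : x ≠ 0 := norm_pos_iff.1 (by linarith)
  set S : ℕ → ℂ := fun P => ∑' n : ℕ, x ^ (-(n : ℤ) - 1) * (backtrackCount n P : ℂ) with hS
  set C : ℝ := ∑' n : ℕ, ‖x‖⁻¹ * (2 * ‖x‖⁻¹) ^ n with hC
  have hgeo : Summable fun n : ℕ => ‖x‖⁻¹ * (2 * ‖x‖⁻¹) ^ n := by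
    refine (summable_geometric_of_lt_one (by positivity) ?_).mul_left _
    rw [← div_eq_mul_inv, div_lt_one (by linarith)]
    exact hx
  have hbound : ∀ P, ‖S P‖ ≤ C := fun P =>
    tsum_of_norm_bounded hgeo.hasSum fun n => norm_zpow_mul_backtrackCount_le hx n P
  have hshift : ∀ P, x * S P = (backtrackCount 0 P : ℂ) +
      ∑' n : ℕ, x ^ (-(n : ℤ) - 1) * (backtrackCount (n + 1) P : ℂ) := by
    intro P
    simp only [hS]
    rw [(summable_backtrack hx P).tsum_eq_zero_add, mul_add, ← tsum_mul_left]
    congr 1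
    · simp [zpow_neg, hx0]
    · refine tsum_congr fun n => ?_
      rw [← mul_assoc, ← zpow_one_add₀ hx0]
      congr 2
      push_cast
      ring
  have hrec0 : x * S 0 = 1 + 2 * S 1 := by
    rw [hshift, ← tsum_mul_left]
    congr 1
    · simp [backtrackCount]
    · refine tsum_congr fun n => ?_
      rw [backtrackCount]
      push_cast
      ring
  have hrec : ∀ P, x * S (P + 1) = S P + S (P + 2) := by
    intro P
    rw [hshift, ← (summable_backtrack hx P).tsum_add (summable_backtrack hx (P + 2))]
    simp only [backtrackCount]
    rw [if_neg (Nat.succ_ne_zero _), Nat.cast_zero, zero_add]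
    refine tsum_congr fun n => ?_
    push_cast
    ring
  -- the failure of `S (P + 1) = q * S P` is multiplied by `q⁻¹` in each step, while `S` is bounded
  have hT : ∀ P, S 1 - q * S 0 = q ^ P * (S (P + 1) - q * S P) := by
    intro P
    induction P with
    | zero => simp
    | succ P ih =>
      rw [ih, pow_succ, mul_assoc]
      congr 1
      have h1 := hrec P
      have h2 : q * x = 1 + q * q := by rw [hxdef, mul_add, mul_inv_cancel₀ hq]
      linear_combination q * h1 - S (P + 1) * h2
  have hT0 : S 1 - q * S 0 = 0 := by
    have hlim : Filter.Tendsto (fun P => q ^ P * (S (P + 1) - q * S P)) Filter.atTop (nhds 0) := by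
      refine squeeze_zero_norm (a := fun P => ‖q‖ ^ P * (C + C)) (fun P => ?_) ?_
      · rw [norm_mul, norm_pow]
        refine mul_le_mul_of_nonneg_left ?_ (by positivity)
        refine (norm_sub_le _ _).trans (add_le_add (hbound _) ?_)
        rw [norm_mul]
        exact (mul_le_of_le_one_left (norm_nonneg _) hq1.le).trans (hbound _)
      · simpa using (tendsto_pow_atTop_nhds_zero_of_lt_one (norm_nonneg q) hq1).mul_const (C + C)
    refine tendsto_nhds_unique ?_ hlim
    exact (tendsto_const_nhds (x := S 1 - q * S 0)).congr hT
  have hstep : ∀ P, S P = q ^ P * S 0 := by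
    intro P
    induction P with
    | zero => simp
    | succ P ih =>
      have h1 := hT P
      rw [hT0, eq_comm, mul_eq_zero] at h1
      rcases h1 with h1 | h1
      · exact absurd h1 (pow_ne_zero _ hq)
      · rw [pow_succ', mul_assoc, ← ih]
        exact sub_eq_zero.1 h1
  have hS0 : (q⁻¹ - q) * S 0 = 1 := by
    linear_combination hrec0 + 2 * hT0
  change S P = _
  rw [hstep, eq_div_iff (left_ne_zero_of_mul_eq_one hS0), mul_assoc, mul_comm (S 0), hS0, mul_one]

/-- The sum over the lengths `k` of the cycles that reduce to a cycle of length `P`. -/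
theorem hasSum_backtrack {l : ℂ} (hl : 0 < l.re)
    (hx : 2 < ‖Complex.exp l + Complex.exp (-l)‖) (P : ℕ+) :
    HasSum (fun k : ℕ+ => (Complex.exp l + Complex.exp (-l)) ^ (-((k : ℕ) : ℤ) - 1) *
      (backtrackCount k P : ℂ))
      (Complex.exp (-((P : ℕ) : ℂ) * l) * (1 / (Complex.exp l - Complex.exp (-l)))) := by
  have hq1 : ‖Complex.exp (-l)‖ < 1 := by
    rw [Complex.norm_exp, Complex.neg_re, Real.exp_lt_one_iff]; linarith
  have hinv : Complex.exp l = (Complex.exp (-l))⁻¹ := by rw [Complex.exp_neg, inv_inv]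
  have hs := summable_backtrack hx P
  have ht := tsum_backtrack (Complex.exp_ne_zero (-l)) hq1 (by rw [← hinv]; exact hx) P
  rw [← hinv] at ht
  have h1 := hs.hasSum
  rw [ht] at h1
  have h2 := (hasSum_nat_add_iff' (f := fun n : ℕ =>
    (Complex.exp l + Complex.exp (-l)) ^ (-(n : ℤ) - 1) * (backtrackCount n P : ℂ)) 1).2 h1
  rw [Finset.sum_range_one, show backtrackCount 0 P = 0 from if_neg P.ne_zero] at h2
  simp only [Nat.cast_zero, mul_zero, sub_zero] at h2
  rw [← Equiv.pnatEquivNat.symm.hasSum_iff, mul_one_div]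
  rw [← Complex.exp_nat_mul] at h2
  rw [neg_mul, ← mul_neg]
  refine h2.congr_fun fun n => ?_
  simp

/-- Real points at which the resolvent dominates: `‖x‖` is itself of the form `e ^ m + e ^ (-m)`. -/
theorem exists_real_of_two_lt {r : ℝ} (hr : 2 < r) : ∃ m : ℝ, 0 < m ∧
    r = Real.exp m + Real.exp (-m) := by
  obtain ⟨m, hm, h⟩ := Real.cosh_surjOn (show r / 2 ∈ Set.Ici 1 from by
    rw [Set.mem_Ici]; linarith)
  rw [Real.cosh_eq] at h
  refine ⟨m, lt_of_le_of_ne hm ?_, by linarith⟩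
  rintro rfl
  norm_num at h
  linarith

/-- The norms of the terms sum to the value at a real point. -/
theorem hasSum_norm_backtrack {x : ℂ} {m : ℝ} (hm : 0 < m)
    (hx : 2 < ‖x‖) (hxm : ‖x‖ = Real.exp m + Real.exp (-m)) (P : ℕ+) :
    HasSum (fun k : ℕ+ => ((‖x ^ (-((k : ℕ) : ℤ) - 1) * (backtrackCount k P : ℂ)‖ : ℝ) : ℂ))
      (Complex.exp (-((P : ℕ) : ℂ) * m) * (1 / (Complex.exp m - Complex.exp (-m)))) := by
  have hxm' : (Complex.exp m + Complex.exp (-m)) = ((‖x‖ : ℝ) : ℂ) := by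
    rw [hxm]; push_cast; rfl
  have h := hasSum_backtrack (l := (m : ℂ)) (by simpa using hm)
    (by rw [hxm', Complex.norm_real, norm_norm]; exact hx) P
  rw [hxm'] at h
  convert h using 2 with k
  rw [norm_mul, norm_zpow, Complex.norm_natCast]
  push_cast
  rfl

/-- The factor `P` is absorbed by half of the exponential decay. -/
theorem summable_weightedLaplaceTerm (g : ℕ) {s : ℕ} {l : Fin s → ℂ} (hl : ∀ I, 0 < (l I).re) :
    Summable (weightedLaplaceTerm g l) := by
  have h := (laplaceVolume_eq_shapeSum g (l := fun I => l I / 2) fun I => by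
    have := hl I
    simpa using this).1
  refine Summable.of_norm_bounded (h.norm.mul_left (∏ I, 2 / (l I).re)) fun P => ?_
  rw [weightedLaplaceTerm, laplaceTerm, norm_mul, norm_mul, ← Finset.sum_neg_distrib,
    Complex.exp_sum, norm_prod, norm_prod, mul_comm ‖((discreteVolume g s P : ℚ) : ℂ)‖, ← mul_assoc,
    ← Finset.prod_mul_distrib]
  refine mul_le_mul_of_nonneg_right ?_ (norm_nonneg _)
  refine Finset.prod_le_prod (fun _ _ => norm_nonneg _) fun I _ => ?_
  have hI := hl I
  have e1 : (-((P I : ℕ) : ℂ) * l I).re = -((P I : ℕ) : ℝ) * (l I).re := by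
    simp
  have e2 : (-(((P I : ℕ) : ℂ) * (l I / 2))).re = -((P I : ℕ) : ℝ) * (l I).re / 2 := by
    simp
    ring
  rw [norm_mul, Complex.norm_natCast, Complex.norm_exp, Complex.norm_exp, e1, e2]
  set y : ℝ := ((P I : ℕ) : ℝ) * (l I).re / 2 with hy
  have h1 : y ≤ Real.exp y := by linarith [Real.add_one_le_exp y]
  have h2 : ((P I : ℕ) : ℝ) = 2 / (l I).re * y := by rw [hy]; field_simp
  have h3 : -((P I : ℕ) : ℝ) * (l I).re = -y + -y := by rw [hy]; ring
  have h4 : -((P I : ℕ) : ℝ) * (l I).re / 2 = -y := by rw [hy]; ring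
  rw [h4, h3, Real.exp_add]
  have h5 : y * Real.exp (-y) ≤ 1 := by
    calc y * Real.exp (-y) ≤ Real.exp y * Real.exp (-y) := by gcongr
      _ = 1 := by rw [← Real.exp_add, add_neg_cancel, Real.exp_zero]
  calc ((P I : ℕ) : ℝ) * (Real.exp (-y) * Real.exp (-y))
      = 2 / (l I).re * (y * Real.exp (-y)) * Real.exp (-y) := by rw [h2]; ring
    _ ≤ 2 / (l I).re * 1 * Real.exp (-y) := by gcongr
    _ = 2 / (l I).re * Real.exp (-y) := by rw [mul_one]

/-- The term of the double series over the valencies `k` of the stars and the perimeters `P`. -/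
def doubleTerm (g : ℕ) {s : ℕ} (x : Fin s → ℂ) (P k : Fin s → ℕ+) : ℂ :=
  (∏ i, x i ^ (-((k i : ℕ) : ℤ) - 1) * (backtrackCount (k i) (P i) : ℂ)) *
    ((∏ i, ((P i : ℕ) : ℂ)) * (discreteVolume g s P : ℂ))

theorem weightedLaplaceTerm_eq (g : ℕ) {s : ℕ} (l : Fin s → ℂ) (P : Fin s → ℕ+) :
    (∏ i, Complex.exp (-((P i : ℕ) : ℂ) * l i) *
      (1 / (Complex.exp (l i) - Complex.exp (-l i)))) *
      ((∏ i, ((P i : ℕ) : ℂ)) * (discreteVolume g s P : ℂ)) =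
    (∏ I, 1 / (Complex.exp (l I) - Complex.exp (-l I))) * weightedLaplaceTerm g l P := by
  rw [weightedLaplaceTerm, Finset.prod_mul_distrib, Finset.prod_mul_distrib]
  ring

/-- For given valencies, the sum over the perimeters is finite. -/
theorem hasSum_doubleTerm_left {g s : ℕ} (hs : 0 < s) (hgs : 2 < 2 * g + s) (x : Fin s → ℂ)
    (k : Fin s → ℕ+) : HasSum (fun P => doubleTerm g x P k) (resolventTerm g x k) := by
  rw [resolventTerm, genusMean_eq_sum hs hgs, Finset.mul_sum]
  have h := hasSum_sum_of_ne_finset_zero (f := fun P => doubleTerm g x P k)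
    (s := Fintype.piFinset fun i => Finset.Icc 1 (k i)) (L := .unconditional _) fun P hP => by
      rw [Fintype.mem_piFinset, not_forall] at hP
      obtain ⟨i, hi⟩ := hP
      have hlt : (k i : ℕ) < P i := by
        by_contra hle
        exact hi (Finset.mem_Icc.2 ⟨one_le, PNat.coe_le_coe _ _ |>.1 (not_lt.1 hle)⟩)
      rw [doubleTerm, Finset.prod_eq_zero (Finset.mem_univ i), zero_mul]
      rw [backtrackCount_eq_zero hlt, Nat.cast_zero, mul_zero]
  convert h using 1
  refine Finset.sum_congr rfl fun P _ => ?_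
  rw [doubleTerm, Finset.prod_mul_distrib, mul_assoc]

/-- For given perimeters, the sum over the valencies is a product of resolvents. -/
theorem hasSum_doubleTerm_right (g : ℕ) {s : ℕ} {l : Fin s → ℂ} (hl : ∀ I, 0 < (l I).re)
    (hx : ∀ I, 2 < ‖Complex.exp (l I) + Complex.exp (-l I)‖) (P : Fin s → ℕ+) :
    HasSum (doubleTerm g (fun I => Complex.exp (l I) + Complex.exp (-l I)) P)
      ((∏ I, 1 / (Complex.exp (l I) - Complex.exp (-l I))) * weightedLaplaceTerm g l P) := by
  have h := fun i => hasSum_backtrack (hl i) (hx i) (P i)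
  have h2 := (hasSum_prod_pi _ fun i => (h i).summable).mul_right
    ((∏ i, ((P i : ℕ) : ℂ)) * (discreteVolume g s P : ℂ))
  simp_rw [fun i => (h i).tsum_eq] at h2
  rw [weightedLaplaceTerm_eq] at h2
  exact h2

theorem hasSum_norm_doubleTerm (g : ℕ) {s : ℕ} {x : Fin s → ℂ} {m : Fin s → ℝ}
    (hm : ∀ I, 0 < m I) (hx : ∀ I, 2 < ‖x I‖)
    (hxm : ∀ I, ‖x I‖ = Real.exp (m I) + Real.exp (-m I)) (P : Fin s → ℕ+) :
    HasSum (fun k => ‖doubleTerm g x P k‖)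
      ‖(∏ I, 1 / (Complex.exp (m I) - Complex.exp (-m I))) *
        weightedLaplaceTerm g (fun I => (m I : ℂ)) P‖ := by
  have h := fun i => hasSum_norm_backtrack (hm i) (hx i) (hxm i) (P i)
  have h1 := hasSum_prod_pi _ fun i => (h i).summable
  simp_rw [fun i => (h i).tsum_eq, ← Complex.ofReal_prod, ← norm_prod] at h1
  have h2 : ‖∏ i, Complex.exp (-((P i : ℕ) : ℂ) * (m i)) *
      (1 / (Complex.exp (m i) - Complex.exp (-m i)))‖ =
      ∏ i, Real.exp (-((P i : ℕ) : ℝ) * m i) * (1 / (Real.exp (m i) - Real.exp (-m i))) := by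
    rw [norm_prod]
    refine Finset.prod_congr rfl fun i _ => ?_
    have h3 : Complex.exp (-((P i : ℕ) : ℂ) * (m i)) *
        (1 / (Complex.exp (m i) - Complex.exp (-m i))) =
        ((Real.exp (-((P i : ℕ) : ℝ) * m i) * (1 / (Real.exp (m i) - Real.exp (-m i))) : ℝ) : ℂ) := by
      push_cast
      rfl
    have h4 : 0 < Real.exp (m i) - Real.exp (-m i) := by
      rw [sub_pos, Real.exp_lt_exp]
      linarith [hm i]
    rw [h3, Complex.norm_real, Real.norm_of_nonneg (by positivity)]
  rw [← weightedLaplaceTerm_eq, norm_mul, h2]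
  have h3 : HasSum (fun k : Fin s → ℕ+ => ‖∏ i, x i ^ (-((k i : ℕ) : ℤ) - 1) *
      (backtrackCount (k i) (P i) : ℂ)‖) (∏ i, Real.exp (-((P i : ℕ) : ℝ) * m i) *
        (1 / (Real.exp (m i) - Real.exp (-m i)))) := by
    rw [← Complex.hasSum_ofReal]
    convert h1 using 1
    push_cast
    rfl
  refine (h3.mul_right _).congr_fun fun k => ?_
  rw [doubleTerm, norm_mul]

/-- The two orders of summation in the double series over valencies and perimeters; absolute
convergence follows by comparison with real parameters `m`. -/
theorem correlator_eq {g s : ℕ} (hs : 0 < s) (hgs : 2 < 2 * g + s) {l : Fin s → ℂ}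
    (hl : ∀ I, 0 < (l I).re) (hx : ∀ I, 2 < ‖Complex.exp (l I) + Complex.exp (-l I)‖) :
    Summable (resolventTerm g fun I => Complex.exp (l I) + Complex.exp (-l I)) ∧
      gaussianCorrelator g (fun I => Complex.exp (l I) + Complex.exp (-l I)) =
        (∏ I, 1 / (Complex.exp (l I) - Complex.exp (-l I))) *
          ∑' P, weightedLaplaceTerm g l P := by
  choose m hm hxm using fun I => exists_real_of_two_lt (hx I)
  have hn := hasSum_norm_doubleTerm g hm hx hxm
  have hF : Summable fun p : (Fin s → ℕ+) × (Fin s → ℕ+) =>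
      doubleTerm g (fun I => Complex.exp (l I) + Complex.exp (-l I)) p.1 p.2 := by
    refine Summable.of_norm ?_
    rw [summable_prod_of_nonneg fun _ => norm_nonneg _]
    refine ⟨fun P => (hn P).summable, ?_⟩
    simp_rw [fun P => (hn P).tsum_eq]
    exact ((summable_weightedLaplaceTerm g (l := fun I => (m I : ℂ))
      fun I => by simpa using hm I).mul_left _).norm
  have hleft := hasSum_doubleTerm_left (g := g) hs hgs
    fun I => Complex.exp (l I) + Complex.exp (-l I)
  have h1 : HasSum (resolventTerm g fun I => Complex.exp (l I) + Complex.exp (-l I)) _ :=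
    hF.prod_symm.hasSum.prod_fiberwise hleft
  have h2 := hF.hasSum.prod_fiberwise (hasSum_doubleTerm_right g hl hx)
  refine ⟨h1.summable, ?_⟩
  rw [gaussianCorrelator, h1.tsum_eq, ← tsum_mul_left, h2.tsum_eq]
  exact (Equiv.prodComm _ _).tsum_eq fun p : (Fin s → ℕ+) × (Fin s → ℕ+) =>
      doubleTerm g (fun I => Complex.exp (l I) + Complex.exp (-l I)) p.1 p.2

end

theorem mainTheorem4 :
    -- the genus expansion of the connected Gaussian means exists and is unique
    (∀ s : ℕ, 0 < s → ∀ k : Fin s → ℕ+,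
      ∃! c : ℕ →₀ ℂ, IsGenusExpansion (fun i => (k i : ℕ)) c) ∧
    (∀ g s : ℕ, 0 < s → 2 < 2 * g + s →
      Finite (Shape g s) ∧
      -- the Laplace transform of the discrete volumes is the sum over shapes
      (∀ l : Fin s → ℂ, (∀ I, 0 < (l I).re) →
        Summable (laplaceTerm g l) ∧ laplaceVolume g l = shapeSum g l) ∧
      -- the Gaussian correlators in terms of the discrete volumes
      (∀ l : Fin s → ℂ, (∀ I, 0 < (l I).re) →
        (∀ I, 2 < ‖Complex.exp (l I) + Complex.exp (-l I)‖) →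
        Summable (resolventTerm g fun I => Complex.exp (l I) + Complex.exp (-l I)) ∧
        Summable (weightedLaplaceTerm g l) ∧
        gaussianCorrelator g (fun I => Complex.exp (l I) + Complex.exp (-l I)) =
          (∏ I, 1 / (Complex.exp (l I) - Complex.exp (-l I))) *
            ∑' P, weightedLaplaceTerm g l P)) ∧
    -- the Kontsevich–Penner matrix model generates the Laplace transforms of the discrete volumes
    (∀ N : ℕ, 1 ≤ N → ∀ l : Fin N → ℝ, (∀ i, 0 < l i) →
      kpmmPartitionFunction l = (PowerSeries.exp ℂ).subst (volumeGeneratingSeries l)) := by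
  refine ⟨fun s hs k => existsUnique_genusExpansion hs fun i => (k i).pos, fun g s hs hgs =>
    ⟨finite_shape g s, fun l hl => laplaceVolume_eq_shapeSum g hl, fun l hl hx => ?_⟩,
    fun N hN l hl => kpmmPartitionFunction_eq_exp hN hl⟩
  exact ⟨(correlator_eq hs hgs hl hx).1, summable_weightedLaplaceTerm g hl,
    (correlator_eq hs hgs hl hx).2⟩
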